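/- **Setting.** Let $\mathbb T^d=\mathbb R^d/2\pi\mathbb Z^d$ with Lebesgue measure, $e_k(x)=(2\pi)^{-d/2}e^{ik\cdot x}$ $(k\in\mathbb Z^d)$, and let $|\cdot|$ be the Euclidean norm. For $a$ on $T^*\mathbb T^d=\mathbb T^d\times\mathbb R^d$ put $\widehat a(k,\xi)=(2\pi)^{-d/2}\int_{\mathbb T^d}a(x,\xi)e^{-ik\cdot x}\,dx$. For $\hbar>0$ the semiclassical Weyl quantization $\operatorname{Op}_\hbar(a)$ is the operator on $L^2(\mathbb T^d)$ with matrix elements $$\langle e_j,\operatorname{Op}_\hbar(a)e_k\rangle=(2\pi)^{-d/2}\,\widehat a\big(j-k,\tfrac{\hbar(j+k)}2\big),$$ and $\widehat L_{\omega,\hbar}=\omega\cdot\hbar D_x$, $D_x=-i\partial_x$, is the self-adjoint operator with $\widehat L_{\omega,\hbar}e_k=\hbar\,(\omega\cdot k)\,e_k$ and domain $\{\psi:\sum_k|\omega\cdot k|^2|\langle e_k,\psi\rangle|^2<\infty\}$. Fix a lattice $\Gamma=\bigoplus_{i=1}^d\mathbb Z v_i$ spanned by a basis $(v_i)$ of $\mathbb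 R^d$, a Schwartz function $\chi_0$ on $\mathbb R^d$ with $\sum_{j\in\Gamma}\chi_j=1$, where $\chi_j=\chi_0(\cdot-j)$, and a constant $C_d>0$. The space $S_W(\mathbb R^d)$ consists of the bounded continuous functions $f$ on $\mathbb R^d$ with $$\|f\|_W=C_d\int_{\mathbb R^d}\sup_{j\in\Gamma}\big|\widehat{\chi_jf}(\eta)\big|\,d\eta<\infty,\qquad \widehat h(\eta)=(2\pi)^{-d/2}\int_{\mathbb R^d} h(\xi)e^{-i\eta\cdot\xi}\,d\xi.$$ For $\rho>0$ the space $\mathcal A_{W,\rho}(T^*\mathbb T^d)$ consists of the real functions $g\in C^\infty(T^*\mathbb T^d)$ with $\widehat g(k,\cdot)\in S_W(\mathbb R^d)$ for all $k$ and $$\|g\|_{W,\rho}=(2\pi)^{-d/2}\sum_{k\in\mathbb Z^d}\|\widehat g(k,\cdot)\|_W\,e^{|k|\rho}<\infty.$$ **Theorem.** Let $\rho>0$, $\varsigma>0$, $\gamma>d$. There is $\delta>0$, depending only on $\rho,\varsigma,\gamma$ and on the fixed data $d,\Gamma,\chi_0,C_d$, such that the following holds. Let $\omega\in\mathbb R^d$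 satisfy $|k\cdot\omega|\ge\varsigma|k|^{-(\gamma-1)}$ for all $k\in\mathbb Z^d\setminus\{0\}$, let $V\in\mathcal A_{W,\rho}(T^*\mathbb T^d)$, and let $(\varepsilon_\hbar)_{\hbar\in(0,1]}$ be positive numbers with $\varepsilon_\hbar\ll\hbar$, that is, $\varepsilon_\hbar/\hbar\to0$ as $\hbar\to0^+$. Then there are unitary operators $\mathcal U_\hbar:L^2(\mathbb T^d)\to L^2(\mathbb T^d)$ and real-valued counterterms $R_\hbar=R_\hbar(\xi)\in S_W(\mathbb R^d)$ with $$\|R_\hbar\|_W\le2\|V\|_{W,\rho}\qquad\text{for all }\hbar\in(0,1],$$ such that the equality of unbounded operators (domains included) $$\mathcal U_\hbar\big(\widehat L_{\omega,\hbar}+\varepsilon_\hbar\operatorname{Op}_\hbar(V-R_\hbar)\big)\mathcal U_\hbar^*=\widehat L_{\omega,\hbar}$$ holds for all sufficiently small $\hbar$ (that is, for all $\hbar\in(0,\hbar_0]$ with some $\hbar_0\in(0,1]$), and more precisely for every $\hbar\in(0,1]$ with $\varepsilon_\hbar\|V\|_{W,\rho}\le\delta\hbar$. -/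

import Mathlib

open Set Filter Topology MeasureTheory
open scoped ENNReal ComplexConjugate FourierTransform SchwartzMap

noncomputable section

namespace TorusKAM

instance instFactTwoPiPos : Fact (0 < 2 * Real.pi) := ⟨Real.two_pi_pos⟩

/-! ### The torus, its Hilbert space and its Fourier basis -/

/-- The flat torus `𝕋^d = ℝ^d / 2πℤ^d`, with Lebesgue measure (of total mass `(2π)^d`). -/
abbrev Torus (d : ℕ) : Type := Fin d → AddCircle (2 * Real.pi)

/-- Euclidean space `ℝ^d`. -/
abbrev Eucl (d : ℕ) : Type := EuclideanSpace ℝ (Fin d)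

/-- The Hilbert space `L²(𝕋^d)` (complex valued, Lebesgue measure). -/
abbrev L2 (d : ℕ) : Type := Lp ℂ 2 (volume : Measure (Torus d))

/-- A point of `ℤ^d` seen in `ℝ^d`. -/
def latticePt {d : ℕ} (k : Fin d → ℤ) : Eucl d := WithLp.toLp 2 fun i => (k i : ℝ)

/-- The class in `𝕋^d` of a point of `ℝ^d`. -/
def toTorus {d : ℕ} (x : Eucl d) : Torus d := fun i => (x i : AddCircle (2 * Real.pi))

/-- The character `x ↦ e^{i k·x}` of the torus, as a continuous function. -/
def character {d : ℕ} (k : Fin d → ℤ) : C(Torus d, ℂ) where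
  toFun x := ∏ i, fourier (k i) (x i)
  continuous_toFun := by fun_prop

/-- The normalizing constant `(2π)^{-d/2}`. -/
def normConst (d : ℕ) : ℝ := (2 * Real.pi) ^ (-(d : ℝ) / 2)

/-- `e_k(x) = (2π)^{-d/2} e^{i k·x}`. -/
def eFun {d : ℕ} (k : Fin d → ℤ) : C(Torus d, ℂ) := (normConst d : ℂ) • character k

theorem character_toTorus {d : ℕ} (k : Fin d → ℤ) (x : Eucl d) :
    character k (toTorus x) = Complex.exp (Complex.I * (inner ℝ (latticePt k) x : ℝ)) := by
  have hpi : (Real.pi : ℂ) ≠ 0 := by exact_mod_cast Real.pi_ne_zero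
  simp only [character, toTorus, ContinuousMap.coe_mk, fourier_coe_apply]
  rw [← Complex.exp_sum]
  congr 1
  simp only [PiLp.inner_apply, latticePt, Complex.ofReal_sum, Finset.mul_sum]
  refine Finset.sum_congr rfl fun i _ => ?_
  simp
  field_simp

theorem character_neg {d : ℕ} (k : Fin d → ℤ) (x : Torus d) :
    character (-k) x = conj (character k x) := by
  simp only [character, Pi.neg_apply, fourier_neg, ContinuousMap.coe_mk, map_prod]

theorem character_add {d : ℕ} (k l : Fin d → ℤ) (x : Torus d) :
    character (k + l) x = character k x * character l x := by
  simp only [character, Pi.add_apply, fourier_add, ContinuousMap.coe_mk, ← Finset.prod_mul_distrib]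

theorem character_zero {d : ℕ} : character (0 : Fin d → ℤ) = 1 := by
  ext x
  simp [character]

theorem character_single {d : ℕ} (z : Torus d) (i : Fin d) :
    character (Pi.single i 1) z = fourier 1 (z i) := by
  simp only [character, ContinuousMap.coe_mk]
  rw [Finset.prod_eq_single i]
  · simp
  · intro j _ hj
    simp [Pi.single_eq_of_ne hj]
  · simp

/-- The span of the characters, as a star subalgebra of `C(𝕋^d)`. -/
def characterAlg (d : ℕ) : StarSubalgebra ℂ C(Torus d, ℂ) where
  toSubalgebra := Algebra.adjoin ℂ (range character)
  star_mem' := by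
    change Algebra.adjoin ℂ (range character) ≤ star (Algebra.adjoin ℂ (range character))
    refine Algebra.adjoin_le ?_
    rintro _ ⟨n, rfl⟩
    refine Algebra.subset_adjoin ⟨-n, ?_⟩
    ext1 x
    simp only [character_neg, starRingEnd_apply, ContinuousMap.star_apply]

theorem characterAlg_coe (d : ℕ) :
    (characterAlg d).toSubalgebra.toSubmodule = Submodule.span ℂ (range character) := by
  apply Algebra.adjoin_eq_span_of_subset
  refine .trans (fun x ↦ Submonoid.closure_induction (fun _ ↦ id) ⟨0, character_zero⟩ ?_)
    Submodule.subset_span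
  rintro _ _ _ _ ⟨m, rfl⟩ ⟨n, rfl⟩
  exact ⟨m + n, by ext z; simp [character_add]⟩

theorem characterAlg_separatesPoints (d : ℕ) : (characterAlg d).SeparatesPoints := by
  intro x y hxy
  rw [Ne, funext_iff, not_forall] at hxy
  obtain ⟨i, hi⟩ := hxy
  refine ⟨_, ⟨character (Pi.single i 1), Algebra.subset_adjoin ⟨Pi.single i 1, rfl⟩, rfl⟩, ?_⟩
  dsimp only
  rw [character_single, character_single, fourier_one, fourier_one]
  intro h
  exact hi (AddCircle.injective_toCircle Real.two_pi_pos.ne' (Circle.ext h))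

theorem span_character_closure_eq_top (d : ℕ) :
    (Submodule.span ℂ (range (character (d := d)))).topologicalClosure = ⊤ := by
  rw [← characterAlg_coe]
  exact congr_arg (Subalgebra.toSubmodule <| StarSubalgebra.toSubalgebra ·)
    (ContinuousMap.starSubalgebra_topologicalClosure_eq_top_of_separatesPoints _
      (characterAlg_separatesPoints d))

theorem normConst_pos (d : ℕ) : 0 < normConst d := Real.rpow_pos_of_pos Real.two_pi_pos _

theorem normConst_sq (d : ℕ) : normConst d * normConst d * (2 * Real.pi) ^ d = 1 := by
  rw [normConst, ← Real.rpow_add Real.two_pi_pos, ← Real.rpow_natCast,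
    ← Real.rpow_add Real.two_pi_pos]
  rw [show -(d : ℝ) / 2 + -(d : ℝ) / 2 + (d : ℝ) = 0 by ring, Real.rpow_zero]

theorem span_eFun_closure_eq_top (d : ℕ) :
    (Submodule.span ℂ (range (eFun (d := d)))).topologicalClosure = ⊤ := by
  have h : Submodule.span ℂ (range (eFun (d := d))) = Submodule.span ℂ (range character) := by
    have hc : (normConst d : ℂ) ≠ 0 := by exact_mod_cast (normConst_pos d).ne'
    apply le_antisymm
    · rw [Submodule.span_le]
      rintro _ ⟨k, rfl⟩
      exact Submodule.smul_mem _ _ (Submodule.subset_span ⟨k, rfl⟩)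
    · rw [Submodule.span_le]
      rintro _ ⟨k, rfl⟩
      have : character k = (normConst d : ℂ)⁻¹ • eFun k := by
        rw [eFun, smul_smul, inv_mul_cancel₀ hc, one_smul]
      rw [this]
      exact Submodule.smul_mem _ _ (Submodule.subset_span ⟨k, rfl⟩)
  rw [h, span_character_closure_eq_top]

/-- The function `e_k` as an element of `L²(𝕋^d)`. -/
def eLp {d : ℕ} (k : Fin d → ℤ) : L2 d := ContinuousMap.toLp (E := ℂ) 2 volume ℂ (eFun k)

theorem integral_character {d : ℕ} (k : Fin d → ℤ) :
    ∫ x : Torus d, character k x = if k = 0 then ((2 * Real.pi) ^ d : ℂ) else 0 := by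
  split_ifs with h
  · subst h
    have h0 : ∀ x : Torus d, character (0 : Fin d → ℤ) x = ∏ _i : Fin d, (1 : ℂ) := by
      intro x; simp [character_zero]
    simp_rw [h0]
    rw [MeasureTheory.integral_fintype_prod_volume_eq_prod
      (f := fun (_ : Fin d) (_ : AddCircle (2 * Real.pi)) => (1 : ℂ))]
    simp [Measure.real, AddCircle.measure_univ, Real.pi_pos.le]
  · simp only [character, ContinuousMap.coe_mk]
    rw [MeasureTheory.integral_fintype_prod_volume_eq_prod
      (f := fun (i : Fin d) (x : AddCircle (2 * Real.pi)) => (fourier (k i) x : ℂ))]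
    obtain ⟨i, hi⟩ := Function.ne_iff.mp h
    apply Finset.prod_eq_zero (Finset.mem_univ i)
    exact integral_eq_zero_of_add_right_eq_neg (fourier_add_half_inv_index hi Real.two_pi_pos)

theorem orthonormal_eLp (d : ℕ) : Orthonormal ℂ (eLp (d := d)) := by
  rw [orthonormal_iff_ite]
  intro m n
  have hint : ∀ x : Torus d, eFun n x * conj (eFun m x)
      = ((normConst d * normConst d : ℝ) : ℂ) * character (n + -m) x := by
    intro x
    simp only [eFun, ContinuousMap.smul_apply, smul_eq_mul, map_mul, Complex.conj_ofReal,
      character_add, character_neg]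
    push_cast
    ring
  simp only [eLp, ContinuousMap.inner_toLp, hint]
  rw [integral_const_mul, integral_character]
  by_cases h : m = n
  · subst h
    have := normConst_sq d
    simp only [add_neg_cancel, if_true]
    exact_mod_cast this
  · have : n + -m ≠ 0 := fun h' => h (by rw [← sub_eq_add_neg, sub_eq_zero] at h'; exact h'.symm)
    simp [this, h]

theorem span_eLp_closure_eq_top (d : ℕ) :
    (Submodule.span ℂ (range (eLp (d := d)))).topologicalClosure = ⊤ := by
  have := (ContinuousMap.toLp_denseRange ℂ (volume : Measure (Torus d)) ℂ
    (p := 2) (by simp)).topologicalClosure_map_submodule (span_eFun_closure_eq_top d)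
  simpa only [Submodule.map_span, ContinuousLinearMap.coe_coe, ← range_comp,
    Function.comp_def, eLp] using! this

/-- The orthonormal basis `(e_k)` of `L²(𝕋^d)`; `(basis d).repr ψ k` is the `k`-th Fourier
coefficient `⟨e_k, ψ⟩ = (2π)^{-d/2} ∫ ψ(x) e^{-i k·x} dx`. -/
def basis (d : ℕ) : HilbertBasis (Fin d → ℤ) ℂ (L2 d) :=
  HilbertBasis.mk (orthonormal_eLp d) (span_eLp_closure_eq_top d).ge

theorem basis_apply {d : ℕ} (k : Fin d → ℤ) : basis d k = eLp k := by
  simp [basis]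

/-! ### Unbounded operators -/

section MatrixOp

variable {ι H : Type*} [NormedAddCommGroup H] [InnerProductSpace ℂ H]

/-- The `j`-th coordinate `∑_k M_{jk} ψ_k` of `M ψ`, where `ψ_k` are the coordinates of `ψ`. -/
def rowSum (b : HilbertBasis ι ℂ H) (M : ι → ι → ℂ) (ψ : H) (j : ι) : ℂ :=
  ∑' k, M j k * b.repr ψ k

theorem rowTerm_add (b : HilbertBasis ι ℂ H) (M : ι → ι → ℂ) (ψ φ : H) (j : ι) :
    (fun k => M j k * b.repr (ψ + φ) k) =
      fun k => M j k * b.repr ψ k + M j k * b.repr φ k := by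
  ext k
  rw [map_add, lp.coeFn_add, Pi.add_apply, mul_add]

theorem rowTerm_smul (b : HilbertBasis ι ℂ H) (M : ι → ι → ℂ) (c : ℂ) (ψ : H) (j : ι) :
    (fun k => M j k * b.repr (c • ψ) k) = fun k => c * (M j k * b.repr ψ k) := by
  ext k
  rw [map_smul, lp.coeFn_smul, Pi.smul_apply, smul_eq_mul]
  ring

theorem rowSum_add (b : HilbertBasis ι ℂ H) (M : ι → ι → ℂ) {ψ φ : H}
    (h : ∀ j, Summable fun k => M j k * b.repr ψ k)
    (h' : ∀ j, Summable fun k => M j k * b.repr φ k) :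
    rowSum b M (ψ + φ) = rowSum b M ψ + rowSum b M φ := by
  ext j
  rw [rowSum, rowTerm_add, (h j).tsum_add (h' j)]
  rfl

theorem rowSum_smul (b : HilbertBasis ι ℂ H) (M : ι → ι → ℂ) (c : ℂ) (ψ : H) :
    rowSum b M (c • ψ) = c • rowSum b M ψ := by
  ext j
  rw [rowSum, rowTerm_smul, tsum_mul_left]
  rfl

/-- The maximal domain of the operator given by an infinite matrix `M` in a Hilbert basis. -/
def matrixDomain (b : HilbertBasis ι ℂ H) (M : ι → ι → ℂ) : Submodule ℂ H where
  carrier := {ψ | (∀ j, Summable fun k => M j k * b.repr ψ k) ∧ Memℓp (rowSum b M ψ) 2}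
  zero_mem' := by
    have h0 : (fun j => rowSum b M 0 j) = 0 := by
      ext j
      simp [rowSum]
    refine ⟨fun j => by simp, ?_⟩
    change Memℓp (fun j => rowSum b M 0 j) 2
    rw [h0]
    exact zero_memℓp
  add_mem' := by
    rintro ψ φ ⟨h1, h2⟩ ⟨h3, h4⟩
    refine ⟨fun j => ?_, ?_⟩
    · rw [rowTerm_add]
      exact (h1 j).add (h3 j)
    · rw [rowSum_add b M h1 h3]
      exact h2.add h4
  smul_mem' := by
    rintro c ψ ⟨h1, h2⟩
    refine ⟨fun j => ?_, ?_⟩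
    · rw [rowTerm_smul]
      exact (h1 j).mul_left c
    · rw [rowSum_smul]
      exact h2.const_smul c

/-- The operator `ψ ↦ ∑_j (∑_k M_{jk} ψ_k) b_j` given by an infinite matrix `M` in a Hilbert basis,
on its maximal domain. -/
def matrixOp (b : HilbertBasis ι ℂ H) (M : ι → ι → ℂ) : H →ₗ.[ℂ] H where
  domain := matrixDomain b M
  toFun :=
    { toFun := fun ψ => b.repr.symm ⟨rowSum b M (ψ : H), ψ.2.2⟩
      map_add' := by
        intro ψ φ
        rw [← map_add]
        congr 1
        exact Subtype.ext (rowSum_add b M ψ.2.1 φ.2.1)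
      map_smul' := by
        intro c ψ
        rw [RingHom.id_apply, ← map_smul]
        congr 1
        exact Subtype.ext (rowSum_smul b M c ψ) }

end MatrixOp

/-- The conjugated operator `U T U*`, with domain `U (dom T)`, for a unitary `U`. -/
def unitaryConj {H : Type*} [NormedAddCommGroup H] [InnerProductSpace ℂ H]
    (U : H ≃ₗᵢ[ℂ] H) (T : H →ₗ.[ℂ] H) : H →ₗ.[ℂ] H where
  domain := T.domain.comap (U.symm.toLinearEquiv : H →ₗ[ℂ] H)
  toFun :=
    { toFun := fun ψ => U (T ⟨U.symm (ψ : H), ψ.2⟩)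
      map_add' := by
        intro ψ φ
        rw [← map_add, ← LinearPMap.map_add]
        congr 2
        exact Subtype.ext (map_add U.symm (ψ : H) (φ : H))
      map_smul' := by
        intro c ψ
        rw [RingHom.id_apply, ← map_smul, ← LinearPMap.map_smul]
        congr 2
        exact Subtype.ext (map_smul U.symm c (ψ : H)) }

/-! ### Weyl quantization and the unperturbed operator -/

/-- The Fourier coefficient `â(k, ξ) = (2π)^{-d/2} ∫_{𝕋^d} a(x, ξ) e^{-i k·x} dx` of a symbol on
`T*𝕋^d = 𝕋^d × ℝ^d`. -/
def symbolCoeff {d : ℕ} (a : Torus d → Eucl d → ℂ) (k : Fin d → ℤ) (ξ : Eucl d) : ℂ :=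
  ∫ x : Torus d, a x ξ * conj (eFun k x)

/-- The matrix element `⟨e_j, Op_ħ(a) e_k⟩ = (2π)^{-d/2} â(j - k, ħ (j + k) / 2)`. -/
def weylMatrix {d : ℕ} (ħ : ℝ) (a : Torus d → Eucl d → ℂ) (j k : Fin d → ℤ) : ℂ :=
  (normConst d : ℂ) * symbolCoeff a (j - k) ((ħ / 2) • latticePt (j + k))

/-- The semiclassical Weyl quantization `Op_ħ(a)` on `L²(𝕋^d)`. -/
def weylOp {d : ℕ} (ħ : ℝ) (a : Torus d → Eucl d → ℂ) : L2 d →ₗ.[ℂ] L2 d :=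
  matrixOp (basis d) (weylMatrix ħ a)

/-- The operator `ω · ħ D_x`, `D_x = -i∂_x`, on `L²(𝕋^d)` with its natural (self-adjoint) domain:
the Fourier multiplier by `ħ ω·k`. -/
def freeOp {d : ℕ} (ω : Eucl d) (ħ : ℝ) : L2 d →ₗ.[ℂ] L2 d :=
  matrixOp (basis d) fun j k => if j = k then ((ħ * inner ℝ ω (latticePt k) : ℝ) : ℂ) else 0

/-- The Diophantine condition `|k·ω| ≥ ς / |k|^{γ-1}` for all `k ∈ ℤ^d \ {0}`. -/
def IsDiophantine {d : ℕ} (ς γ : ℝ) (ω : Eucl d) : Prop :=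
  ∀ k : Fin d → ℤ, k ≠ 0 → ς / ‖latticePt k‖ ^ (γ - 1) ≤ |inner ℝ (latticePt k) ω|

/-! ### Sjöstrand's Wiener algebra and the spaces of symbols -/

/-- The choices that enter the norm of `S_W(ℝ^d)`: a lattice `Γ` (spanned by a basis of `ℝ^d`),
a Schwartz function `χ₀` whose `Γ`-translates sum to `1`, and a constant `C_d > 0`. -/
structure WienerData (d : ℕ) where
  latticeBasis : Module.Basis (Fin d) ℝ (Eucl d)
  cutoff : 𝓢(Eucl d, ℂ)
  hasSum_cutoff : ∀ ξ : Eucl d,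
    HasSum (fun j : Submodule.span ℤ (range latticeBasis) => cutoff (ξ - (j : Eucl d))) 1
  const : ℝ
  const_pos : 0 < const

/-- The Fourier transform `f̂(η) = (2π)^{-d/2} ∫ f(ξ) e^{-i η·ξ} dξ`
(Mathlib's `𝓕` uses `e^{-2πi η·ξ}`). -/
def fourierTr {d : ℕ} (f : Eucl d → ℂ) (η : Eucl d) : ℂ :=
  (normConst d : ℂ) * 𝓕 f ((2 * Real.pi)⁻¹ • η)

/-- `‖f‖_W = C_d ∫ sup_{j ∈ Γ} |(χ_j f)^(η)| dη`, where `χ_j = χ₀(· - j)`. -/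
def normSW {d : ℕ} (N : WienerData d) (f : Eucl d → ℂ) : ℝ≥0∞ :=
  ENNReal.ofReal N.const * ∫⁻ η : Eucl d,
    ⨆ j : Submodule.span ℤ (range N.latticeBasis),
      ‖fourierTr (fun ξ => N.cutoff (ξ - (j : Eucl d)) * f ξ) η‖ₑ

/-- `f ∈ S_W(ℝ^d)`. Elements of `S_W(ℝ^d)` are bounded continuous functions; requiring this makes
the Fourier integrals of the `χ_j f` converge absolutely. -/
def MemSW {d : ℕ} (N : WienerData d) (f : Eucl d → ℂ) : Prop :=
  Continuous f ∧ (∃ B : ℝ, ∀ ξ, ‖f ξ‖ ≤ B) ∧ normSW N f < ∞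

/-- `‖g‖_{W,ρ} = (2π)^{-d/2} ∑_k ‖ĝ(k, ·)‖_W e^{|k|ρ}`. -/
def normAW {d : ℕ} (N : WienerData d) (ρ : ℝ) (g : Torus d → Eucl d → ℂ) : ℝ≥0∞ :=
  ENNReal.ofReal (normConst d) * ∑' k : Fin d → ℤ,
    normSW N (symbolCoeff g k) * ENNReal.ofReal (Real.exp (‖latticePt k‖ * ρ))

/-- `g ∈ 𝒜_{W,ρ}(T*𝕋^d)`: a smooth real function on `T*𝕋^d` with `‖g‖_{W,ρ} < ∞`. -/
def MemAW {d : ℕ} (N : WienerData d) (ρ : ℝ) (g : Torus d → Eucl d → ℝ) : Prop :=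
  ContDiff ℝ ((⊤ : ℕ∞) : WithTop ℕ∞) (fun p : Eucl d × Eucl d => g (toTorus p.1) p.2) ∧
  (∀ k, MemSW N (symbolCoeff (fun x ξ => (g x ξ : ℂ)) k)) ∧
  normAW N ρ (fun x ξ => (g x ξ : ℂ)) < ∞

/-- The renormalized operator `ω·ħD_x + ε Op_ħ(V - R)`, for an integrable counterterm `R = R(ξ)`. -/
def renormalizedOp {d : ℕ} (ω : Eucl d) (ħ ε : ℝ) (V : Torus d → Eucl d → ℝ) (R : Eucl d → ℝ) :
    L2 d →ₗ.[ℂ] L2 d :=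
  freeOp ω ħ + (ε : ℂ) • weylOp ħ (fun x ξ => ((V x ξ - R ξ : ℝ) : ℂ))

end TorusKAM

end

set_option linter.unusedSectionVars false

noncomputable section

namespace TorusKAM

/-! Divide by ħ. With L = ω·D and λ = ε/ħ, the claim reads U (L + λ Op(V - R)) U* = L, that is [L,
U] = λ U Op(V - R), where λ‖V‖ is small. The unperturbed symbol ω·ξ is linear, so the frequency
never moves and one Diophantine condition serves every step; the diagonal part of the error, which
no conjugation removes, is absorbed in the counterterm.

The Newton scheme is run abstractly on a `KAMScale`; there V and R contain the factor λ. If U (L + V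
- R) U* = L + E, a contraction argument (`exists_diagonal`) gives a diagonal d with D(U d U*) =
D(E), and replacing R by R + d leaves the error B = E - U d U*, with zero diagonal. Then [L, F] = B
is solved by dividing by ω·k, at the cost of some analyticity width; F is skew-adjoint, and the
Cayley transform of F/2 is an exact unitary that conjugates L + B to L plus a quadratically small
error (`exists_step`). `exists_conjugation` iterates along radii decreasing to ρ/2. As the scheme
starts at U = 1, the first counterterm is exactly the diagonal part of V, and all later ones add up
to a quadratic correction.

Operators are handled through left symbols a_k(ξ), with matrix entries a_{j-k}(ħk). A single
operator sees its symbol only on ħℤ^d, so `covAlg` consists of families of operators indexed by ξ in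
ℝ^d: a diagonal element is then a genuine function of ξ, and R is one. Products convolve in k and
translate ξ by multiples of ħ, so estimates uniform in ħ need a submultiplicative norm invariant
under all translations. The norm ‖·‖_W depends on a lattice and a cutoff and need be neither;
`exists_isWienerNorm_equiv` replaces it by an equivalent norm, a supremum over all translates of one
bump function. The equivalence constant K does not spoil the bound 2‖V‖: the mean of V is estimated
directly in ‖·‖_W by ‖V‖, and K enters only the quadratic remainder, which δ makes at most ‖V‖.

`unitaryConj_diagonal` turns the identity between matrix entries into an equality of unbounded
operators. -/

/-- Bounded continuous functions, unbundled. -/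
def BddCont {E : Type*} [TopologicalSpace E] (f : E → ℂ) : Prop :=
  Continuous f ∧ ∃ B : ℝ, ∀ ξ, ‖f ξ‖ ≤ B

theorem BddCont.mul {E : Type*} [TopologicalSpace E] {f g : E → ℂ} (hf : BddCont f)
    (hg : BddCont g) : BddCont fun ξ => f ξ * g ξ := by
  obtain ⟨cf, B, hB⟩ := hf
  obtain ⟨cg, C, hC⟩ := hg
  refine ⟨cf.mul cg, B * C, fun ξ => ?_⟩
  rw [norm_mul]
  exact mul_le_mul (hB ξ) (hC ξ) (norm_nonneg _) ((norm_nonneg _).trans (hB ξ))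

/-! ### Windowed Fourier transforms and change of window -/

section Wiener

variable {E : Type*} [NormedAddCommGroup E] [InnerProductSpace ℝ E] [FiniteDimensional ℝ E]
  [MeasurableSpace E] [BorelSpace E]

/-- The supremum over a family of translations `s i` of the Fourier transforms of `f` cut off by
the translated windows `φ(· - s i)`. -/
def windowSup {ι : Type*} (φ : E → ℂ) (s : ι → E) (f : E → ℂ) (η : E) : ℝ≥0∞ :=
  ⨆ i, ‖𝓕 (fun ξ => φ (ξ - s i) * f ξ) η‖ₑ

theorem integrable_window_mul (φ : 𝓢(E, ℂ)) (s : E) {f : E → ℂ} (hf : BddCont f) :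
    Integrable fun ξ => φ (ξ - s) * f ξ := by
  obtain ⟨B, hB⟩ := hf.2
  exact (φ.integrable.comp_sub_right s).mul_bdd (c := B) hf.1.aestronglyMeasurable
    (Eventually.of_forall hB)

theorem continuous_fourier_of_integrable {g : E → ℂ} (hg : Integrable g) : Continuous (𝓕 g) :=
  VectorFourier.fourierIntegral_continuous Real.continuous_fourierChar
    (innerSL ℝ).continuous₂ hg

theorem measurable_windowSup {ι : Type*} (φ : 𝓢(E, ℂ)) (s : ι → E) {f : E → ℂ} (hf : BddCont f) :
    Measurable (windowSup φ s f) := by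
  refine LowerSemicontinuous.measurable ?_
  have h := lowerSemicontinuous_iSup (f := fun (i : ι) (η : E) =>
    ‖𝓕 (fun ξ => φ (ξ - s i) * f ξ) η‖ₑ) fun i =>
      (continuous_fourier_of_integrable (integrable_window_mul φ (s i) hf)).enorm.lowerSemicontinuous
  exact h

/-- The Fourier transform of a product is bounded by the convolution of the Fourier transforms. -/
theorem enorm_fourier_mul_le {g₁ g₂ : E → ℂ} (hc : Continuous g₁) (h₁ : Integrable g₁)
    (h₁' : Integrable (𝓕 g₁)) (h₂ : Integrable g₂) (η : E) :
    ‖𝓕 (fun ξ => g₁ ξ * g₂ ξ) η‖ₑ ≤ ∫⁻ ζ, ‖𝓕 g₁ ζ‖ₑ * ‖𝓕 g₂ (η - ζ)‖ₑ := by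
  have hinv : 𝓕 (𝓕⁻ g₁) = g₁ := hc.fourier_fourierInv_eq h₁ h₁'
  have hinvi : Integrable (𝓕⁻ g₁) := by
    rw [Real.fourierInv_eq_fourier_comp_neg]
    have : 𝓕 (fun x => g₁ (-x)) = fun x => 𝓕 g₁ (-x) := by
      rw [← Real.fourierInv_eq_fourier_comp_neg]
      ext x
      exact Real.fourierInv_eq_fourier_neg _ _
    rw [this]
    exact h₁'.comp_neg
  have hmod : Integrable fun ξ => Real.fourierChar (-inner ℝ ξ η) • g₂ ξ :=
    (Real.fourierIntegral_convergent_iff η).2 h₂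
  -- Duality ∫ 𝓕(𝓕⁻ g₁) h = ∫ 𝓕⁻ g₁ 𝓕 h, where h is g₂ modulated by η: its transform is 𝓕 g₂ shifted
  -- by η, which is the convolution formula.
  have hswap := VectorFourier.integral_fourierIntegral_smul_eq_flip
    (μ := (volume : Measure E)) (ν := (volume : Measure E)) (L := innerₗ E)
    Real.continuous_fourierChar (innerSL ℝ).continuous₂ hinvi hmod
  have hL : (∫ ξ, (VectorFourier.fourierIntegral Real.fourierChar volume (innerₗ E) (𝓕⁻ g₁) ξ) •
      (Real.fourierChar (-inner ℝ ξ η) • g₂ ξ)) = 𝓕 (fun ξ => g₁ ξ * g₂ ξ) η := by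
    rw [Real.fourier_eq]
    congr 1
    ext ξ
    have : VectorFourier.fourierIntegral Real.fourierChar volume (innerₗ E) (𝓕⁻ g₁) ξ = g₁ ξ :=
      congrFun hinv ξ
    rw [this, smul_eq_mul, Circle.smul_def, Circle.smul_def, smul_eq_mul, smul_eq_mul]
    ring
  rw [← hL, hswap]
  refine (enorm_integral_le_lintegral_enorm _).trans ?_
  rw [← lintegral_neg_eq_self]
  refine lintegral_mono fun ζ => ?_
  rw [enorm_smul, Real.fourierInv_eq_fourier_neg, neg_neg]
  gcongr
  apply le_of_eq
  congr 1
  rw [Real.fourier_eq]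
  simp only [VectorFourier.fourierIntegral]
  congr 1
  ext ξ
  rw [smul_smul]
  congr 1
  simp only [LinearMap.flip_apply, innerₗ_apply_apply, inner_sub_right]
  rw [← AddChar.map_add_eq_mul]
  congr 1
  rw [real_inner_comm, inner_neg_right]
  ring

theorem lintegral_lintegral_mul_sub {H F : E → ℝ≥0∞} (hH : Measurable H) (hF : Measurable F) :
    ∫⁻ η, ∫⁻ ζ, H ζ * F (η - ζ) = (∫⁻ ζ, H ζ) * ∫⁻ η, F η := by
  rw [lintegral_lintegral_swap (by fun_prop)]
  calc ∫⁻ ζ, ∫⁻ η, H ζ * F (η - ζ) = ∫⁻ ζ, H ζ * ∫⁻ η, F η := by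
        refine lintegral_congr fun ζ => ?_
        rw [lintegral_const_mul _ (by fun_prop), lintegral_sub_right_eq_self]
    _ = _ := lintegral_mul_const _ hH

theorem enorm_fourier_comp_sub (g : E → ℂ) (s ζ : E) :
    ‖𝓕 (fun ξ => g (ξ - s)) ζ‖ₑ = ‖𝓕 g ζ‖ₑ := by
  have h := congrFun (VectorFourier.fourierIntegral_comp_add_right Real.fourierChar
    (volume : Measure E) (innerₗ E) g (-s)) ζ
  have h' : 𝓕 (fun ξ => g (ξ - s)) ζ =
      Real.fourierChar (innerₗ E (-s) ζ) • 𝓕 g ζ := by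
    simpa [sub_eq_add_neg, Function.comp_def] using! h
  rw [h', ← ofReal_norm, Circle.norm_smul, ofReal_norm]

/-- The integrable weight `(1 + |ζ|)^{-(dim E + 1)}`. -/
def decayWeight (ζ : E) : ℝ := ((1 + ‖ζ‖) ^ (Module.finrank ℝ E + 1))⁻¹

theorem decayWeight_pos (ζ : E) : 0 < decayWeight ζ := by
  unfold decayWeight; positivity

theorem decayWeight_le_one (ζ : E) : decayWeight ζ ≤ 1 :=
  inv_le_one_of_one_le₀ (one_le_pow₀ (by linarith [norm_nonneg ζ]))

/-- Peetre's inequality: decay around two centres gives decay in their distance. -/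
theorem decayWeight_mul_le (x y : E) : decayWeight x * decayWeight y ≤ decayWeight (x - y) := by
  unfold decayWeight
  rw [← mul_inv, ← mul_pow]
  have h := norm_sub_le x y
  have := mul_nonneg (norm_nonneg x) (norm_nonneg y)
  gcongr
  nlinarith

theorem decayWeight_neg (x : E) : decayWeight (-x) = decayWeight x := by
  simp [decayWeight]

theorem measurable_decayWeight : Measurable (decayWeight (E := E)) := by
  unfold decayWeight; fun_prop

theorem integrable_decayWeight : Integrable (decayWeight (E := E)) := by
  have h := integrable_one_add_norm (E := E) (μ := volume)
    (r := ((Module.finrank ℝ E + 1 : ℕ) : ℝ)) (by push_cast; linarith)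
  refine h.congr (Eventually.of_forall fun x => ?_)
  simp only [decayWeight]
  rw [Real.rpow_neg (by positivity), Real.rpow_natCast]

theorem schwartz_decay (u : 𝓢(E, ℂ)) (k : ℕ) :
    ∃ C : ℝ, 0 ≤ C ∧ ∀ x, ‖u x‖ ≤ C * decayWeight x ^ k := by
  set m : ℕ := (Module.finrank ℝ E + 1) * k
  refine ⟨2 ^ m * ((Finset.Iic (m, 0)).sup fun m => SchwartzMap.seminorm ℝ m.1 m.2) u,
    by positivity, fun x => ?_⟩
  have h := SchwartzMap.one_add_le_sup_seminorm_apply (𝕜 := ℝ) (m := (m, 0)) (k := m) (n := 0)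
    le_rfl le_rfl u x
  rw [norm_iteratedFDeriv_zero] at h
  rw [decayWeight, inv_pow, ← pow_mul, ← div_eq_mul_inv, le_div_iff₀ (by positivity), mul_comm]
  exact h

/-- Of the five weights available, two around each centre become the decay in t - s by Peetre's
inequality, and the one left over makes the integral converge; hence the exponents 3 and 2. -/
theorem lintegral_mul_translate_le {u v : E → ℂ} {C D : ℝ} (hC : 0 ≤ C) (hD : 0 ≤ D)
    (hu : ∀ x, ‖u x‖ ≤ C * decayWeight x ^ 3) (hv : ∀ x, ‖v x‖ ≤ D * decayWeight x ^ 2) (s t : E) :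
    ∫⁻ x, ‖u (x - s)‖ₑ * ‖v (x - t)‖ₑ ≤
      ENNReal.ofReal (C * D * (∫ x : E, decayWeight x) * decayWeight (t - s) ^ 2) := by
  have hpt : ∀ x, ‖u (x - s)‖ₑ * ‖v (x - t)‖ₑ ≤
      ENNReal.ofReal (C * D * decayWeight (t - s) ^ 2 * decayWeight (x - s)) := by
    intro x
    rw [← enorm_mul, ← ofReal_norm, norm_mul]
    refine ENNReal.ofReal_le_ofReal ?_
    have h1 := decayWeight_mul_le (x - s) (x - t)
    rw [sub_sub_sub_cancel_left] at h1
    have p1 := decayWeight_pos (x - s)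
    have p2 := decayWeight_pos (x - t)
    calc ‖u (x - s)‖ * ‖v (x - t)‖
        ≤ (C * decayWeight (x - s) ^ 3) * (D * decayWeight (x - t) ^ 2) :=
          mul_le_mul (hu _) (hv _) (norm_nonneg _) (by positivity)
      _ = C * D * (decayWeight (x - s) * decayWeight (x - t)) ^ 2 * decayWeight (x - s) := by ring
      _ ≤ _ := by gcongr
  refine (lintegral_mono hpt).trans ?_
  rw [← ofReal_integral_eq_lintegral_ofReal]
  · rw [integral_const_mul, integral_sub_right_eq_self]
    exact le_of_eq (by ring_nf)
  · exact (integrable_decayWeight.comp_sub_right s).const_mul _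
  · exact Eventually.of_forall fun x => by
      have := decayWeight_pos (x - s); have := decayWeight_pos (t - s)
      simp only [Pi.zero_apply]; positivity

theorem enorm_fourier_le (g : E → ℂ) (ζ : E) : ‖𝓕 g ζ‖ₑ ≤ ∫⁻ ξ, ‖g ξ‖ₑ := by
  rw [Real.fourier_eq]
  refine (enorm_integral_le_lintegral_enorm _).trans (lintegral_mono fun ξ => ?_)
  rw [← ofReal_norm, Circle.norm_smul, ofReal_norm]

/-- The short time Fourier transform of a Schwartz function is rapidly decaying. -/
theorem norm_fourier_mul_translate_le (χ ψ : 𝓢(E, ℂ)) :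
    ∃ C : ℝ, 0 ≤ C ∧ ∀ s t ζ : E, ‖𝓕 (fun ξ => χ (ξ - s) * ψ (ξ - t)) ζ‖ ≤
      C * (decayWeight (t - s) * decayWeight ζ) := by
  obtain ⟨C₁, h₁, hχ⟩ := schwartz_decay χ 3
  obtain ⟨C₂, h₂, hψ⟩ := schwartz_decay ψ 2
  obtain ⟨C₃, h₃, hχ'⟩ := schwartz_decay (𝓕 χ) 3
  obtain ⟨C₄, h₄, hψ'⟩ := schwartz_decay (𝓕 ψ) 2
  set I := ∫ x : E, decayWeight x
  have hI : 0 ≤ I := integral_nonneg fun x => (decayWeight_pos x).le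
  refine ⟨max (C₁ * C₂ * I) (C₃ * C₄ * I), by positivity, fun s t ζ => ?_⟩
  -- Two quadratic bounds: `ha` takes absolute values in space and gives decay in t - s; `hb` works
  -- on the frequency side and gives decay in ζ.
  have ha : ‖𝓕 (fun ξ => χ (ξ - s) * ψ (ξ - t)) ζ‖ ≤ C₁ * C₂ * I * decayWeight (t - s) ^ 2 := by
    rw [← ENNReal.ofReal_le_ofReal_iff (by positivity), ofReal_norm]
    refine (enorm_fourier_le _ _).trans ?_
    simp only [enorm_mul]
    exact lintegral_mul_translate_le h₁ h₂ hχ hψ s t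
  have hb : ‖𝓕 (fun ξ => χ (ξ - s) * ψ (ξ - t)) ζ‖ ≤ C₃ * C₄ * I * decayWeight ζ ^ 2 := by
    rw [← ENNReal.ofReal_le_ofReal_iff (by positivity), ofReal_norm]
    have hi : Integrable (𝓕 (fun ξ => χ (ξ - s))) :=
      (𝓕 (χ.compSubConstCLM ℂ s)).integrable
    refine (enorm_fourier_mul_le (by fun_prop) (χ.integrable.comp_sub_right s) hi
      (ψ.integrable.comp_sub_right t) ζ).trans ?_
    -- Translations do not change moduli of transforms, so s and t drop out and the convolution at ζ
    -- is an overlap integral with centres 0 and ζ.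
    have := lintegral_mul_translate_le (u := (𝓕 χ : 𝓢(E, ℂ))) (v := fun x => (𝓕 ψ) (-x)) h₃ h₄ hχ'
      (fun x => by simpa only [decayWeight_neg] using hψ' (-x)) 0 ζ
    rw [sub_zero] at this
    refine le_trans (le_of_eq ?_) this
    refine lintegral_congr fun x => ?_
    rw [enorm_fourier_comp_sub, enorm_fourier_comp_sub, sub_zero, neg_sub]
    rfl
  have p1 := decayWeight_pos (t - s)
  have p2 := decayWeight_pos ζ
  -- The minimum of the squares of two nonnegative numbers is at most their product.
  rcases le_total (decayWeight (t - s)) (decayWeight ζ) with h | h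
  · refine ha.trans (mul_le_mul (le_max_left _ _) ?_ (by positivity) (by positivity))
    nlinarith
  · refine hb.trans (mul_le_mul (le_max_right _ _) ?_ (by positivity) (by positivity))
    nlinarith

/-- The transform of a product of two windows is concentrated near frequency 0 and small for distant
centres. Multiplying g by it smears 𝓕 g with an integrable weight, with a gain in t - s that can be
integrated over t. -/
theorem enorm_fourier_mul_translate_mul_le (χ ψ : 𝓢(E, ℂ)) :
    ∃ C : ℝ, 0 ≤ C ∧ ∀ (s t η : E) (g : E → ℂ), Integrable g →
      ‖𝓕 (fun ξ => (χ (ξ - s) * ψ (ξ - t)) * g ξ) η‖ₑ ≤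
        ENNReal.ofReal C * (ENNReal.ofReal (decayWeight (t - s)) *
          ∫⁻ ζ, ENNReal.ofReal (decayWeight ζ) * ‖𝓕 g (η - ζ)‖ₑ) := by
  obtain ⟨C, hC, hstft⟩ := norm_fourier_mul_translate_le χ ψ
  refine ⟨C, hC, fun s t η g hg => ?_⟩
  let u : 𝓢(E, ℂ) := SchwartzMap.smulLeftCLM ℂ (χ.compSubConstCLM ℂ s) (ψ.compSubConstCLM ℂ t)
  have hu : (fun ξ => χ (ξ - s) * ψ (ξ - t)) = u := by
    ext ξ
    simp [u, SchwartzMap.smulLeftCLM_apply_apply (SchwartzMap.hasTemperateGrowth _)]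
  have hui : Integrable (𝓕 (fun ξ => χ (ξ - s) * ψ (ξ - t))) := by
    rw [hu]; exact (𝓕 u).integrable
  refine (enorm_fourier_mul_le (by fun_prop) (hu ▸ u.integrable) hui hg η).trans ?_
  rw [← mul_assoc, ← lintegral_const_mul' _ _ (ENNReal.mul_ne_top (by simp) (by simp))]
  refine lintegral_mono fun ζ => ?_
  rw [← mul_assoc]
  gcongr
  rw [← ofReal_norm, ← ENNReal.ofReal_mul hC, ← ENNReal.ofReal_mul
    (mul_nonneg hC (decayWeight_pos _).le)]
  exact ENNReal.ofReal_le_ofReal ((hstft s t ζ).trans (le_of_eq (by ring)))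

/-- Change of window: the Fourier transforms of the pieces of `f` cut off by `χ` are controlled by
those of the pieces cut off by all the translates of `φ`. -/
theorem enorm_fourier_window_le (χ ψ φ : 𝓢(E, ℂ)) (hc : ∫ x, ψ x * φ x ≠ 0) :
    ∃ C : ℝ≥0∞, C ≠ ∞ ∧ ∀ f : E → ℂ, BddCont f → ∀ s η : E,
      ‖𝓕 (fun ξ => χ (ξ - s) * f ξ) η‖ₑ ≤
        C * ∫⁻ ζ, ENNReal.ofReal (decayWeight ζ) * windowSup φ id f (η - ζ) := by
  obtain ⟨C, hC, hstft⟩ := enorm_fourier_mul_translate_mul_le χ ψ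
  set c := ∫ x, ψ x * φ x with hcdef
  have hce : ‖c‖ₑ ≠ 0 := by simpa using hc
  refine ⟨‖c‖ₑ⁻¹ * (ENNReal.ofReal C * ∫⁻ x : E, ENNReal.ofReal (decayWeight x)), ?_,
    fun f hf s η => ?_⟩
  · refine ENNReal.mul_ne_top (ENNReal.inv_ne_top.2 hce) (ENNReal.mul_ne_top (by simp) ?_)
    exact integrable_decayWeight.lintegral_lt_top.ne
  set h : E → ℂ := fun ξ => Real.fourierChar (-inner ℝ ξ η) • (χ (ξ - s) * f ξ) with hh
  have hhi : Integrable h :=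
    (Real.fourierIntegral_convergent_iff η).2 (integrable_window_mul χ s hf)
  obtain ⟨Cφ, hCφ, hφb⟩ := schwartz_decay φ 0
  have hk : Integrable fun x => ψ x * φ x :=
    ψ.integrable.mul_bdd (c := Cφ) φ.continuous.aestronglyMeasurable
      (Eventually.of_forall fun x => by simpa using hφb x)
  have hprod := hhi.convolution_integrand (ContinuousLinearMap.mul ℝ ℂ) hk.comp_neg
  -- Reproducing formula: ∫ ψ(ξ - t) φ(ξ - t) dt = c for every ξ, so f is recovered, up to c, from
  -- its pieces cut off by all translates of φ.
  have hswap : ∫ t, 𝓕 (fun ξ => (χ (ξ - s) * ψ (ξ - t)) * (φ (ξ - t) * f ξ)) η =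
      c * 𝓕 (fun ξ => χ (ξ - s) * f ξ) η := by
    have h1 : ∀ t, 𝓕 (fun ξ => (χ (ξ - s) * ψ (ξ - t)) * (φ (ξ - t) * f ξ)) η =
        ∫ ξ, h ξ * (ψ (-(t - ξ)) * φ (-(t - ξ))) := by
      intro t
      rw [Real.fourier_eq]
      congr 1
      ext ξ
      simp only [hh, neg_sub, Circle.smul_def, smul_eq_mul]
      ring
    simp_rw [h1]
    rw [integral_integral_swap hprod]
    have h2 : ∀ ξ, ∫ t, h ξ * (ψ (-(t - ξ)) * φ (-(t - ξ))) = h ξ * c := by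
      intro ξ
      rw [integral_const_mul]
      congr 1
      simp only [neg_sub]
      exact integral_sub_left_eq_self (fun x => ψ x * φ x) volume ξ
    simp_rw [h2]
    rw [integral_mul_const, mul_comm, Real.fourier_eq]
  have hbound : ‖c‖ₑ * ‖𝓕 (fun ξ => χ (ξ - s) * f ξ) η‖ₑ ≤
      (ENNReal.ofReal C * ∫⁻ x : E, ENNReal.ofReal (decayWeight x)) *
        ∫⁻ ζ, ENNReal.ofReal (decayWeight ζ) * windowSup φ id f (η - ζ) := by
    rw [← enorm_mul, ← hswap]
    refine (enorm_integral_le_lintegral_enorm _).trans ?_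
    have h3 : ∀ t, ‖𝓕 (fun ξ => (χ (ξ - s) * ψ (ξ - t)) * (φ (ξ - t) * f ξ)) η‖ₑ ≤
        ENNReal.ofReal (decayWeight (t - s)) * (ENNReal.ofReal C *
          ∫⁻ ζ, ENNReal.ofReal (decayWeight ζ) * windowSup φ id f (η - ζ)) := by
      intro t
      refine (hstft s t η _ (integrable_window_mul φ t hf)).trans ?_
      rw [mul_left_comm]
      gcongr with ζ
      exact le_iSup (fun i : E => ‖𝓕 (fun ξ => φ (ξ - id i) * f ξ) (η - ζ)‖ₑ) t
    refine (lintegral_mono h3).trans (le_of_eq ?_)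
    rw [lintegral_mul_const _ (by have := measurable_decayWeight (E := E); fun_prop),
      lintegral_sub_right_eq_self (fun x : E => ENNReal.ofReal (decayWeight x))]
    ring
  rw [mul_assoc, ← ENNReal.mul_le_iff_le_inv hce (by simp)]
  exact hbound

end Wiener

/-! ### Properties of the supremum of windowed transforms -/

section Wiener

variable {E : Type*} [NormedAddCommGroup E] [InnerProductSpace ℝ E] [FiniteDimensional ℝ E]
  [MeasurableSpace E] [BorelSpace E]

/-- The summable uniform bounds B allow termwise integration against the integrable window, so
countable subadditivity already holds frequency by frequency. -/
theorem windowSup_le_tsum {ι κ : Type*} [Countable κ] (φ : 𝓢(E, ℂ)) (s : ι → E)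
    {f : κ → E → ℂ} {g : E → ℂ} {B : κ → ℝ} (hf : ∀ n, BddCont (f n))
    (hB : ∀ n ξ, ‖f n ξ‖ ≤ B n) (hs : Summable B) (hg : ∀ ξ, HasSum (fun n => f n ξ) (g ξ))
    (η : E) : windowSup φ s g η ≤ ∑' n, windowSup φ s (f n) η := by
  refine iSup_le fun i => ?_
  have hint : ∀ n, Integrable fun ξ => Real.fourierChar (-inner ℝ ξ η) •
      (φ (ξ - s i) * f n ξ) := fun n =>
    (Real.fourierIntegral_convergent_iff η).2 (integrable_window_mul φ (s i) (hf n))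
  have hsum : Summable fun n => ∫ ξ, ‖Real.fourierChar (-inner ℝ ξ η) •
      (φ (ξ - s i) * f n ξ)‖ := by
    refine Summable.of_nonneg_of_le (fun n => integral_nonneg fun ξ => norm_nonneg _) (fun n => ?_)
      (hs.mul_left (∫ ξ, ‖φ (ξ - s i)‖))
    rw [← integral_mul_const]
    refine integral_mono (hint n).norm ((φ.integrable.comp_sub_right (s i)).norm.mul_const _)
      fun ξ => ?_
    simp only [Circle.norm_smul, norm_mul]
    exact mul_le_mul_of_nonneg_left (hB n ξ) (norm_nonneg _)
  have h := hasSum_integral_of_summable_integral_norm hint hsum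
  have hg' : ∀ ξ, ∑' n, Real.fourierChar (-inner ℝ ξ η) • (φ (ξ - s i) * f n ξ) =
      Real.fourierChar (-inner ℝ ξ η) • (φ (ξ - s i) * g ξ) := by
    intro ξ
    have := (((hg ξ).mul_left (φ (ξ - s i))).mul_left
      ((Real.fourierChar (-inner ℝ ξ η) : Circle) : ℂ)).tsum_eq
    simpa only [Circle.smul_def, smul_eq_mul] using this
  simp_rw [hg'] at h
  rw [Real.fourier_eq, ← h.tsum_eq]
  refine enorm_tsum_le_tsum_enorm.trans (ENNReal.tsum_le_tsum fun n => ?_)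
  exact le_iSup (fun i => ‖𝓕 (fun ξ => φ (ξ - s i) * f n ξ) η‖ₑ) i

/-- Translating f relabels the windows and modulates the transforms. This works for every a because
the windows are centred at all points, not only at lattice points. -/
theorem windowSup_translate_le (φ f : E → ℂ) (a η : E) :
    windowSup φ id (fun ξ => f (ξ + a)) η ≤ windowSup φ id f η := by
  refine iSup_le fun t => ?_
  have h := enorm_fourier_comp_sub (fun ξ => φ (ξ - (t + a)) * f ξ) (-a) η
  have h2 : (fun ξ => φ (ξ - -a - (t + a)) * f (ξ - -a)) =
      fun ξ => φ (ξ - id t) * f (ξ + a) := by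
    ext ξ
    simp only [id, sub_neg_eq_add, add_sub_add_right_eq_sub]
  rw [h2] at h
  rw [h]
  exact le_iSup (fun i : E => ‖𝓕 (fun ξ => φ (ξ - id i) * f ξ) η‖ₑ) (t + a)

theorem windowSup_conj_le {φ : E → ℂ} (hφ : ∀ x, conj (φ x) = φ x) (f : E → ℂ) (η : E) :
    windowSup φ id (fun ξ => conj (f ξ)) η ≤ windowSup φ id f (-η) := by
  refine iSup_le fun t => ?_
  have h : 𝓕 (fun ξ => φ (ξ - id t) * conj (f ξ)) η =
      conj (𝓕 (fun ξ => φ (ξ - id t) * f ξ) (-η)) := by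
    rw [Real.fourier_eq, Real.fourier_eq, ← integral_conj]
    congr 1
    ext ξ
    simp only [Circle.smul_def, smul_eq_mul, map_mul, hφ, inner_neg_right, neg_neg,
      AddChar.map_neg_eq_inv, Circle.coe_inv_eq_conj]
  rw [h, ← ofReal_norm, RCLike.norm_conj, ofReal_norm]
  exact le_iSup (fun i : E => ‖𝓕 (fun ξ => φ (ξ - id i) * f ξ) (-η)‖ₑ) t

theorem windowSup_const_mul {ι : Type*} (φ : E → ℂ) (s : ι → E) (f : E → ℂ) (c : ℂ) (η : E) :
    windowSup φ s (fun ξ => c * f ξ) η = ‖c‖ₑ * windowSup φ s f η := by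
  rw [windowSup, windowSup, ENNReal.mul_iSup]
  congr 1
  ext i
  rw [← enorm_mul, Real.fourier_eq, Real.fourier_eq, ← integral_const_mul]
  congr 2
  ext ξ
  simp only [Circle.smul_def, smul_eq_mul]
  ring

theorem integrable_fourier_window {φ : 𝓢(E, ℂ)} {f : E → ℂ} (hf : BddCont f)
    (h : ∫⁻ η, windowSup φ id f η ≠ ∞) (s : E) :
    Integrable (𝓕 fun ξ => φ (ξ - s) * f ξ) := by
  refine ⟨(continuous_fourier_of_integrable (integrable_window_mul φ s hf)).aestronglyMeasurable,
    lt_of_le_of_lt (lintegral_mono fun η => ?_) h.lt_top⟩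
  exact le_iSup (fun i : E => ‖𝓕 (fun ξ => φ (ξ - id i) * f ξ) η‖ₑ) s

/-- Fourier inversion at ξ for the piece of f cut off by the window centred at ξ, which has the
value f(ξ) there. -/
theorem enorm_le_lintegral_windowSup {φ : 𝓢(E, ℂ)} (h0 : φ 0 = 1) {f : E → ℂ} (hf : BddCont f)
    (ξ : E) : ‖f ξ‖ₑ ≤ ∫⁻ η, windowSup φ id f η := by
  by_cases h : ∫⁻ η, windowSup φ id f η = ∞
  · simp [h]
  have hc : Continuous fun x => φ (x - ξ) * f x := by have := hf.1; fun_prop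
  have hinv := congrFun (hc.fourierInv_fourier_eq (integrable_window_mul φ ξ hf)
    (integrable_fourier_window hf h ξ)) ξ
  simp only [sub_self, h0, one_mul] at hinv
  rw [← hinv, Real.fourierInv_eq_fourier_neg]
  refine (enorm_fourier_le _ _).trans (lintegral_mono fun η => ?_)
  exact le_iSup (fun i : E => ‖𝓕 (fun ξ => φ (ξ - id i) * f ξ) η‖ₑ) ξ

theorem lintegral_windowSup_change (χ ψ φ : 𝓢(E, ℂ)) (hc : ∫ x, ψ x * φ x ≠ 0) :
    ∃ C : ℝ≥0∞, C ≠ ∞ ∧ ∀ {ι : Type} (s : ι → E) (f : E → ℂ), BddCont f →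
      ∫⁻ η, windowSup χ s f η ≤ C * ∫⁻ η, windowSup φ id f η := by
  obtain ⟨C, hC, h⟩ := enorm_fourier_window_le χ ψ φ hc
  refine ⟨C * ∫⁻ x : E, ENNReal.ofReal (decayWeight x),
    ENNReal.mul_ne_top hC integrable_decayWeight.lintegral_lt_top.ne, fun {ι} s f hf => ?_⟩
  refine (lintegral_mono (μ := volume) fun η => iSup_le fun i => h f hf (s i) η).trans (le_of_eq ?_)
  rw [lintegral_const_mul' _ _ hC, lintegral_lintegral_mul_sub
    (by have := measurable_decayWeight (E := E); fun_prop) (measurable_windowSup φ id hf), mul_assoc]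

/-- With the window φ² the product splits as (φf)(φg), and its transform is a convolution; the
window of the product is therefore not the window of the factors. -/
theorem lintegral_windowSup_mul_le (φ : 𝓢(E, ℂ)) {f g : E → ℂ} (hf : BddCont f) (hg : BddCont g)
    (h : ∫⁻ η, windowSup φ id f η ≠ ∞) :
    ∫⁻ η, windowSup (fun x => φ x * φ x) id (fun ξ => f ξ * g ξ) η ≤
      (∫⁻ η, windowSup φ id f η) * ∫⁻ η, windowSup φ id g η := by
  rw [← lintegral_lintegral_mul_sub (measurable_windowSup φ id hf) (measurable_windowSup φ id hg)]
  refine lintegral_mono fun η => iSup_le fun t => ?_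
  have heq : (fun ξ => φ (ξ - id t) * φ (ξ - id t) * (f ξ * g ξ)) =
      fun ξ => (φ (ξ - id t) * f ξ) * (φ (ξ - id t) * g ξ) := by
    ext ξ; ring
  rw [heq]
  refine (enorm_fourier_mul_le (by have := hf.1; fun_prop) (integrable_window_mul φ _ hf)
    (integrable_fourier_window hf h _) (integrable_window_mul φ _ hg) η).trans
    (lintegral_mono fun ζ => ?_)
  gcongr
  · exact le_iSup (fun i : E => ‖𝓕 (fun ξ => φ (ξ - id i) * f ξ) ζ‖ₑ) t
  · exact le_iSup (fun i : E => ‖𝓕 (fun ξ => φ (ξ - id i) * g ξ) (η - ζ)‖ₑ) t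

end Wiener

/-! ### The bump window and its comparison with lattice windows -/

section Wiener

variable {E : Type*} [NormedAddCommGroup E] [InnerProductSpace ℝ E] [FiniteDimensional ℝ E]
  [MeasurableSpace E] [BorelSpace E]

variable (E) in
/-- A smooth bump function with values in `[0, 1]`, equal to `1` near the origin. -/
def bump : ContDiffBump (0 : E) := ⟨1, 2, one_pos, one_lt_two⟩

variable (E) in
/-- The bump function as a Schwartz function. -/
def bumpWindow : 𝓢(E, ℂ) :=
  HasCompactSupport.toSchwartzMap (f := fun x => ((bump E x : ℝ) : ℂ))
    ((bump E).hasCompactSupport.comp_left Complex.ofReal_zero)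
    (Complex.ofRealCLM.contDiff.comp (bump E).contDiff)

theorem bumpWindow_apply (x : E) : bumpWindow E x = ((bump E x : ℝ) : ℂ) := rfl

theorem bumpWindow_zero : bumpWindow E 0 = 1 := by
  rw [bumpWindow_apply, (bump E).one_of_mem_closedBall (by simp [bump]), Complex.ofReal_one]

theorem conj_bumpWindow (x : E) : conj (bumpWindow E x) = bumpWindow E x := by
  rw [bumpWindow_apply, Complex.conj_ofReal]

theorem bumpWindow_eq_zero {x : E} (hx : 2 ≤ ‖x‖) : bumpWindow E x = 0 := by
  rw [bumpWindow_apply, (bump E).zero_of_le_dist (by simpa [bump] using hx), Complex.ofReal_zero]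

theorem integral_bump_pow_pos (n : ℕ) : 0 < ∫ x, bump E x ^ (n + 1) := by
  have hcs : HasCompactSupport fun x => bump E x ^ (n + 1) :=
    (bump E).hasCompactSupport.comp_left (g := fun y : ℝ => y ^ (n + 1)) (by simp)
  have hc : Continuous fun x => bump E x ^ (n + 1) := (bump E).continuous.pow _
  refine hc.integral_pos_of_hasCompactSupport_nonneg_nonzero hcs
    (fun x => pow_nonneg (bump E).nonneg _) (x := 0) ?_
  rw [(bump E).one_of_mem_closedBall (by simp [bump])]
  simp

theorem integral_bumpWindow_mul_ne_zero : ∫ x, bumpWindow E x * bumpWindow E x ≠ 0 := by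
  have : ∫ x, bumpWindow E x * bumpWindow E x = ((∫ x, bump E x ^ (1 + 1) : ℝ) : ℂ) := by
    rw [← integral_complex_ofReal]
    congr 1; ext x; simp [bumpWindow_apply, pow_two]
  rw [this]
  exact_mod_cast (integral_bump_pow_pos 1).ne'

theorem integral_bumpWindow_mul_sq_ne_zero :
    ∫ x, bumpWindow E x * (SchwartzMap.smulLeftCLM ℂ (bumpWindow E) (bumpWindow E)) x ≠ 0 := by
  have : ∫ x, bumpWindow E x * (SchwartzMap.smulLeftCLM ℂ (bumpWindow E) (bumpWindow E)) x =
      ((∫ x, bump E x ^ (2 + 1) : ℝ) : ℂ) := by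
    rw [← integral_complex_ofReal]
    congr 1; ext x
    rw [SchwartzMap.smulLeftCLM_apply_apply (SchwartzMap.hasTemperateGrowth _)]
    simp [bumpWindow_apply]
    ring
  rw [this]
  exact_mod_cast (integral_bump_pow_pos 2).ne'

/-- Change from the bump to its square, then split the square between the two factors. -/
theorem exists_lintegral_bumpWindow_mul_le :
    ∃ C : ℝ≥0∞, C ≠ ∞ ∧ ∀ f g : E → ℂ, BddCont f → BddCont g →
      ∫⁻ η, windowSup (bumpWindow E) id f η ≠ ∞ →
      ∫⁻ η, windowSup (bumpWindow E) id (fun ξ => f ξ * g ξ) η ≤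
        C * ((∫⁻ η, windowSup (bumpWindow E) id f η) * ∫⁻ η, windowSup (bumpWindow E) id g η) := by
  obtain ⟨C, hC, h⟩ := enorm_fourier_window_le (bumpWindow E) (bumpWindow E)
    (SchwartzMap.smulLeftCLM ℂ (bumpWindow E) (bumpWindow E)) integral_bumpWindow_mul_sq_ne_zero
  refine ⟨C * ∫⁻ x : E, ENNReal.ofReal (decayWeight x),
    ENNReal.mul_ne_top hC integrable_decayWeight.lintegral_lt_top.ne, fun f g hf hg hfin => ?_⟩
  refine (lintegral_mono (μ := volume) fun η =>
    iSup_le fun i => h _ (hf.mul hg) (id i) η).trans ?_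
  rw [lintegral_const_mul' _ _ hC, lintegral_lintegral_mul_sub
    (by have := measurable_decayWeight (E := E); fun_prop)
    (measurable_windowSup _ id (hf.mul hg)), mul_assoc]
  gcongr
  refine le_trans (le_of_eq (lintegral_congr fun η => ?_))
    (lintegral_windowSup_mul_le (bumpWindow E) hf hg hfin)
  congr 1
  ext x
  rw [SchwartzMap.smulLeftCLM_apply_apply (SchwartzMap.hasTemperateGrowth _), smul_eq_mul]

/-- If finitely many translates of `χ` have no common zero on a ball, the bump function is, near
the centre of this ball, a combination of these translates with Schwartz coefficients. -/
theorem exists_schwartz_partition (χ : 𝓢(E, ℂ)) (S : Finset E) {r : ℝ} (hr : 0 < r)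
    (hS : ∀ x, ‖x‖ ≤ r + 1 → ∃ l ∈ S, χ (x - l) ≠ 0) :
    ∃ ψ : E → 𝓢(E, ℂ), ∀ x, ‖x‖ ≤ r → ∑ l ∈ S, ψ l x * χ (x - l) = 1 := by
  let b : ContDiffBump (0 : E) := ⟨r, r + 1, hr, by linarith⟩
  let θ : E → ℝ := fun x => ∑ l ∈ S, ‖χ (x - l)‖ ^ 2
  have hθ0 : ∀ x, 0 ≤ θ x := fun x => Finset.sum_nonneg fun l _ => by positivity
  -- The summand 1 - b keeps the denominator positive outside the large ball, where θ may vanish,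
  -- and disappears on the small ball, where the identity is needed.
  have hden : ∀ x, 0 < θ x + 1 - b x := by
    intro x
    by_cases hx : ‖x‖ ≤ r + 1
    · obtain ⟨l, hl, hne⟩ := hS x hx
      have h1 : ‖χ (x - l)‖ ^ 2 ≤ θ x :=
        Finset.single_le_sum (f := fun l => ‖χ (x - l)‖ ^ 2) (fun l _ => by positivity) hl
      have h2 : 0 < ‖χ (x - l)‖ ^ 2 := by positivity
      linarith [b.le_one (x := x)]
    · have : b x = 0 := b.zero_of_le_dist (by simpa [b] using (not_le.1 hx).le)
      linarith [hθ0 x]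
  have hχl : ∀ l, ContDiff ℝ ((⊤ : ℕ∞) : WithTop ℕ∞) fun x => χ (x - l) := fun l =>
    (χ.smooth ⊤).comp (contDiff_id.sub contDiff_const)
  have hθs : ContDiff ℝ ((⊤ : ℕ∞) : WithTop ℕ∞) θ :=
    ContDiff.sum fun l _ => (hχl l).norm_sq ℝ
  have hβ : ContDiff ℝ ((⊤ : ℕ∞) : WithTop ℕ∞) fun x => b x * (θ x + 1 - b x)⁻¹ :=
    b.contDiff.mul (((hθs.add contDiff_const).sub b.contDiff).inv fun x => (hden x).ne')
  have hψs : ∀ l, ContDiff ℝ ((⊤ : ℕ∞) : WithTop ℕ∞)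
      fun x => ((b x * (θ x + 1 - b x)⁻¹ : ℝ) : ℂ) * conj (χ (x - l)) := fun l =>
    (Complex.ofRealCLM.contDiff.comp hβ).mul
      ((Complex.conjCLE : ℂ →L[ℝ] ℂ).contDiff.comp (hχl l))
  have hψc : ∀ l, HasCompactSupport
      fun x => ((b x * (θ x + 1 - b x)⁻¹ : ℝ) : ℂ) * conj (χ (x - l)) := by
    intro l
    refine b.hasCompactSupport.mono fun x hx => ?_
    rw [Function.mem_support] at hx ⊢
    intro h0
    simp [h0] at hx
  refine ⟨fun l => (hψc l).toSchwartzMap (hψs l), fun x hx => ?_⟩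
  have hb : b x = 1 := b.one_of_mem_closedBall (by simpa [b] using hx)
  have hθx : θ x ≠ 0 := by have := hden x; rw [hb] at this; linarith
  have : ∀ l, (hψc l).toSchwartzMap (hψs l) x * χ (x - l) =
      (((θ x)⁻¹ * ‖χ (x - l)‖ ^ 2 : ℝ) : ℂ) := by
    intro l
    rw [HasCompactSupport.toSchwartzMap_toFun, hb, mul_assoc, Complex.conj_mul']
    push_cast
    ring
  simp only [this]
  rw [← Complex.ofReal_sum, ← Finset.mul_sum]
  exact_mod_cast inv_mul_cancel₀ hθx

/-- If the translates of `χ` by a cocompact subgroup `Γ` have no common zero, they control the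
pieces cut off by all the translates of the bump function. -/
theorem windowSup_bumpWindow_le (χ : 𝓢(E, ℂ)) (Γ : Submodule ℤ E) {r : ℝ} (hr : 0 ≤ r)
    (hΓ : ∀ t : E, ∃ j ∈ Γ, ‖t - j‖ ≤ r) (hχ : ∀ x, ∃ j ∈ Γ, χ (x - j) ≠ 0) :
    ∃ C : ℝ≥0∞, C ≠ ∞ ∧ ∀ f : E → ℂ, BddCont f → ∀ η,
      windowSup (bumpWindow E) id f η ≤ C * ∫⁻ ζ, ENNReal.ofReal (decayWeight ζ) *
        windowSup χ (fun j : Γ => (j : E)) f (η - ζ) := by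
  classical
  obtain ⟨S, hSΓ, hS⟩ : ∃ S : Finset E, (∀ l ∈ S, l ∈ Γ) ∧
      ∀ x, ‖x‖ ≤ (r + 2) + 1 → ∃ l ∈ S, χ (x - l) ≠ 0 := by
    obtain ⟨T, hT⟩ := (isCompact_closedBall (0 : E) (r + 2 + 1)).elim_finite_subcover
      (fun l : Γ => {x | χ (x - l) ≠ 0})
      (fun l => isOpen_ne_fun (by fun_prop) continuous_const) (fun x _ => by
        obtain ⟨j, hj, hne⟩ := hχ x
        exact mem_iUnion.2 ⟨⟨j, hj⟩, hne⟩)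
    refine ⟨T.image (fun l : Γ => (l : E)), ?_, fun x hx => ?_⟩
    · intro l hl
      obtain ⟨j, -, rfl⟩ := Finset.mem_image.1 hl
      exact j.2
    · have := hT (show x ∈ Metric.closedBall (0 : E) (r + 2 + 1) by simpa using hx)
      simp only [mem_iUnion] at this
      obtain ⟨j, hj, hne⟩ := this
      exact ⟨j, Finset.mem_image.2 ⟨j, hj, rfl⟩, hne⟩
  obtain ⟨ψ, hψ⟩ := exists_schwartz_partition χ S (by linarith : 0 < r + 2) hS
  choose C hC hCb using fun l => enorm_fourier_mul_translate_mul_le (bumpWindow E) (ψ l)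
  refine ⟨∑ l ∈ S, ENNReal.ofReal (C l), by simp [ENNReal.sum_eq_top], fun f hf η => ?_⟩
  refine iSup_le fun t => ?_
  obtain ⟨j, hj, htj⟩ := hΓ t
  have hint : ∀ l, Integrable fun ξ => χ (ξ - (l + j)) * f ξ := fun l =>
    integrable_window_mul χ _ hf
  -- The bump at t lives within 2 of t, hence within r + 2 of the point j of Γ close to t. So the
  -- partition made once around the origin can be shifted by j, and it uses only windows l + j of Γ.
  have hdec : (fun ξ => bumpWindow E (ξ - id t) * f ξ) = fun ξ => ∑ l ∈ S,
      (bumpWindow E (ξ - t) * ψ l (ξ - j)) * (χ (ξ - (l + j)) * f ξ) := by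
    ext ξ
    by_cases hb : 2 ≤ ‖ξ - t‖
    · simp [bumpWindow_eq_zero hb]
    · have hle : ‖ξ - j‖ ≤ r + 2 := by
        have : ξ - j = (ξ - t) + (t - j) := by abel
        rw [this]
        refine (norm_add_le _ _).trans ?_
        linarith [not_le.1 hb]
      have h1 := hψ (ξ - j) hle
      calc bumpWindow E (ξ - id t) * f ξ
          = bumpWindow E (ξ - t) * (∑ l ∈ S, ψ l (ξ - j) * χ (ξ - j - l)) * f ξ := by
            rw [h1]; simp
        _ = _ := by
            rw [Finset.mul_sum, Finset.sum_mul]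
            refine Finset.sum_congr rfl fun l _ => ?_
            rw [show ξ - j - l = ξ - (l + j) by abel]
            ring
  have hint2 : ∀ l ∈ S, Integrable fun ξ => Real.fourierChar (-inner ℝ ξ η) •
      ((bumpWindow E (ξ - t) * ψ l (ξ - j)) * (χ (ξ - (l + j)) * f ξ)) := by
    intro l _
    refine (Real.fourierIntegral_convergent_iff η).2 ?_
    obtain ⟨D, hD, hDb⟩ := schwartz_decay (bumpWindow E) 0
    obtain ⟨D', hD', hDb'⟩ := schwartz_decay (ψ l) 0
    refine (hint l).bdd_mul (c := D * D') (by fun_prop) (Eventually.of_forall fun ξ => ?_)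
    rw [norm_mul]
    exact mul_le_mul (by simpa using hDb _) (by simpa using hDb' _) (norm_nonneg _) hD
  rw [hdec, Real.fourier_eq]
  simp_rw [Finset.smul_sum]
  rw [integral_finsetSum _ hint2]
  refine (enorm_sum_le _ _).trans ?_
  rw [Finset.sum_mul]
  refine Finset.sum_le_sum fun l hl => ?_
  refine (hCb l t j η _ (hint l)).trans ?_
  gcongr
  refine mul_le_of_le_one_of_le (by simpa using decayWeight_le_one _) ?_
  gcongr with ζ
  exact le_iSup (fun i : Γ => ‖𝓕 (fun ξ => χ (ξ - (i : E)) * f ξ) (η - ζ)‖ₑ)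
    ⟨l + j, Γ.add_mem (hSΓ l hl) hj⟩

end Wiener

/-! ### A translation invariant algebra norm equivalent to the Wiener norm -/

/-- The properties of a translation invariant Banach algebra norm on bounded continuous functions
(infinite outside of its domain). -/
structure IsWienerNorm {E : Type*} [NormedAddCommGroup E] (p : (E → ℂ) → ℝ≥0∞) : Prop where
  bddCont : ∀ f, p f ≠ ∞ → BddCont f
  enorm_le : ∀ f ξ, ‖f ξ‖ₑ ≤ p f
  mul_le : ∀ f g, p (fun ξ => f ξ * g ξ) ≤ p f * p g
  translate_le : ∀ f a, p (fun ξ => f (ξ + a)) ≤ p f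
  conj_le : ∀ f, p (fun ξ => conj (f ξ)) ≤ p f
  const_mul_le : ∀ (c : ℂ) f, p (fun ξ => c * f ξ) ≤ ‖c‖ₑ * p f
  le_tsum : ∀ {ι : Type} [Countable ι] (f : ι → E → ℂ) (g : E → ℂ),
    (∀ ξ, HasSum (fun n => f n ξ) (g ξ)) → p g ≤ ∑' n, p (f n)

section Wiener

variable {E : Type*} [NormedAddCommGroup E] [InnerProductSpace ℝ E] [FiniteDimensional ℝ E]
  [MeasurableSpace E] [BorelSpace E]

open Classical in
/-- The norm `C ∫ sup_s |(φ(· - s) f)^|`, where `φ` is the bump function. -/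
def bumpNorm (C : ℝ≥0∞) (f : E → ℂ) : ℝ≥0∞ :=
  if BddCont f then C * ∫⁻ η, windowSup (bumpWindow E) id f η else ∞

theorem bumpNorm_of_bddCont {C : ℝ≥0∞} {f : E → ℂ} (hf : BddCont f) :
    bumpNorm C f = C * ∫⁻ η, windowSup (bumpWindow E) id f η := if_pos hf

theorem bddCont_of_bumpNorm_ne_top {C : ℝ≥0∞} {f : E → ℂ} (h : bumpNorm C f ≠ ∞) : BddCont f := by
  by_contra hf
  exact h (if_neg hf)

theorem enorm_le_bumpNorm {C : ℝ≥0∞} (hC : 1 ≤ C) (f : E → ℂ) (ξ : E) :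
    ‖f ξ‖ₑ ≤ bumpNorm C f := by
  by_cases hf : BddCont f
  · rw [bumpNorm_of_bddCont hf]
    exact (enorm_le_lintegral_windowSup bumpWindow_zero hf ξ).trans (le_mul_of_one_le_left' hC)
  · rw [bumpNorm, if_neg hf]
    exact le_top

/-- When the right side is finite the series converges uniformly, because the norm dominates the sup
norm; so g is bounded continuous, and its norm is the integral rather than ∞. -/
theorem bumpNorm_le_tsum {C : ℝ≥0∞} (hC : 1 ≤ C) {κ : Type*} [Countable κ]
    (f : κ → E → ℂ) (g : E → ℂ) (h : ∀ ξ, HasSum (fun n => f n ξ) (g ξ)) :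
    bumpNorm C g ≤ ∑' n, bumpNorm C (f n) := by
  by_cases htop : ∑' n, bumpNorm C (f n) = ∞
  · rw [htop]; exact le_top
  have hn : ∀ n, bumpNorm C (f n) ≠ ∞ := ENNReal.ne_top_of_tsum_ne_top htop
  have hf : ∀ n, BddCont (f n) := fun n => bddCont_of_bumpNorm_ne_top (hn n)
  have hB : ∀ n ξ, ‖f n ξ‖ ≤ (bumpNorm C (f n)).toReal := by
    intro n ξ
    rw [← ENNReal.ofReal_le_iff_le_toReal (hn n), ofReal_norm]
    exact enorm_le_bumpNorm hC _ ξ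
  have hs : Summable fun n => (bumpNorm C (f n)).toReal := ENNReal.summable_toReal htop
  have hgeq : g = fun ξ => ∑' n, f n ξ := funext fun ξ => (h ξ).tsum_eq.symm
  have hg : BddCont g := by
    refine ⟨?_, ∑' n, (bumpNorm C (f n)).toReal, fun ξ => ?_⟩
    · rw [hgeq]
      exact continuous_tsum (fun n => (hf n).1) hs hB
    · rw [hgeq]
      exact tsum_of_norm_bounded hs.hasSum fun n => hB n ξ
  rw [bumpNorm_of_bddCont hg]
  have : ∀ n, bumpNorm C (f n) = C * ∫⁻ η, windowSup (bumpWindow E) id (f n) η := fun n =>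
    bumpNorm_of_bddCont (hf n)
  simp_rw [this]
  rw [ENNReal.tsum_mul_left, ← lintegral_tsum fun n =>
    (measurable_windowSup (bumpWindow E) id (hf n)).aemeasurable]
  gcongr with η
  exact windowSup_le_tsum _ _ hf hB hs h η

theorem exists_isWienerNorm_bumpNorm :
    ∃ C : ℝ≥0∞, 1 ≤ C ∧ C ≠ ∞ ∧ IsWienerNorm (bumpNorm (E := E) C) := by
  obtain ⟨C, hC, hmul⟩ := exists_lintegral_bumpWindow_mul_le (E := E)
  -- A factor at least 1 keeps the sup norm below the norm; a factor at least C absorbs the constant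
  -- of the product estimate.
  have h1 : 1 ≤ max 1 C := le_max_left _ _
  have htop : max 1 C ≠ ∞ := by simp [hC]
  have hzero : bumpNorm (E := E) (max 1 C) (fun _ => 0) = 0 := by
    have := bumpNorm_le_tsum (E := E) h1 (κ := Empty) (fun n _ => n.elim) (fun _ => 0)
      (fun ξ => by simp)
    simpa using this
  refine ⟨max 1 C, h1, htop, fun f => bddCont_of_bumpNorm_ne_top, enorm_le_bumpNorm h1,
    fun f g => ?_, fun f a => ?_, fun f => ?_, fun c f => ?_, fun {ι} _ f g h =>
      bumpNorm_le_tsum h1 f g h⟩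
  -- As 0 · ∞ = 0, a factor of norm zero must be shown to vanish before the other factor may be
  -- allowed infinite norm.
  · have hz : ∀ f : E → ℂ, bumpNorm (max 1 C) f = 0 → ∀ ξ, f ξ = 0 := fun f hf ξ => by
      simpa [hf] using enorm_le_bumpNorm h1 f ξ
    by_cases hf0 : bumpNorm (max 1 C) f = 0
    · simp [hz f hf0, hzero]
    by_cases hg0 : bumpNorm (max 1 C) g = 0
    · simp [hz g hg0, hzero]
    by_cases hft : bumpNorm (max 1 C) f = ∞
    · rw [hft, ENNReal.top_mul hg0]; exact le_top
    by_cases hgt : bumpNorm (max 1 C) g = ∞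
    · rw [hgt, ENNReal.mul_top hf0]; exact le_top
    have hf := bddCont_of_bumpNorm_ne_top hft
    have hg := bddCont_of_bumpNorm_ne_top hgt
    rw [bumpNorm_of_bddCont (hf.mul hg), bumpNorm_of_bddCont hf, bumpNorm_of_bddCont hg]
    have hfin : ∫⁻ η, windowSup (bumpWindow E) id f η ≠ ∞ := by
      intro h
      rw [bumpNorm_of_bddCont hf, h, ENNReal.mul_top (zero_lt_one.trans_le h1).ne'] at hft
      exact hft rfl
    calc max 1 C * ∫⁻ η, windowSup (bumpWindow E) id (fun ξ => f ξ * g ξ) η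
        ≤ max 1 C * (max 1 C * ((∫⁻ η, windowSup (bumpWindow E) id f η) *
            ∫⁻ η, windowSup (bumpWindow E) id g η)) := by
          gcongr
          refine (hmul f g hf hg hfin).trans ?_
          gcongr
          exact le_max_right _ _
      _ = _ := by ring
  · by_cases hf : BddCont f
    · have hfa : BddCont fun ξ => f (ξ + a) := by
        obtain ⟨hc, B, hB⟩ := hf
        exact ⟨by fun_prop, B, fun ξ => hB _⟩
      rw [bumpNorm_of_bddCont hf, bumpNorm_of_bddCont hfa]
      gcongr with η
      exact windowSup_translate_le _ f a η
    · rw [bumpNorm, bumpNorm, if_neg hf]; exact le_top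
  · by_cases hf : BddCont f
    · have hfa : BddCont fun ξ => conj (f ξ) := by
        obtain ⟨hc, B, hB⟩ := hf
        exact ⟨Complex.continuous_conj.comp hc, B, fun ξ => by simpa using hB ξ⟩
      rw [bumpNorm_of_bddCont hf, bumpNorm_of_bddCont hfa,
        ← lintegral_neg_eq_self (windowSup (bumpWindow E) id f)]
      gcongr with η
      exact windowSup_conj_le conj_bumpWindow f η
    · rw [bumpNorm, bumpNorm, if_neg hf]; exact le_top
  · by_cases hc : c = 0
    · simp [hc, hzero]
    by_cases hf : BddCont f
    · have hfa : BddCont fun ξ => c * f ξ := by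
        obtain ⟨hc, B, hB⟩ := hf
        exact ⟨by fun_prop, ‖c‖ * B, fun ξ => by rw [norm_mul]; gcongr; exact hB ξ⟩
      rw [bumpNorm_of_bddCont hf, bumpNorm_of_bddCont hfa]
      simp_rw [windowSup_const_mul]
      rw [lintegral_const_mul' _ _ (by simp)]
      exact le_of_eq (by ring)
    · rw [bumpNorm, bumpNorm, if_neg hf, ENNReal.mul_top (by simpa using hc)]; exact le_top

theorem lintegral_comp_smul (g : E → ℝ≥0∞) {c : ℝ} (hc : c ≠ 0) :
    ∫⁻ x, g (c • x) = ENNReal.ofReal |(c ^ Module.finrank ℝ E)⁻¹| * ∫⁻ x, g x := by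
  have h := lintegral_map_equiv (μ := (volume : Measure E)) g
    (Homeomorph.smulOfNeZero c hc).toMeasurableEquiv
  have h2 : Measure.map (Homeomorph.smulOfNeZero (α := E) c hc).toMeasurableEquiv volume =
      ENNReal.ofReal |(c ^ Module.finrank ℝ E)⁻¹| • (volume : Measure E) :=
    Measure.map_addHaar_smul volume hc
  rw [h2, lintegral_smul_measure] at h
  exact h.symm

end Wiener

/-- The lattice of a `WienerData`. -/
abbrev WienerData.lattice {d : ℕ} (N : WienerData d) : Submodule ℤ (Eucl d) :=
  Submodule.span ℤ (range N.latticeBasis)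

/-- The two normalizations of the Fourier transform differ by a factor and a dilation of η, which
only change the constant. -/
theorem exists_normSW_eq {d : ℕ} (N : WienerData d) :
    ∃ c : ℝ≥0∞, c ≠ 0 ∧ c ≠ ∞ ∧ ∀ f, normSW N f =
      c * ∫⁻ η, windowSup N.cutoff (fun j : N.lattice => (j : Eucl d)) f η := by
  refine ⟨ENNReal.ofReal N.const * (‖(normConst d : ℂ)‖ₑ *
    ENNReal.ofReal |(((2 * Real.pi)⁻¹ : ℝ) ^ Module.finrank ℝ (Eucl d))⁻¹|), ?_, ?_, fun f => ?_⟩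
  · have h1 := N.const_pos
    have h2 := normConst_pos d
    have h3 := Real.pi_pos
    simp [h1, h2.ne', h3.ne']
  · exact ENNReal.mul_ne_top (by simp) (ENNReal.mul_ne_top (by simp) (by simp))
  · rw [normSW, mul_assoc, mul_assoc, ← lintegral_comp_smul _ (by positivity),
      ← lintegral_const_mul' ‖(normConst d : ℂ)‖ₑ _ (by simp)]
    congr 1
    refine lintegral_congr fun η => ?_
    rw [windowSup, ENNReal.mul_iSup]
    simp only [fourierTr, enorm_mul]

/-- Lattice windows are controlled by all bump windows through the change of window. Conversely the
translates of χ₀ sum to 1, hence have no common zero, so finitely many of them resolve each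
translate of the bump. -/
theorem exists_isWienerNorm_equiv {d : ℕ} (N : WienerData d) :
    ∃ p : (Eucl d → ℂ) → ℝ≥0∞, IsWienerNorm p ∧ ∃ K : ℝ≥0∞, K ≠ ∞ ∧
      (∀ f, normSW N f ≤ K * p f) ∧ ∀ f, BddCont f → p f ≤ K * normSW N f := by
  obtain ⟨C, hC1, hC, hp⟩ := exists_isWienerNorm_bumpNorm (E := Eucl d)
  obtain ⟨c, hc0, hc, hN⟩ := exists_normSW_eq N
  obtain ⟨A, hA, hAle⟩ := lintegral_windowSup_change N.cutoff (bumpWindow (Eucl d))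
    (bumpWindow (Eucl d)) integral_bumpWindow_mul_ne_zero
  obtain ⟨B, hB, hBle⟩ := windowSup_bumpWindow_le N.cutoff N.lattice
    (r := ∑ i, ‖N.latticeBasis i‖) (Finset.sum_nonneg fun i _ => norm_nonneg _)
    (fun t => ⟨ZSpan.floor N.latticeBasis t, (ZSpan.floor N.latticeBasis t).2,
      ZSpan.norm_fract_le N.latticeBasis t⟩)
    (fun x => by
      by_contra! h
      have hs := N.hasSum_cutoff x
      have h0 : (fun j : N.lattice => N.cutoff (x - (j : Eucl d))) = fun _ => 0 :=
        funext fun j => h j j.2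
      rw [h0] at hs
      exact zero_ne_one (hasSum_zero.unique hs))
  set I := ∫⁻ x : Eucl d, ENNReal.ofReal (decayWeight x)
  have hI : I ≠ ∞ := integrable_decayWeight.lintegral_lt_top.ne
  have hB' : ∀ f : Eucl d → ℂ, BddCont f → ∫⁻ η, windowSup (bumpWindow (Eucl d)) id f η ≤
      B * I * ∫⁻ η, windowSup N.cutoff (fun j : N.lattice => (j : Eucl d)) f η := by
    intro f hf
    refine (lintegral_mono fun η => hBle f hf η).trans (le_of_eq ?_)
    rw [lintegral_const_mul' _ _ hB, lintegral_lintegral_mul_sub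
      (by have := measurable_decayWeight (E := Eucl d); fun_prop)
      (measurable_windowSup _ _ hf), mul_assoc]
  -- The two comparison constants are added; the extra 1 makes K nonzero, so that K · ∞ = ∞ when f
  -- is not bounded continuous.
  refine ⟨bumpNorm C, hp, c * A + C * (B * I) * c⁻¹ + 1, ?_, fun f => ?_, fun f hf => ?_⟩
  · exact ENNReal.add_ne_top.2 ⟨ENNReal.add_ne_top.2 ⟨ENNReal.mul_ne_top hc hA, ENNReal.mul_ne_top
      (ENNReal.mul_ne_top hC (ENNReal.mul_ne_top hB hI)) (ENNReal.inv_ne_top.2 hc0)⟩, by simp⟩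
  · by_cases hf : BddCont f
    · rw [hN, bumpNorm_of_bddCont hf, add_mul, add_mul, mul_assoc c]
      refine le_add_right (le_add_right ?_)
      gcongr
      exact (hAle _ f hf).trans (by gcongr; exact le_mul_of_one_le_left' hC1)
    · rw [bumpNorm, if_neg hf, ENNReal.mul_top (by simp)]; exact le_top
  · rw [hN, bumpNorm_of_bddCont hf, add_mul, add_mul]
    refine le_add_right (le_add_left ?_)
    rw [mul_assoc, ← mul_assoc c⁻¹, ENNReal.inv_mul_cancel hc0 hc, one_mul, mul_assoc]
    gcongr
    exact hB' f hf

/-! ### The abstract Newton scheme -/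

/-- A scale of norms on a `*`-algebra (`Bd r a x`: the `r`-norm of `a` is at most `x`), with a
projection `D` on a space of diagonal elements and a derivation whose graph is `Der`. -/
structure KAMScale {A : Type*} [Ring A] [StarRing A] [Algebra ℂ A] (Bd : ℝ → A → ℝ → Prop)
    (D : A → A) (Der : A → A → Prop) : Prop where
  nonneg : ∀ {r a x}, Bd r a x → 0 ≤ x
  zero : ∀ {r}, Bd r 0 0
  mono : ∀ {r a x y}, Bd r a x → x ≤ y → Bd r a y
  anti : ∀ {r r' a x}, Bd r a x → r' ≤ r → Bd r' a x
  add : ∀ {r a b x y}, Bd r a x → Bd r b y → Bd r (a + b) (x + y)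
  smul : ∀ {r a x} (c : ℂ), Bd r a x → Bd r (c • a) (‖c‖ * x)
  mul : ∀ {r a b x y}, 0 ≤ r → Bd r a x → Bd r b y → Bd r (a * b) (x * y)
  bd_star : ∀ {r a x}, Bd r a x → Bd r (star a) x
  eq_zero : ∀ {r a}, 0 ≤ r → (∀ ε : ℝ, 0 < ε → Bd r a ε) → a = 0
  complete : ∀ {r} {u : ℕ → A} {x : ℕ → ℝ}, 0 ≤ r → (∀ n, Bd r (u n) (x n)) → Summable x →
    ∃ s, ∀ n, Bd r (s - ∑ i ∈ Finset.range n, u i) (∑' i, x (i + n))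
  D_add : ∀ a b, D (a + b) = D a + D b
  D_D : ∀ a, D (D a) = D a
  D_star : ∀ a, D (star a) = star (D a)
  D_bd : ∀ {r a x}, Bd r a x → ∀ r', Bd r' (D a) x
  der_add : ∀ {a b a' b'}, Der a b → Der a' b' → Der (a + a') (b + b')
  der_smul : ∀ {a b} (c : ℂ), Der a b → Der (c • a) (c • b)
  der_mul : ∀ {a b a' b'}, Der a b → Der a' b' → Der (a * a') (b * a' + a * b')
  der_one : Der 1 0
  der_unique : ∀ {a b b'}, Der a b → Der a b' → b = b'
  der_bd : ∀ {r}, 0 < r → ∃ C : ℝ, ∀ a x, Bd r a x → ∃ b, Der a b ∧ Bd 0 b (C * x)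

namespace KAMScale

variable {A : Type*} [Ring A] [StarRing A] [Algebra ℂ A] [StarModule ℂ A] {Bd : ℝ → A → ℝ → Prop}
    {D : A → A} {Der : A → A → Prop} (S : KAMScale Bd D Der)

include S

theorem neg {r a x} (ha : Bd r a x) : Bd r (-a) x := by
  simpa using S.smul (-1) ha

theorem sub {r a b x y} (ha : Bd r a x) (hb : Bd r b y) : Bd r (a - b) (x + y) := by
  rw [sub_eq_add_neg]; exact S.add ha (S.neg hb)

theorem eq_zero_of_tendsto {r a} {x : ℕ → ℝ} (hr : 0 ≤ r) (h : ∀ n, Bd r a (x n))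
    (hx : Tendsto x atTop (𝓝 0)) : a = 0 := by
  refine S.eq_zero hr fun ε hε => ?_
  obtain ⟨n, hn⟩ := (hx.eventually (gt_mem_nhds hε)).exists
  exact S.mono (h n) hn.le

theorem D_zero : D 0 = 0 := by
  have := S.D_add 0 0
  simpa using this

theorem D_neg (a : A) : D (-a) = -D a := by
  have := S.D_add a (-a)
  rw [add_neg_cancel, S.D_zero] at this
  exact (neg_eq_of_add_eq_zero_right this.symm).symm

theorem D_sub (a b : A) : D (a - b) = D a - D b := by
  rw [sub_eq_add_neg, S.D_add, S.D_neg, ← sub_eq_add_neg]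

theorem der_neg {a b : A} (h : Der a b) : Der (-a) (-b) := by
  simpa using S.der_smul (-1) h

/-- The norm of the unit is not part of the axioms, so elements near 1 are measured by their
distance to 1. -/
theorem bd_one_add_mul {r w x : ℝ} {u a : A} (hr : 0 ≤ r) (hu : Bd r (u - 1) w) (ha : Bd r a x) :
    Bd r (u * a) ((1 + w) * x) := by
  have := S.add ha (S.mul hr hu ha)
  rw [show a + (u - 1) * a = u * a by noncomm_ring] at this
  exact S.mono this (by ring_nf; rfl)

theorem bd_mul_one_add {r w x : ℝ} {u a : A} (hr : 0 ≤ r) (hu : Bd r (u - 1) w) (ha : Bd r a x) :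
    Bd r (a * u) ((1 + w) * x) := by
  have := S.add ha (S.mul hr ha hu)
  rw [show a + a * (u - 1) = a * u by noncomm_ring] at this
  exact S.mono this (by ring_nf; rfl)

theorem bd_star_sub_one {r w : ℝ} {u : A} (hu : Bd r (u - 1) w) : Bd r (star u - 1) w := by
  simpa using S.bd_star hu

theorem exists_inverse {r g : ℝ} {G : A} (hr : 0 ≤ r) (hG : Bd r G g) (hg : g ≤ 1 / 2) :
    ∃ Y, (1 - G) * Y = 1 ∧ Y * (1 - G) = 1 ∧ Bd r (Y - 1) (2 * g) := by
  have hg0 := S.nonneg hG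
  have hpow : ∀ n, Bd r (G ^ (n + 1)) (g ^ (n + 1)) := by
    intro n
    induction n with
    | zero => simpa using hG
    | succ n ih =>
      rw [pow_succ G, pow_succ g]
      exact S.mul hr ih hG
  have hgeo : HasSum (fun n => g ^ (n + 1)) (g * (1 - g)⁻¹) := by
    have := (hasSum_geometric_of_lt_one hg0 (by linarith)).mul_left g
    simpa [pow_succ'] using this
  obtain ⟨s, hs⟩ := S.complete hr hpow hgeo.summable
  have htail : Tendsto (fun n => ∑' i, g ^ (i + n + 1)) atTop (𝓝 0) :=
    tendsto_sum_nat_add fun n => g ^ (n + 1)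
  have hgn : Tendsto (fun n : ℕ => g ^ (n + 1)) atTop (𝓝 0) :=
    (tendsto_add_atTop_iff_nat 1).2 (tendsto_pow_atTop_nhds_zero_of_lt_one hg0 (by linarith))
  have hlim : Tendsto (fun n => (∑' i, g ^ (i + n + 1)) + g * (∑' i, g ^ (i + n + 1)) +
      g ^ (n + 1)) atTop (𝓝 0) := by
    have := (htail.add (htail.const_mul g)).add hgn
    simpa using this
  have hfin : ∀ n, G * ∑ i ∈ Finset.range n, G ^ (i + 1) =
      ∑ i ∈ Finset.range n, G ^ (i + 1) + G ^ (n + 1) - G := by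
    intro n
    induction n with
    | zero => simp
    | succ n ih => rw [Finset.sum_range_succ, mul_add, ih, pow_succ' G (n + 1)]; abel
  have hcomm : ∀ n, (∑ i ∈ Finset.range n, G ^ (i + 1)) * G =
      G * ∑ i ∈ Finset.range n, G ^ (i + 1) := by
    intro n
    rw [Finset.sum_mul, Finset.mul_sum]
    exact Finset.sum_congr rfl fun i _ => ((Commute.refl G).pow_left _).eq
  refine ⟨1 + s, ?_, ?_, ?_⟩
  · rw [← sub_eq_zero]
    refine S.eq_zero_of_tendsto hr (fun n => ?_) hlim
    have := S.sub (S.sub (hs n) (S.mul hr hG (hs n))) (hpow n)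
    have e : (1 - G) * (1 + s) - 1 = s - ∑ i ∈ Finset.range n, G ^ (i + 1) -
        G * (s - ∑ i ∈ Finset.range n, G ^ (i + 1)) - G ^ (n + 1) := by
      rw [mul_sub, hfin]; noncomm_ring
    rw [e]
    exact this
  · rw [← sub_eq_zero]
    refine S.eq_zero_of_tendsto hr (fun n => ?_) hlim
    have := S.sub (S.sub (hs n) (S.mul hr (hs n) hG)) (hpow n)
    have e : (1 + s) * (1 - G) - 1 = s - ∑ i ∈ Finset.range n, G ^ (i + 1) -
        (s - ∑ i ∈ Finset.range n, G ^ (i + 1)) * G - G ^ (n + 1) := by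
      rw [sub_mul, hcomm, hfin]; noncomm_ring
    rw [e]
    exact S.mono this (le_of_eq (by ring))
  · have := hs 0
    simp only [Finset.range_zero, Finset.sum_empty, sub_zero, add_zero] at this
    rw [hgeo.tsum_eq] at this
    rw [add_sub_cancel_left]
    refine S.mono this ?_
    rw [mul_comm]
    gcongr
    rw [inv_le_comm₀ (by linarith) two_pos]
    linarith

/-- The diagonal part of the conjugation by a unitary close to `1` is invertible. -/
theorem exists_diagonal {r e : ℝ} {U E : A} (hr : 0 ≤ r) (hU : Bd r (U - 1) (1 / 10))
    (hE : Bd r E e) (hEs : star E = E) :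
    ∃ d, D d = d ∧ star d = d ∧ D (U * d * star U) = D E ∧ Bd r d (2 * e) := by
  have he := S.nonneg hE
  have hconj : ∀ {a x}, Bd r a x → Bd r (U * a * star U) (2 * x) := fun ha => by
    have := S.bd_mul_one_add hr (S.bd_star_sub_one hU) (S.bd_one_add_mul hr hU ha)
    exact S.mono this (by have := S.nonneg ha; linarith)
  have hdiff : ∀ {a x}, Bd r a x → Bd r (a - U * a * star U) (1 / 2 * x) := fun {a x} ha => by
    have h1 := S.mul hr hU ha
    have h2 := S.bd_one_add_mul hr hU (S.mul hr ha (S.bd_star_sub_one hU))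
    have := S.neg (S.add h1 h2)
    rw [show -((U - 1) * a + U * (a * (star U - 1))) = a - U * a * star U by
      noncomm_ring] at this
    exact S.mono this (by have := S.nonneg ha; linarith)
  -- For diagonal d the equation is d = D(E) + D(d - U d U*), whose right side contracts by 1/2
  -- since U is close to 1. The `u n` are the terms of its Neumann series.
  let u : ℕ → A := fun n => Nat.rec (D E) (fun _ a => D (a - U * a * star U)) n
  have hu0 : u 0 = D E := rfl
  have hus : ∀ n, u (n + 1) = D (u n - U * u n * star U) := fun n => rfl
  have hub : ∀ n, Bd r (u n) (e * (1 / 2) ^ n) := by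
    intro n
    induction n with
    | zero => simpa [hu0] using S.D_bd hE r
    | succ n ih =>
      rw [hus]
      exact S.mono (S.D_bd (hdiff ih) r) (le_of_eq (by ring))
  have huD : ∀ n, D (u n) = u n := by
    intro n
    cases n with
    | zero => rw [hu0, S.D_D]
    | succ n => rw [hus, S.D_D]
  have hustar : ∀ n, star (u n) = u n := by
    intro n
    induction n with
    | zero => rw [hu0, ← S.D_star, hEs]
    | succ n ih =>
      rw [hus, ← S.D_star]
      simp only [star_sub, star_mul, star_star, ih, mul_assoc]
  have hgeo : HasSum (fun n : ℕ => e * (1 / 2) ^ n) (e * 2) := by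
    have := (hasSum_geometric_of_lt_one (r := (1 / 2 : ℝ)) (by norm_num) (by norm_num)).mul_left e
    norm_num at this ⊢
    exact this
  obtain ⟨s, hs⟩ := S.complete hr hub hgeo.summable
  set t : ℕ → ℝ := fun n => ∑' i, e * (1 / 2) ^ (i + n) with ht
  have htail : Tendsto t atTop (𝓝 0) := tendsto_sum_nat_add fun n => e * (1 / 2 : ℝ) ^ n
  have hen : Tendsto (fun n : ℕ => e * (1 / 2 : ℝ) ^ n) atTop (𝓝 0) :=
    hgeo.summable.tendsto_atTop_zero
  have hsum : ∀ n, D (∑ i ∈ Finset.range n, u i) = ∑ i ∈ Finset.range n, u i ∧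
      star (∑ i ∈ Finset.range n, u i) = ∑ i ∈ Finset.range n, u i ∧
      D (U * (∑ i ∈ Finset.range n, u i) * star U) = D E - u n := by
    intro n
    induction n with
    | zero => simp [S.D_zero, hu0]
    | succ n ih =>
      obtain ⟨h1, h2, h3⟩ := ih
      rw [Finset.sum_range_succ]
      refine ⟨by rw [S.D_add, h1, huD], by rw [star_add, h2, hustar], ?_⟩
      rw [mul_add, add_mul, S.D_add, h3, hus, S.D_sub, huD]
      abel
  refine ⟨s, ?_, ?_, ?_, ?_⟩
  · rw [← sub_eq_zero]
    refine S.eq_zero_of_tendsto hr (x := fun n => t n + t n) (fun n => ?_)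
      (by simpa using htail.add htail)
    have := S.sub (S.D_bd (hs n) r) (hs n)
    rw [S.D_sub, (hsum n).1, sub_sub_sub_cancel_right] at this
    exact this
  · rw [← sub_eq_zero]
    refine S.eq_zero_of_tendsto hr (x := fun n => t n + t n) (fun n => ?_)
      (by simpa using htail.add htail)
    have := S.sub (S.bd_star (hs n)) (hs n)
    rw [star_sub, (hsum n).2.1, sub_sub_sub_cancel_right] at this
    exact this
  · rw [← sub_eq_zero]
    refine S.eq_zero_of_tendsto hr (x := fun n => 2 * t n + e * (1 / 2) ^ n) (fun n => ?_)
      (by simpa using (htail.const_mul 2).add hen)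
    have := S.sub (S.D_bd (hconj (hs n)) r) (hub n)
    rw [mul_sub, sub_mul, S.D_sub, (hsum n).2.2] at this
    rw [show D (U * s * star U) - D E =
      D (U * s * star U) - (D E - u n) - u n by abel]
    exact this
  · have := hs 0
    simp only [Finset.range_zero, Finset.sum_empty, sub_zero, add_zero] at this
    rw [hgeo.tsum_eq] at this
    exact S.mono this (by linarith)

/-- One step of the Newton scheme. -/
theorem exists_step {r r' q e : ℝ} {U R E V : A} (hr' : 0 < r') (hrr : r' ≤ r)
    (hsolve : ∀ B y, D B = 0 → star B = B → Bd r B y →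
      ∃ G, Der G B ∧ star G = -G ∧ Bd r' G (q * y))
    (hq : 0 ≤ q) (hqe : 8 * (q * e) ≤ 1) (hU : Bd r (U - 1) (1 / 10)) (hUU : star U * U = 1)
    (hUU' : U * star U = 1) (hE : Bd r E e) (hEs : star E = E)
    (hder : Der U (U * (V - R) - E * U)) :
    ∃ U' R' E', star U' * U' = 1 ∧ U' * star U' = 1 ∧ star E' = E' ∧
      Der U' (U' * (V - R') - E' * U') ∧ star (R' - R) = R' - R ∧ D (R' - R) = R' - R ∧
      D (U * (R' - R) * star U) = D E ∧ Bd r (R' - R) (2 * e) ∧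
      Bd r' (U' - U) (16 * (q * e)) ∧ Bd r' E' (80 * (q * e ^ 2)) := by
  have hr : 0 ≤ r := hr'.le.trans hrr
  have he := S.nonneg hE
  obtain ⟨d, hdD, hds, hdE, hdb⟩ := S.exists_diagonal hr hU hE hEs
  -- The error of L + V - (R + d) conjugated by U: subtracting d before the conjugation subtracts U
  -- d U* after it.
  set B := E - U * d * star U with hB
  have hDB : D B = 0 := by rw [hB, S.D_sub, hdE, sub_self]
  have hBs : star B = B := by
    simp only [hB, star_sub, star_mul, star_star, hds, hEs, mul_assoc]
  have hBb : Bd r B (4 * e) := by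
    have := S.sub hE (S.bd_mul_one_add hr (S.bd_star_sub_one hU) (S.bd_one_add_mul hr hU hdb))
    exact S.mono this (by linarith)
  obtain ⟨F, hFder, hFs, hFb⟩ := hsolve B _ hDB hBs hBb
  -- With half of F, the Cayley transform (1 - G)⁻¹ (1 + G) is 1 + F to first order. It is exactly
  -- unitary because G is skew-adjoint, and only one inverse has to be differentiated.
  set G := (1 / 2 : ℂ) • F with hG
  set H := (1 / 2 : ℂ) • B with hH
  have hHH : B = H + H := by rw [hH, ← add_smul]; norm_num
  have hGder : Der G H := S.der_smul _ hFder
  have hGs : star G = -G := by rw [hG, star_smul, hFs]; simp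
  set g := 2 * (q * e) with hg
  have hqe0 : 0 ≤ q * e := mul_nonneg hq he
  have hGb : Bd r' G g := S.mono (S.smul _ hFb) (by norm_num; rw [hg]; linarith)
  have hBb' := S.anti hBb hrr
  have hU' := S.anti hU hrr
  obtain ⟨Y, hY1, hY2, hYb⟩ := S.exists_inverse hr'.le hGb (by linarith)
  obtain ⟨Y', hY1', hY2', hYb'⟩ := S.exists_inverse hr'.le (S.neg hGb) (by linarith)
  rw [sub_neg_eq_add] at hY1' hY2'
  have hYs : star Y = Y' := by
    refine left_inv_eq_right_inv (a := 1 + G) ?_ hY1'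
    have := congrArg star hY1
    simpa [hGs] using this
  have hYs' : star Y' = Y := by rw [← hYs, star_star]
  have hYY : Y' * Y = Y * Y' := by
    refine (left_inv_eq_right_inv (a := (1 + G) * (1 - G)) ?_ ?_).symm
    · rw [mul_assoc, ← mul_assoc Y', hY2', one_mul, hY2]
    · rw [show (1 + G) * (1 - G) = (1 - G) * (1 + G) by noncomm_ring, mul_assoc,
        ← mul_assoc (1 + G), hY1', one_mul, hY1]
  have hYG : Y * (1 + G) = (1 + G) * Y := by
    have h1 : Y * G = Y - 1 := by
      rw [mul_sub, mul_one] at hY2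
      rw [← hY2]; abel
    have h2 : G * Y = Y - 1 := by
      rw [sub_mul, one_mul] at hY1
      rw [← hY1]; abel
    rw [mul_add, add_mul, h1, h2, mul_one, one_mul]
  set X := Y * (1 + G) with hX
  have hXs : star X = (1 - G) * Y' := by
    rw [hX, star_mul, hYs, star_add, star_one, hGs, sub_eq_add_neg]
  have hXX : star X * X = 1 := by
    rw [hXs, hX, mul_assoc, ← mul_assoc Y', hYY, mul_assoc Y, hY2', mul_one, hY1]
  have hXX' : X * star X = 1 := by
    rw [hXs, hX, mul_assoc, ← mul_assoc (1 + G),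
      show (1 + G) * (1 - G) = (1 - G) * (1 + G) by noncomm_ring, mul_assoc, hY1', mul_one, hY2]
  -- the derivative of `X`
  obtain ⟨C, hC⟩ := S.der_bd hr'
  obtain ⟨z, hz, -⟩ := hC _ _ hYb
  have hYder : Der Y z := by simpa using S.der_add hz S.der_one
  have h1G : Der (1 - G) (-H) := by
    simpa [sub_eq_add_neg] using S.der_add S.der_one (S.der_neg hGder)
  have h1G' : Der (1 + G) H := by simpa using S.der_add S.der_one hGder
  -- `der_bd` provides some derivative z of Y; differentiating (1 - G) Y = 1 identifies it.
  have hz : z = Y * H * Y := by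
    have h := S.der_mul h1G hYder
    rw [hY1] at h
    have h0 := S.der_unique h S.der_one
    have h2 : (1 - G) * z = H * Y := by
      have : (1 - G) * z = (-H * Y + (1 - G) * z) + H * Y := by noncomm_ring
      rw [this, h0, zero_add]
    calc z = Y * (1 - G) * z := by rw [hY2, one_mul]
      _ = Y * H * Y := by rw [mul_assoc, h2, mul_assoc]
  have hXder : Der X (Y * H * Y * (1 + G) + Y * H) := by
    have := S.der_mul hYder h1G'
    rwa [hz] at this
  -- Since [L, G] = B/2, the terms of first order cancel in X (L + B) X* = L + Y Q Y', and Q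
  -- collects terms at least bilinear in G and B.
  set Q := G * B - B * G - G * B * G with hQ
  have hEX : Y * Q * Y' * X = X * B - (Y * H * Y * (1 + G) + Y * H) := by
    have hQ' : Q = (1 + G) * B * (1 - G) - H * (1 + G) - H * (1 - G) := by
      rw [hQ, hHH]; noncomm_ring
    have h1 : Y * Q * Y' * X = Y * (Q * Y) := by
      rw [hX, mul_assoc, ← mul_assoc Y', hYY, mul_assoc Y Y', hY2', mul_one, mul_assoc]
    have h2 : Q * Y = (1 + G) * B - H * X - H := by
      rw [hYG, hQ', sub_mul, sub_mul, mul_assoc, hY1, mul_one, mul_assoc H, mul_assoc H, hY1,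
        mul_one]
    rw [h1, h2, hX]
    noncomm_ring
  have hds' : star (R + d - R) = R + d - R := by rw [add_sub_cancel_left, hds]
  refine ⟨X * U, R + d, Y * Q * Y', ?_, ?_, ?_, ?_, hds', ?_, ?_, ?_, ?_, ?_⟩
  · rw [star_mul, mul_assoc, ← mul_assoc (star X), hXX, one_mul, hUU]
  · rw [star_mul, mul_assoc, ← mul_assoc U, hUU', one_mul, hXX']
  · have hQs : star Q = Q := by
      rw [hQ]
      simp only [star_sub, star_mul, hBs, hGs]
      noncomm_ring
    rw [star_mul, star_mul, hYs', hYs, hQs, mul_assoc]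
  · have := S.der_mul hXder hder
    convert this using 1
    have hUd : U * d = U * d * star U * U := by rw [mul_assoc _ _ U, hUU, mul_one]
    have hEB : E = B + U * d * star U := by rw [hB]; abel
    calc X * U * (V - (R + d)) - Y * Q * Y' * (X * U)
        = X * (U * (V - R)) - X * (U * d) - Y * Q * Y' * X * U := by noncomm_ring
      _ = _ := by
        rw [hEX, hUd, hEB]
        noncomm_ring
  · rw [add_sub_cancel_left, hdD]
  · rw [add_sub_cancel_left, hdE]
  · rw [add_sub_cancel_left]; exact hdb
  · have h1 := S.add (S.bd_one_add_mul hr'.le hYb hGb) hYb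
    rw [show Y * G + (Y - 1) = X - 1 by rw [hX]; noncomm_ring] at h1
    have h2 := S.bd_mul_one_add hr'.le hU' h1
    rw [show (X - 1) * U = X * U - U by noncomm_ring] at h2
    exact S.mono h2 (by nlinarith)
  · have h1 := S.sub (S.sub (S.mul hr'.le hGb hBb') (S.mul hr'.le hBb' hGb))
      (S.mul hr'.le (S.mul hr'.le hGb hBb') hGb)
    have h2 := S.bd_mul_one_add hr'.le hYb' (S.bd_one_add_mul hr'.le hYb h1)
    refine S.mono h2 ?_
    have hg4 : g ≤ 1 / 4 := by linarith
    have hg0 : 0 ≤ g := by positivity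
    have hge : 0 ≤ g * e := mul_nonneg hg0 he
    have h3 : (1 + 2 * g) ^ 2 ≤ 9 / 4 := by nlinarith
    have h4 : g * (4 * e) + 4 * e * g + g * (4 * e) * g ≤ 9 * (g * e) := by nlinarith
    calc (1 + 2 * g) * ((1 + 2 * g) * (g * (4 * e) + 4 * e * g + g * (4 * e) * g))
        = (1 + 2 * g) ^ 2 * (g * (4 * e) + 4 * e * g + g * (4 * e) * g) := by ring
      _ ≤ 9 / 4 * (9 * (g * e)) := mul_le_mul h3 h4 (by positivity) (by norm_num)
      _ ≤ 80 * (q * e ^ 2) := by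
        have : 0 ≤ q * e ^ 2 := by positivity
        rw [hg]
        nlinarith

/-- Newton scheme: `V` is conjugated to a diagonal counterterm, up to the unperturbed operator. -/
theorem exists_conjugation {ρ c e M : ℝ} {τ : ℕ} {V : A} (hρ : 0 < ρ) (hc : 0 ≤ c)
    (hsolve : ∀ r r' B y, 0 < r' → r' < r → D B = 0 → star B = B → Bd r B y →
      ∃ G, Der G B ∧ star G = -G ∧ Bd r' G (c / (r - r') ^ τ * y))
    (hV : Bd ρ V e) (hVs : star V = V) (hM : M = 320 * (c * (4 / ρ) ^ τ) * 2 ^ τ)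
    (hsmall : M * e ≤ 1) :
    ∃ U R, star U * U = 1 ∧ U * star U = 1 ∧ star R = R ∧ D R = R ∧ Bd 0 (R - D V) (2 * (M * e ^ 2)) ∧
      Der U (U * (V - R)) := by
  have he := S.nonneg hV
  set s := c * (4 / ρ) ^ τ with hs
  have hs0 : 0 ≤ s := by positivity
  set b : ℝ := 2 ^ τ with hb
  have hb1 : 1 ≤ b := one_le_pow₀ one_le_two
  have hM0 : 0 ≤ M := by rw [hM]; positivity
  -- The radii start at ρ and decrease to ρ/2; a positive radius must survive so that the limit can
  -- be differentiated.
  set r : ℕ → ℝ := fun n => ρ * (1 / 2 + (1 / 2) ^ (n + 1)) with hr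
  have hrpos : ∀ n, ρ / 2 ≤ r n := fun n => by
    have : (0 : ℝ) ≤ (1 / 2) ^ (n + 1) := by positivity
    rw [hr]; nlinarith
  have hrdiff : ∀ n, r n - r (n + 1) = ρ / 4 * (1 / 2) ^ n := fun n => by
    rw [hr]; ring
  have hrlt : ∀ n, r (n + 1) < r n := fun n => by
    have := hrdiff n
    have : 0 < ρ / 4 * (1 / 2 : ℝ) ^ n := by positivity
    linarith
  set q : ℕ → ℝ := fun n => c / (r n - r (n + 1)) ^ τ with hq
  have hqn : ∀ n, q n = s * b ^ n := fun n => by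
    rw [hq, hs, hb]
    simp only
    rw [hrdiff, mul_pow, ← pow_mul, ← pow_mul, mul_comm n τ, one_div, inv_pow, div_pow, div_pow]
    field_simp
  -- The rate 4b beats the growth q_n = s bⁿ of the small divisor loss: 80 q_n (a (4b)⁻ⁿ)² ≤ 80 s a²
  -- (4b)⁻ⁿ = M a² (4b)⁻⁽ⁿ⁺¹⁾ for M = 320 s b. The increments of U are at most 2⁻ⁿ/20, so U stays
  -- within 1/10 of 1.
  have hstep : ∀ (n : ℕ) (a : ℝ) (U R E : A), 0 ≤ a → M * a ≤ 1 →
      Bd (r n) (U - 1) ((1 - (1 / 2) ^ n) / 10) → star U * U = 1 → U * star U = 1 →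
      Bd (r n) E (a * ((4 * b) ^ n)⁻¹) → star E = E → Der U (U * (V - R) - E * U) →
      ∃ U' R' E', Bd (r (n + 1)) (U' - 1) ((1 - (1 / 2) ^ (n + 1)) / 10) ∧
        star U' * U' = 1 ∧ U' * star U' = 1 ∧
        Bd (r (n + 1)) E' (M * a ^ 2 * ((4 * b) ^ (n + 1))⁻¹) ∧ star E' = E' ∧
        Der U' (U' * (V - R') - E' * U') ∧ star (R' - R) = R' - R ∧ D (R' - R) = R' - R ∧
        D (U * (R' - R) * star U) = D E ∧ Bd 0 (R' - R) (2 * a * (1 / 2) ^ n) ∧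
        Bd (ρ / 2) (U' - U) ((1 / 2) ^ n) := by
    intro n a U R E ha hMa hU hUU hUU' hE hEs hder
    have h4n : (0 : ℝ) < (1 / 2) ^ n := by positivity
    have h4n1 : (1 / 2 : ℝ) ^ n ≤ 1 := pow_le_one₀ (by norm_num) (by norm_num)
    have hbn : (0 : ℝ) < b ^ n := by positivity
    have hqe : q n * (a * ((4 * b) ^ n)⁻¹) = s * a * ((1 / 2) ^ n * (1 / 2) ^ n) := by
      rw [hqn, mul_pow, ← mul_pow (1 / 2 : ℝ), show (1 / 2 : ℝ) * (1 / 2) = 4⁻¹ by norm_num, inv_pow]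
      field_simp
    have hsa : 320 * (s * a) ≤ 1 := by
      have : 0 ≤ s * a := mul_nonneg hs0 ha
      rw [hM] at hMa
      nlinarith
    have hsa0 : 0 ≤ s * a := mul_nonneg hs0 ha
    have hqe1 : q n * (a * ((4 * b) ^ n)⁻¹) ≤ 1 / 320 * (1 / 2) ^ n := by
      rw [hqe]
      have : (1 / 2 : ℝ) ^ n * (1 / 2) ^ n ≤ (1 / 2) ^ n := by nlinarith
      exact mul_le_mul (by linarith) this (by positivity) (by norm_num)
    have hq0 : 0 ≤ q n := by rw [hqn]; positivity
    obtain ⟨U', R', E', h1, h2, h3, h4, h5, h6, h7, h8, h9, h10⟩ := S.exists_step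
      (r := r n) (r' := r (n + 1)) (q := q n) (e := a * ((4 * b) ^ n)⁻¹) (V := V)
      (by have := hrpos (n + 1); linarith) (hrlt n).le
      (fun B y => hsolve (r n) (r (n + 1)) B y (by have := hrpos (n + 1); linarith) (hrlt n))
      hq0 (by linarith) (S.mono hU (by linarith)) hUU hUU' hE hEs hder
    refine ⟨U', R', E', ?_, h1, h2, S.mono h10 ?_, h3, h4, h5, h6, h7,
      S.mono (S.anti h8 (by have := hrpos n; linarith)) ?_,
      S.mono (S.anti h9 (hrpos (n + 1))) (by linarith)⟩
    · have := S.add (S.anti hU (hrlt n).le) h9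
      rw [show U - 1 + (U' - U) = U' - 1 by abel] at this
      refine S.mono this ?_
      rw [pow_succ]
      linarith
    · have : 80 * (q n * (a * ((4 * b) ^ n)⁻¹) ^ 2) =
          80 * (s * a ^ 2 * ((1 / 2) ^ n * (1 / 2) ^ n)) * ((4 * b) ^ n)⁻¹ := by
        rw [pow_two, ← mul_assoc (q n), hqe]; ring
      rw [this, hM, pow_succ (4 * b), mul_inv]
      have h11 : (1 / 2 : ℝ) ^ n * (1 / 2) ^ n ≤ 1 := by nlinarith
      have h12 : 320 * s * b * a ^ 2 * (((4 * b) ^ n)⁻¹ * (4 * b)⁻¹) =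
        80 * (s * a ^ 2 * 1) * ((4 * b) ^ n)⁻¹ := by field_simp; ring
      rw [h12]
      gcongr
    · have : ((4 * b) ^ n)⁻¹ ≤ (1 / 2 : ℝ) ^ n := by
        rw [one_div, inv_pow]
        gcongr
        linarith
      nlinarith
  -- The first step is made separately, from U = 1, R = 0, E = V. It yields R₁ = D(V) exactly and
  -- lowers the error constant from e to M e², which then bounds all later counterterms.
  have hfirst := hstep 0 e 1 0 V he hsmall (by simpa using S.zero) (by simp) (by simp)
    (by
      have : r 0 = ρ := by rw [hr]; ring
      simpa [this] using hV) hVs (by simpa using S.der_one)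
  obtain ⟨U₁, R₁, E₁, hU₁, hUU₁, hUU₁', hE₁, hEs₁, hder₁, hRs₁, hRD₁, hR₁, -, -⟩ := hfirst
  have hR1 : R₁ = D V := by
    have h1 : D R₁ = D V := by simpa using hR₁
    rw [← h1, ← sub_zero R₁, hRD₁]
  set a := M * e ^ 2 with ha
  have ha0 : 0 ≤ a := by positivity
  have hMa : M * a ≤ 1 := by
    have : M * a = (M * e) ^ 2 := by rw [ha]; ring
    rw [this]
    exact pow_le_one₀ (by positivity) hsmall
  have hMaa : M * a ^ 2 ≤ a := by nlinarith
  let Inv : ℕ → A × A × A → Prop := fun n x =>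
    Bd (r n) (x.1 - 1) ((1 - (1 / 2) ^ n) / 10) ∧ star x.1 * x.1 = 1 ∧ x.1 * star x.1 = 1 ∧
      Bd (r n) x.2.2 (a * ((4 * b) ^ n)⁻¹) ∧ star x.2.2 = x.2.2 ∧
      Der x.1 (x.1 * (V - x.2.1) - x.2.2 * x.1) ∧ star x.2.1 = x.2.1 ∧ D x.2.1 = x.2.1
  let Rel : ℕ → A × A × A → A × A × A → Prop := fun n x y =>
    Bd 0 (y.2.1 - x.2.1) (2 * a * (1 / 2) ^ n) ∧ Bd (ρ / 2) (y.1 - x.1) ((1 / 2) ^ n)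
  have hnext : ∀ n (x : {x // Inv n x}), ∃ y : {y // Inv (n + 1) y}, Rel n x.1 y.1 := by
    rintro n ⟨⟨U, R, E⟩, hU, hUU, hUU', hE, hEs, hder, hRs, hRD⟩
    obtain ⟨U', R', E', h1, h2, h3, h4, h5, h6, h7, h8, h9, h10, h11⟩ :=
      hstep n a U R E ha0 hMa hU hUU hUU' hE hEs hder
    refine ⟨⟨(U', R', E'), h1, h2, h3, S.mono h4 (by gcongr), h5, h6, ?_, ?_⟩, h10, h11⟩
    · have := star_sub R' R
      rw [h7, hRs] at this
      exact (sub_left_injective this).symm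
    · have := S.D_sub R' R
      rw [h8, hRD] at this
      exact (sub_left_injective this).symm
  choose next hrel using hnext
  -- The index is shifted by one: `sq n` is the state after n + 1 steps.
  let sq : ∀ n : ℕ, {x // Inv (n + 1) x} := fun n => Nat.rec
    ⟨(U₁, R₁, E₁), hU₁, hUU₁, hUU₁', hE₁, hEs₁, hder₁, by simpa using hRs₁, by simpa using hRD₁⟩
    (fun n x => next (n + 1) x) n
  have hsq : ∀ n, Rel (n + 1) (sq n).1 (sq (n + 1)).1 := fun n => hrel (n + 1) (sq n)
  set Un : ℕ → A := fun n => (sq n).1.1 with hUn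
  set Rn : ℕ → A := fun n => (sq n).1.2.1 with hRn
  set En : ℕ → A := fun n => (sq n).1.2.2 with hEn
  have hgeo2 : HasSum (fun n : ℕ => (1 / 2 : ℝ) ^ (n + 1)) 1 := by
    have := (hasSum_geometric_of_lt_one (r := (1 / 2 : ℝ)) (by norm_num) (by norm_num)).mul_left
      (1 / 2)
    norm_num at this
    simpa [pow_succ'] using this
  have hRsum : HasSum (fun n : ℕ => 2 * a * (1 / 2 : ℝ) ^ (n + 1)) (2 * a) := by
    simpa using hgeo2.mul_left (2 * a)
  obtain ⟨sR, hsR⟩ := S.complete le_rfl (u := fun n => Rn (n + 1) - Rn n)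
    (fun n => (hsq n).1) hRsum.summable
  obtain ⟨sU, hsU⟩ := S.complete (by positivity) (u := fun n => Un (n + 1) - Un n)
    (fun n => (hsq n).2) hgeo2.summable
  set tR : ℕ → ℝ := fun n => ∑' i, 2 * a * (1 / 2 : ℝ) ^ (i + n + 1) with htR
  set tU : ℕ → ℝ := fun n => ∑' i, (1 / 2 : ℝ) ^ (i + n + 1) with htU
  have htR0 : Tendsto tR atTop (𝓝 0) := tendsto_sum_nat_add fun n => 2 * a * (1 / 2 : ℝ) ^ (n + 1)
  have htU0 : Tendsto tU atTop (𝓝 0) := tendsto_sum_nat_add fun n => (1 / 2 : ℝ) ^ (n + 1)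
  set R := D V + sR with hR
  set U := U₁ + sU with hU
  have hRb : ∀ n, Bd 0 (R - Rn n) (tR n) := fun n => by
    have := hsR n
    rw [Finset.sum_range_sub] at this
    rwa [show sR - (Rn n - Rn 0) = R - Rn n by rw [hR, ← hR1]; change sR - (Rn n - R₁) = _; abel]
      at this
  have hUb : ∀ n, Bd (ρ / 2) (U - Un n) (tU n) := fun n => by
    have := hsU n
    rw [Finset.sum_range_sub] at this
    rwa [show sU - (Un n - Un 0) = U - Un n by rw [hU]; change sU - (Un n - U₁) = _; abel] at this
  have hUb0 : ∀ n, Bd 0 (U - Un n) (tU n) := fun n => S.anti (hUb n) (by positivity)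
  have hUn1 : ∀ n, Bd 0 (Un n - 1) (1 / 10) := fun n => by
    refine S.mono (S.anti (sq n).2.1 (by have := hrpos (n + 1); linarith)) ?_
    have : (0 : ℝ) ≤ (1 / 2) ^ (n + 1) := by positivity
    linarith
  obtain ⟨w, hw⟩ : ∃ w, Bd 0 (U - 1) w := by
    refine ⟨tU 0 + 1 / 10, ?_⟩
    have := S.add (hUb0 0) (hUn1 0)
    rwa [sub_add_sub_cancel] at this
  have hEb : ∀ n, Bd 0 (En n) (a * (1 / 2) ^ n) := fun n => by
    refine S.mono (S.anti (sq n).2.2.2.2.1 (by have := hrpos (n + 1); linarith)) ?_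
    have h1 : ((4 * b) ^ (n + 1))⁻¹ ≤ (1 / 2 : ℝ) ^ n := by
      rw [one_div, inv_pow]
      gcongr
      calc (2 : ℝ) ^ n ≤ 2 ^ (n + 1) := by gcongr <;> norm_num
        _ ≤ (4 * b) ^ (n + 1) := by gcongr; linarith
    gcongr
  have hEt : Tendsto (fun n : ℕ => a * (1 / 2 : ℝ) ^ n) atTop (𝓝 0) := by
    simpa using (tendsto_pow_atTop_nhds_zero_of_lt_one (r := (1 / 2 : ℝ)) (by norm_num)
      (by norm_num)).const_mul a
  obtain ⟨C, hC⟩ := S.der_bd (r := ρ / 2) (by positivity)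
  refine ⟨U, R, ?_, ?_, ?_, ?_, ?_, ?_⟩
  · rw [← sub_eq_zero]
    refine S.eq_zero_of_tendsto (r := 0) le_rfl
      (x := fun n => (1 + w) * tU n + (1 + 1 / 10) * tU n) (fun n => ?_)
      (by simpa only [mul_zero, add_zero] using (htU0.const_mul (1 + w)).add (htU0.const_mul (1 + 1 / 10)))
    have := S.add (S.bd_mul_one_add le_rfl hw (S.bd_star (hUb0 n)))
      (S.bd_one_add_mul le_rfl (S.bd_star_sub_one (hUn1 n)) (hUb0 n))
    rwa [star_sub, sub_mul, mul_sub, show star (Un n) * Un n = 1 from (sq n).2.2.1,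
      sub_add_sub_cancel] at this
  · rw [← sub_eq_zero]
    refine S.eq_zero_of_tendsto (r := 0) le_rfl
      (x := fun n => (1 + w) * tU n + (1 + 1 / 10) * tU n) (fun n => ?_)
      (by simpa only [mul_zero, add_zero] using (htU0.const_mul (1 + w)).add (htU0.const_mul (1 + 1 / 10)))
    have := S.add (S.bd_mul_one_add le_rfl (S.bd_star_sub_one hw) (hUb0 n))
      (S.bd_one_add_mul le_rfl (hUn1 n) (S.bd_star (hUb0 n)))
    rwa [star_sub, sub_mul, mul_sub, show Un n * star (Un n) = 1 from (sq n).2.2.2.1,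
      sub_add_sub_cancel] at this
  · rw [← sub_eq_zero]
    refine S.eq_zero_of_tendsto (r := 0) le_rfl (x := fun n => tR n + tR n) (fun n => ?_)
      (by simpa using htR0.add htR0)
    have := S.sub (S.bd_star (hRb n)) (hRb n)
    rwa [star_sub, show star (Rn n) = Rn n from (sq n).2.2.2.2.2.2.2.1,
      sub_sub_sub_cancel_right] at this
  · rw [← sub_eq_zero]
    refine S.eq_zero_of_tendsto (r := 0) le_rfl (x := fun n => tR n + tR n) (fun n => ?_)
      (by simpa using htR0.add htR0)
    have := S.sub (S.D_bd (hRb n) 0) (hRb n)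
    rwa [S.D_sub, show D (Rn n) = Rn n from (sq n).2.2.2.2.2.2.2.2,
      sub_sub_sub_cancel_right] at this
  · have := hsR 0
    simp only [Finset.range_zero, Finset.sum_empty, sub_zero, add_zero] at this
    rw [hRsum.tsum_eq] at this
    rwa [hR, add_sub_cancel_left]
  -- The derivation is unbounded, but `der_bd` turns convergence of U_n at radius ρ/2 into
  -- convergence of the derivatives at radius 0, where the limit identity is read off.
  · obtain ⟨z, hz, -⟩ := hC _ _ (hUb 0)
    have hdn : ∀ n, Der (Un n) (Un n * (V - Rn n) - En n * Un n) := fun n => (sq n).2.2.2.2.2.2.1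
    have hU0 : Der U (z + (Un 0 * (V - Rn 0) - En 0 * Un 0)) := by
      have := S.der_add hz (hdn 0)
      rwa [sub_add_cancel] at this
    obtain ⟨y, hy⟩ : ∃ y, Bd 0 (V - R) y :=
      ⟨_, by have := S.sub (S.anti hV hρ.le) (S.add (hRb 0) (S.sub S.zero (S.neg (S.D_bd hV 0))))
             rw [zero_sub, neg_neg] at this
             have h0 : R - Rn 0 + D V = R := by
               change R - R₁ + D V = R
               rw [hR1]; abel
             rwa [h0] at this⟩
    convert hU0 using 1
    rw [← sub_eq_zero]
    refine S.eq_zero_of_tendsto (r := 0) le_rfl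
      (x := fun n => tU n * y + ((1 + 1 / 10) * (a * (1 / 2) ^ n) + C * tU n) +
        (1 + 1 / 10) * tR n) (fun n => ?_)
      (by simpa only [mul_zero, zero_mul, add_zero] using ((htU0.mul_const y).add ((hEt.const_mul (1 + 1 / 10)).add
        (htU0.const_mul C))).add (htR0.const_mul (1 + 1 / 10)))
    obtain ⟨zn, hzn, hznb⟩ := hC _ _ (hUb n)
    have hUn' : Der U (zn + (Un n * (V - Rn n) - En n * Un n)) := by
      have := S.der_add hzn (hdn n)
      rwa [sub_add_cancel] at this
    rw [S.der_unique hU0 hUn']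
    have h1 := S.sub (S.add (S.mul le_rfl (hUb0 n) hy) (S.sub
      (S.bd_mul_one_add le_rfl (hUn1 n) (hEb n)) hznb)) (S.bd_one_add_mul le_rfl (hUn1 n) (hRb n))
    convert h1 using 1
    noncomm_ring

end KAMScale

/-! ### Matrix entries of bounded operators and Schur's test -/

section MatrixEntries

variable {ι H : Type*} [NormedAddCommGroup H] [InnerProductSpace ℂ H]

/-- The matrix entries of a bounded operator in a Hilbert basis. -/
def entry (b : HilbertBasis ι ℂ H) (T : H →L[ℂ] H) (j k : ι) : ℂ := inner ℂ (b j) (T (b k))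

theorem entry_eq_repr (b : HilbertBasis ι ℂ H) (T : H →L[ℂ] H) (j k : ι) :
    entry b T j k = b.repr (T (b k)) j := (b.repr_apply_apply _ _).symm

theorem entry_ext (b : HilbertBasis ι ℂ H) {S T : H →L[ℂ] H}
    (h : ∀ j k, entry b S j k = entry b T j k) : S = T := by
  refine ContinuousLinearMap.ext_on (s := range b)
    ((Submodule.dense_iff_topologicalClosure_eq_top).2 b.dense_span) ?_
  rintro _ ⟨k, rfl⟩
  refine b.repr.injective (lp.ext (funext fun j => ?_))
  simpa only [entry_eq_repr] using h j k

theorem entry_add (b : HilbertBasis ι ℂ H) (S T : H →L[ℂ] H) (j k : ι) :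
    entry b (S + T) j k = entry b S j k + entry b T j k := by
  simp [entry]

theorem entry_smul (b : HilbertBasis ι ℂ H) (c : ℂ) (T : H →L[ℂ] H) (j k : ι) :
    entry b (c • T) j k = c * entry b T j k := by
  simp [entry]

theorem entry_one [DecidableEq ι] (b : HilbertBasis ι ℂ H) (j k : ι) :
    entry b 1 j k = if j = k then 1 else 0 := by
  simpa [entry] using orthonormal_iff_ite.1 b.orthonormal j k

theorem entry_star [CompleteSpace H] (b : HilbertBasis ι ℂ H) (T : H →L[ℂ] H) (j k : ι) :
    entry b (star T) j k = conj (entry b T k j) := by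
  rw [entry, entry, ContinuousLinearMap.star_eq_adjoint, ContinuousLinearMap.adjoint_inner_right,
    inner_conj_symm]

theorem hasSum_entry_apply [CompleteSpace H] (b : HilbertBasis ι ℂ H) (T : H →L[ℂ] H) (ψ : H)
    (j : ι) : HasSum (fun k => entry b T j k * b.repr ψ k) (b.repr (T ψ) j) := by
  have h := b.hasSum_inner_mul_inner (star T (b j)) ψ
  simp only [ContinuousLinearMap.star_eq_adjoint, ContinuousLinearMap.adjoint_inner_left] at h
  simpa only [entry, b.repr_apply_apply] using h

theorem hasSum_entry_mul [CompleteSpace H] (b : HilbertBasis ι ℂ H) (S T : H →L[ℂ] H) (j k : ι) :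
    HasSum (fun l => entry b S j l * entry b T l k) (entry b (S * T) j k) := by
  have h := hasSum_entry_apply b S (T (b k)) j
  simpa only [entry_eq_repr] using! h

theorem norm_entry_le (b : HilbertBasis ι ℂ H) (T : H →L[ℂ] H) (j k : ι) :
    ‖entry b T j k‖ ≤ ‖T‖ := by
  refine (norm_inner_le_norm _ _).trans ?_
  rw [b.orthonormal.1, one_mul]
  exact (T.le_opNorm _).trans (by rw [b.orthonormal.1, mul_one])

theorem exists_weightedShift [AddCommGroup ι] (l : ι) (m : ι → ℂ) {C : ℝ} (hC : 0 ≤ C)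
    (hm : ∀ j, ‖m j‖ ≤ C) :
    ∃ W : lp (fun _ : ι => ℂ) 2 →L[ℂ] lp (fun _ : ι => ℂ) 2,
      ‖W‖ ≤ C ∧ ∀ ψ j, W ψ j = m j * ψ (j - l) := by
  have hs : ∀ ψ : lp (fun _ : ι => ℂ) 2, HasSum (fun j => ‖ψ (j - l)‖ ^ (2 : ℝ)) (‖ψ‖ ^ (2 : ℝ)) := by
    intro ψ
    have h := lp.hasSum_norm (p := 2) (by norm_num) ψ
    simp only [ENNReal.toReal_ofNat] at h
    exact (Equiv.subRight l).hasSum_iff.2 h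
  have hle : ∀ (ψ : lp (fun _ : ι => ℂ) 2) j,
      ‖m j * ψ (j - l)‖ ^ (2 : ℝ) ≤ C ^ (2 : ℝ) * ‖ψ (j - l)‖ ^ (2 : ℝ) := by
    intro ψ j
    rw [norm_mul, Real.mul_rpow (norm_nonneg _) (norm_nonneg _)]
    gcongr
    exact hm j
  have hmem : ∀ ψ : lp (fun _ : ι => ℂ) 2, Memℓp (fun j => m j * ψ (j - l)) 2 := by
    intro ψ
    refine memℓp_gen ?_
    simp only [ENNReal.toReal_ofNat]
    exact Summable.of_nonneg_of_le (fun j => by positivity) (hle ψ) ((hs ψ).summable.mul_left _)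
  let W₀ : lp (fun _ : ι => ℂ) 2 →ₗ[ℂ] lp (fun _ : ι => ℂ) 2 :=
    { toFun := fun ψ => ⟨fun j => m j * ψ (j - l), hmem ψ⟩
      map_add' := fun ψ φ => by
        ext j
        simp only [lp.coeFn_add, Pi.add_apply, mul_add]
      map_smul' := fun c ψ => by
        ext j
        simp [mul_left_comm] }
  refine ⟨W₀.mkContinuous C fun ψ => ?_, LinearMap.mkContinuous_norm_le _ hC _, fun ψ j => rfl⟩
  refine lp.norm_le_of_tsum_le (by norm_num) (by positivity) ?_
  simp only [ENNReal.toReal_ofNat]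
  rw [Real.mul_rpow hC (norm_nonneg _), ← ((hs ψ).mul_left _).tsum_eq]
  exact Summable.tsum_le_tsum (hle ψ)
    (Summable.of_nonneg_of_le (fun j => by positivity) (hle ψ) ((hs ψ).summable.mul_left _))
    ((hs ψ).summable.mul_left _)

/-- Schur's test for matrices dominated by a convolution matrix. -/
theorem exists_operator_of_matrix [AddCommGroup ι] [DecidableEq ι] [CompleteSpace H]
    (b : HilbertBasis ι ℂ H)
    (M : ι → ι → ℂ) {g : ι → ℝ} (hg : Summable g) (hM : ∀ j k, ‖M j k‖ ≤ g (j - k)) :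
    ∃ T : H →L[ℂ] H, ∀ j k, entry b T j k = M j k := by
  have hg0 : ∀ l, 0 ≤ g l := fun l => by
    have := hM l 0
    rw [sub_zero] at this
    exact (norm_nonneg _).trans this
  -- Each diagonal j - k = l of the matrix is a weighted shift of norm at most g(l); the sum of the
  -- diagonals converges in operator norm.
  choose W hW hWapp using fun l => exists_weightedShift l (fun j => M j (j - l)) (hg0 l)
    (fun j => by simpa using hM j (j - l))
  let c : (lp (fun _ : ι => ℂ) 2 →L[ℂ] lp (fun _ : ι => ℂ) 2) → (H →L[ℂ] H) := fun S =>
    (b.repr.symm.toContinuousLinearEquiv : lp (fun _ : ι => ℂ) 2 →L[ℂ] H) ∘L S ∘L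
      (b.repr.toContinuousLinearEquiv : H →L[ℂ] lp (fun _ : ι => ℂ) 2)
  have hsum : Summable W := hg.of_norm_bounded hW
  refine ⟨c (∑' l, W l), fun j k => ?_⟩
  rw [entry_eq_repr]
  have h1 : b.repr (c (∑' l, W l) (b k)) = (∑' l, W l) (lp.single 2 k 1) := by
    simp [c, b.repr_self]
  rw [h1]
  have h2 : HasSum (fun l => (W l (lp.single 2 k (1 : ℂ)) : ι → ℂ) j)
      (((∑' l, W l) (lp.single 2 k (1 : ℂ)) : lp (fun _ : ι => ℂ) 2) j) := by
    have := hsum.hasSum.mapL ((ContinuousLinearMap.apply ℂ _ (lp.single 2 k (1 : ℂ))))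
    exact this.mapL (lp.evalCLM ℂ (fun _ : ι => ℂ) 2 j)
  refine h2.unique ?_
  have h3 := hasSum_single (f := fun l => (W l (lp.single 2 k (1 : ℂ)) : ι → ℂ) j) (j - k)
    fun l hl => by
      have hne : j - l ≠ k := fun h => hl (by rw [← h]; abel)
      simp [hWapp, lp.single_apply, hne]
  simpa [hWapp, lp.single_apply] using h3

end MatrixEntries

section LatticePt

variable {d : ℕ}

theorem latticePt_zero : latticePt (0 : Fin d → ℤ) = 0 := by
  ext i; simp [latticePt]

theorem latticePt_add (k l : Fin d → ℤ) : latticePt (k + l) = latticePt k + latticePt l := by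
  ext i; simp [latticePt]

theorem latticePt_neg (k : Fin d → ℤ) : latticePt (-k) = -latticePt k := by
  ext i; simp [latticePt]

theorem latticePt_sub (k l : Fin d → ℤ) : latticePt (k - l) = latticePt k - latticePt l := by
  rw [sub_eq_add_neg, latticePt_add, latticePt_neg, sub_eq_add_neg]

theorem one_le_norm_latticePt {k : Fin d → ℤ} (hk : k ≠ 0) : 1 ≤ ‖latticePt k‖ := by
  obtain ⟨i, hi⟩ := Function.ne_iff.1 hk
  have h1 : (1 : ℝ) ≤ |(k i : ℝ)| := by exact_mod_cast Int.one_le_abs hi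
  exact h1.trans (PiLp.norm_apply_le (latticePt k) i)

end LatticePt

/-! ### Covariant families of operators and their symbols -/

section CovAlg

variable {d : ℕ} {H : Type*} [NormedAddCommGroup H] [InnerProductSpace ℂ H] [CompleteSpace H]
  (b : HilbertBasis (Fin d → ℤ) ℂ H) (ħ : ℝ)

/-- The families of bounded operators `A ξ`, `ξ ∈ ℝ^d`, such that `A (ξ + ħ m)` is the conjugate of
`A ξ` by the shift by `m`. They are quantizations of the translates by `ξ` of a symbol. -/
def covAlg : StarSubalgebra ℂ (Eucl d → (H →L[ℂ] H)) where
  carrier := {A | ∀ ξ m j k, entry b (A ξ) (j + m) (k + m) =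
    entry b (A (ξ + ħ • latticePt m)) j k}
  mul_mem' := by
    intro A B hA hB ξ m j k
    rw [mem_ofPred_eq] at hA hB
    have h1 := hasSum_entry_mul b (A ξ) (B ξ) (j + m) (k + m)
    rw [← (Equiv.addRight m).hasSum_iff] at h1
    have h2 := hasSum_entry_mul b (A (ξ + ħ • latticePt m)) (B (ξ + ħ • latticePt m)) j k
    simp only [Function.comp_def, Equiv.coe_addRight, hA, hB] at h1
    exact h1.unique h2
  one_mem' := by
    intro ξ m j k
    simp only [Pi.one_apply, entry_one, add_left_inj]
  add_mem' := by
    intro A B hA hB ξ m j k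
    rw [mem_ofPred_eq] at hA hB
    simp only [Pi.add_apply, entry_add, hA, hB]
  zero_mem' := by
    intro ξ m j k
    simp [entry]
  algebraMap_mem' := by
    intro c ξ m j k
    simp only [Pi.algebraMap_apply, Algebra.algebraMap_eq_smul_one, entry_smul, entry_one,
      add_left_inj]
  star_mem' := by
    intro A hA ξ m j k
    rw [mem_ofPred_eq] at hA
    simp only [Pi.star_apply, entry_star, hA]

variable {b ħ}

/-- The symbol of a covariant family. -/
def symb (A : covAlg b ħ) (k : Fin d → ℤ) (ξ : Eucl d) : ℂ := entry b (A.1 ξ) k 0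

theorem entry_eq_symb (A : covAlg b ħ) (ξ : Eucl d) (j k : Fin d → ℤ) :
    entry b (A.1 ξ) j k = symb A (j - k) (ξ + ħ • latticePt k) := by
  have := A.2 ξ k (j - k) 0
  rwa [sub_add_cancel, zero_add] at this

theorem symb_ext {A B : covAlg b ħ} (h : ∀ k ξ, symb A k ξ = symb B k ξ) : A = B := by
  refine Subtype.ext (funext fun ξ => entry_ext b fun j k => ?_)
  rw [entry_eq_symb, entry_eq_symb, h]

theorem symb_add (A B : covAlg b ħ) (k : Fin d → ℤ) (ξ : Eucl d) :
    symb (A + B) k ξ = symb A k ξ + symb B k ξ := entry_add b _ _ _ _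

theorem symb_smul (c : ℂ) (A : covAlg b ħ) (k : Fin d → ℤ) (ξ : Eucl d) :
    symb (c • A) k ξ = c * symb A k ξ := entry_smul b _ _ _ _

theorem symb_zero (k : Fin d → ℤ) (ξ : Eucl d) : symb (0 : covAlg b ħ) k ξ = 0 := by
  simp [symb, entry]

theorem symb_neg (A : covAlg b ħ) (k : Fin d → ℤ) (ξ : Eucl d) :
    symb (-A) k ξ = -symb A k ξ := by
  have := symb_smul (-1) A k ξ
  simpa using this

theorem symb_sub (A B : covAlg b ħ) (k : Fin d → ℤ) (ξ : Eucl d) :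
    symb (A - B) k ξ = symb A k ξ - symb B k ξ := by
  rw [sub_eq_add_neg, symb_add, symb_neg, sub_eq_add_neg]

theorem symb_sum {κ : Type*} (s : Finset κ) (A : κ → covAlg b ħ) (k : Fin d → ℤ) (ξ : Eucl d) :
    symb (∑ i ∈ s, A i) k ξ = ∑ i ∈ s, symb (A i) k ξ := by
  classical
  induction s using Finset.induction_on with
  | empty => simp [symb_zero]
  | insert i s hi ih => rw [Finset.sum_insert hi, Finset.sum_insert hi, symb_add, ih]

theorem symb_one (k : Fin d → ℤ) (ξ : Eucl d) :
    symb (1 : covAlg b ħ) k ξ = if k = 0 then 1 else 0 := entry_one b k 0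

theorem symb_star (A : covAlg b ħ) (k : Fin d → ℤ) (ξ : Eucl d) :
    symb (star A) k ξ = conj (symb A (-k) (ξ + ħ • latticePt k)) := by
  have h : symb (star A) k ξ = conj (entry b (A.1 ξ) 0 k) := entry_star b _ _ _
  rw [h, entry_eq_symb, zero_sub]

/-- Composition of left symbols. The shift of ξ by ħl is the reason for requiring translation
invariance of the norm. -/
theorem hasSum_symb_mul (A B : covAlg b ħ) (k : Fin d → ℤ) (ξ : Eucl d) :
    HasSum (fun l => symb A (k - l) (ξ + ħ • latticePt l) * symb B l ξ) (symb (A * B) k ξ) := by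
  have h := hasSum_entry_mul b (A.1 ξ) (B.1 ξ) k 0
  simp only [entry_eq_symb A ξ k] at h
  exact h

/-- Schur's test is applied for each ξ; covariance is automatic, since shifting both matrix indices
by m amounts to adding ħm to ξ. -/
theorem exists_symb_eq (a : (Fin d → ℤ) → Eucl d → ℂ)
    (ha : ∀ ξ, ∃ g : (Fin d → ℤ) → ℝ, Summable g ∧
      ∀ j k, ‖a (j - k) (ξ + ħ • latticePt k)‖ ≤ g (j - k)) :
    ∃ A : covAlg b ħ, ∀ k ξ, symb A k ξ = a k ξ := by
  choose g hg hga using ha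
  choose T hT using fun ξ => exists_operator_of_matrix b
    (fun j k => a (j - k) (ξ + ħ • latticePt k)) (hg ξ) (hga ξ)
  refine ⟨⟨T, fun ξ m j k => ?_⟩, fun k ξ => ?_⟩
  · rw [hT, hT, add_sub_add_right_eq_sub, latticePt_add, smul_add, add_assoc,
      add_comm (ħ • latticePt m)]
  · simp only [symb, hT, sub_zero, latticePt_zero, smul_zero, add_zero]

theorem exists_diagPart (A : covAlg b ħ) :
    ∃ B : covAlg b ħ, ∀ k ξ, symb B k ξ = if k = 0 then symb A 0 ξ else 0 := by
  refine exists_symb_eq _ fun ξ => ⟨fun k => if k = 0 then ‖A.1 ξ‖ else 0, ?_, fun j k => ?_⟩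
  · exact (hasSum_ite_eq 0 ‖A.1 ξ‖).summable
  · split_ifs with h
    · rw [sub_eq_zero] at h
      subst h
      have := entry_eq_symb A ξ j j
      rw [sub_self] at this
      rw [← this]
      simpa using norm_entry_le b (A.1 ξ) j j
    · simp [h]

/-- The diagonal part of a covariant family. -/
def diagPart (A : covAlg b ħ) : covAlg b ħ := (exists_diagPart A).choose

theorem symb_diagPart (A : covAlg b ħ) (k : Fin d → ℤ) (ξ : Eucl d) :
    symb (diagPart A) k ξ = if k = 0 then symb A 0 ξ else 0 := (exists_diagPart A).choose_spec k ξ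

/-- `IsDerivation ω A B`: `B` is the commutator of the multiplier by `ω · k` with `A`. -/
def IsDerivation (ω : Eucl d) (A B : covAlg b ħ) : Prop :=
  ∀ k ξ, symb B k ξ = (inner ℝ ω (latticePt k) : ℝ) * symb A k ξ

/-- The weighted norm `∑_k p(a_k) e^{r|k|}` of a covariant family of symbol `(a_k)`. -/
def symbNorm (p : (Eucl d → ℂ) → ℝ≥0∞) (r : ℝ) (a : (Fin d → ℤ) → Eucl d → ℂ) : ℝ≥0∞ :=
  ∑' k, p (a k) * ENNReal.ofReal (Real.exp (r * ‖latticePt k‖))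

/-- The norm of a covariant family is at most `x`. -/
def SymbBound (p : (Eucl d → ℂ) → ℝ≥0∞) (r : ℝ) (A : covAlg b ħ) (x : ℝ) : Prop :=
  0 ≤ x ∧ symbNorm p r (symb A) ≤ ENNReal.ofReal x

section Norm

variable {p : (Eucl d → ℂ) → ℝ≥0∞} (hp : IsWienerNorm p)
include hp

theorem IsWienerNorm.zero : p (fun _ => 0) = 0 := by
  simpa using hp.const_mul_le 0 fun _ => 0

theorem IsWienerNorm.add_le (f g : Eucl d → ℂ) : p (fun ξ => f ξ + g ξ) ≤ p f + p g := by
  have h := hp.le_tsum (fun i : Bool => if i then g else f) (fun ξ => f ξ + g ξ) fun ξ => by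
    have := hasSum_fintype fun i : Bool => (if i then g else f) ξ
    simpa [add_comm] using this
  simpa [add_comm] using h

theorem symbNorm_add_le (r : ℝ) (A B : covAlg b ħ) :
    symbNorm p r (symb (A + B)) ≤ symbNorm p r (symb A) + symbNorm p r (symb B) := by
  rw [symbNorm, symbNorm, symbNorm, ← ENNReal.tsum_add]
  refine ENNReal.tsum_le_tsum fun k => ?_
  rw [← add_mul]
  gcongr
  refine le_trans (le_of_eq ?_) (hp.add_le _ _)
  congr 1
  ext ξ
  exact symb_add A B k ξ

theorem symbNorm_smul_le (r : ℝ) (c : ℂ) (A : covAlg b ħ) :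
    symbNorm p r (symb (c • A)) ≤ ‖c‖ₑ * symbNorm p r (symb A) := by
  rw [symbNorm, symbNorm, ← ENNReal.tsum_mul_left]
  refine ENNReal.tsum_le_tsum fun k => ?_
  rw [← mul_assoc]
  gcongr
  refine le_trans (le_of_eq ?_) (hp.const_mul_le _ _)
  congr 1
  ext ξ
  exact symb_smul c A k ξ

theorem symbNorm_star_le (r : ℝ) (A : covAlg b ħ) :
    symbNorm p r (symb (star A)) ≤ symbNorm p r (symb A) := by
  rw [symbNorm, symbNorm, ← (Equiv.neg (Fin d → ℤ)).tsum_eq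
    (fun k => p (symb A k) * ENNReal.ofReal (Real.exp (r * ‖latticePt k‖)))]
  refine ENNReal.tsum_le_tsum fun k => ?_
  rw [Equiv.neg_apply, latticePt_neg, norm_neg]
  gcongr
  refine le_trans (le_of_eq ?_) ((hp.conj_le _).trans (hp.translate_le _ (ħ • latticePt k)))
  congr 1
  ext ξ
  exact symb_star A k ξ

/-- Young's inequality for convolutions in k: translation invariance of p removes ħ from the
composition formula, and the weight is submultiplicative because |k| ≤ |k - l| + |l|. -/
theorem symbNorm_mul_le {r : ℝ} (hr : 0 ≤ r) (A B : covAlg b ħ) :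
    symbNorm p r (symb (A * B)) ≤ symbNorm p r (symb A) * symbNorm p r (symb B) := by
  have h1 : ∀ k, p (symb (A * B) k) ≤ ∑' l, p (symb A (k - l)) * p (symb B l) := by
    intro k
    refine (hp.le_tsum (fun l ξ => symb A (k - l) (ξ + ħ • latticePt l) * symb B l ξ) _
      (hasSum_symb_mul A B k)).trans (ENNReal.tsum_le_tsum fun l => ?_)
    refine (hp.mul_le _ _).trans ?_
    gcongr
    exact hp.translate_le _ _
  set e : (Fin d → ℤ) → ℝ≥0∞ := fun k => ENNReal.ofReal (Real.exp (r * ‖latticePt k‖)) with he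
  have h2 : ∀ k l, e k ≤ e (k - l) * e l := by
    intro k l
    rw [he]
    simp only
    rw [← ENNReal.ofReal_mul (Real.exp_pos _).le, ← Real.exp_add, ← mul_add]
    gcongr
    rw [latticePt_sub]
    have := norm_add_le (latticePt k - latticePt l) (latticePt l)
    rwa [sub_add_cancel] at this
  calc symbNorm p r (symb (A * B))
      ≤ ∑' k, ∑' l, (p (symb A (k - l)) * e (k - l)) * (p (symb B l) * e l) := by
        refine ENNReal.tsum_le_tsum fun k => ?_
        calc p (symb (A * B) k) * e k
            ≤ (∑' l, p (symb A (k - l)) * p (symb B l)) * e k := by gcongr; exact h1 k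
          _ = ∑' l, p (symb A (k - l)) * p (symb B l) * e k := ENNReal.tsum_mul_right.symm
          _ ≤ _ := by
            refine ENNReal.tsum_le_tsum fun l => ?_
            calc p (symb A (k - l)) * p (symb B l) * e k
                ≤ p (symb A (k - l)) * p (symb B l) * (e (k - l) * e l) := by gcongr; exact h2 k l
              _ = _ := by ring
    _ = ∑' l, ∑' k, (p (symb A (k - l)) * e (k - l)) * (p (symb B l) * e l) := ENNReal.tsum_comm
    _ = ∑' l, symbNorm p r (symb A) * (p (symb B l) * e l) := by
        refine tsum_congr fun l => ?_
        rw [ENNReal.tsum_mul_right]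
        congr 1
        exact (Equiv.subRight l).tsum_eq fun k => p (symb A k) * e k
    _ = _ := ENNReal.tsum_mul_left

theorem exists_symb_eq_of_norm (a : (Fin d → ℤ) → Eucl d → ℂ) {r : ℝ} (hr : 0 ≤ r)
    (ha : symbNorm p r a ≠ ∞) : ∃ A : covAlg b ħ, ∀ k ξ, symb A k ξ = a k ξ := by
  have h1 : ∑' k, p (a k) ≠ ∞ := by
    refine ne_top_of_le_ne_top ha (ENNReal.tsum_le_tsum fun k => le_mul_of_one_le_right' ?_)
    rw [← ENNReal.ofReal_one]
    exact ENNReal.ofReal_le_ofReal (Real.one_le_exp (by positivity))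
  have h2 := ENNReal.ne_top_of_tsum_ne_top h1
  refine exists_symb_eq a fun ξ => ⟨fun k => (p (a k)).toReal, ENNReal.summable_toReal h1,
    fun j k => ?_⟩
  rw [← ENNReal.ofReal_le_iff_le_toReal (h2 _), ofReal_norm]
  exact hp.enorm_le _ _

theorem symb_eq_zero_of_norm {r : ℝ} {A : covAlg b ħ} (h : symbNorm p r (symb A) = 0) : A = 0 := by
  refine symb_ext fun k ξ => ?_
  rw [symb_zero]
  have h1 := ENNReal.tsum_eq_zero.1 h k
  rw [mul_eq_zero, ENNReal.ofReal_eq_zero] at h1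
  have h2 : p (symb A k) = 0 := h1.resolve_right (not_le.2 (Real.exp_pos _))
  simpa [h2] using hp.enorm_le (symb A k) ξ

end Norm

end CovAlg

/-! ### The covariant algebra as a KAM scale; the homological equation -/

section CovAlg

variable {d : ℕ} {H : Type*} [NormedAddCommGroup H] [InnerProductSpace ℂ H] [CompleteSpace H]
  {b : HilbertBasis (Fin d → ℤ) ℂ H} {ħ : ℝ}
  {p : (Eucl d → ℂ) → ℝ≥0∞} (hp : IsWienerNorm p)
include hp

/-- Multipliers in k act on each coefficient by a scalar. This covers the diagonal projection, the
derivation and the division by ω·k. -/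
theorem symbNorm_multiplier_le {m : (Fin d → ℤ) → ℂ} {r r' C : ℝ} (hC : 0 ≤ C)
    (hm : ∀ k, ‖m k‖ * Real.exp (r' * ‖latticePt k‖) ≤ C * Real.exp (r * ‖latticePt k‖))
    (a : (Fin d → ℤ) → Eucl d → ℂ) :
    symbNorm p r' (fun k ξ => m k * a k ξ) ≤ ENNReal.ofReal C * symbNorm p r a := by
  rw [symbNorm, symbNorm, ← ENNReal.tsum_mul_left]
  refine ENNReal.tsum_le_tsum fun k => ?_
  calc p (fun ξ => m k * a k ξ) * ENNReal.ofReal (Real.exp (r' * ‖latticePt k‖))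
      ≤ ‖m k‖ₑ * p (a k) * ENNReal.ofReal (Real.exp (r' * ‖latticePt k‖)) := by
        gcongr; exact hp.const_mul_le _ _
    _ = ENNReal.ofReal (‖m k‖ * Real.exp (r' * ‖latticePt k‖)) * p (a k) := by
        rw [ENNReal.ofReal_mul (norm_nonneg _), ofReal_norm]; ring
    _ ≤ ENNReal.ofReal (C * Real.exp (r * ‖latticePt k‖)) * p (a k) := by
        gcongr ?_ * _
        exact ENNReal.ofReal_le_ofReal (hm k)
    _ = _ := by rw [ENNReal.ofReal_mul hC]; ring

theorem symbNorm_le_tsum (r : ℝ) (v : ℕ → (Fin d → ℤ) → Eucl d → ℂ)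
    (c : (Fin d → ℤ) → Eucl d → ℂ) (h : ∀ k ξ, HasSum (fun n => v n k ξ) (c k ξ)) :
    symbNorm p r c ≤ ∑' n, symbNorm p r (v n) := by
  simp only [symbNorm]
  rw [ENNReal.tsum_comm]
  refine ENNReal.tsum_le_tsum fun k => ?_
  rw [ENNReal.tsum_mul_right]
  gcongr
  exact hp.le_tsum (fun n => v n k) (c k) (h k)

theorem SymbBound.norm_symb_le {r x : ℝ} {A : covAlg b ħ} (hr : 0 ≤ r) (h : SymbBound p r A x)
    (k : Fin d → ℤ) (ξ : Eucl d) : ‖symb A k ξ‖ ≤ x := by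
  rw [← ENNReal.ofReal_le_ofReal_iff h.1, ofReal_norm]
  refine (hp.enorm_le _ _).trans (le_trans ?_ h.2)
  refine le_trans (le_mul_of_one_le_right' ?_) (ENNReal.le_tsum k)
  rw [← ENNReal.ofReal_one]
  exact ENNReal.ofReal_le_ofReal (Real.one_le_exp (by positivity))

/-- The symbols are summed pointwise, an operator family is built from the sum, and the tails are
bounded by countable subadditivity of the norm. -/
theorem SymbBound.complete {r : ℝ} {u : ℕ → covAlg b ħ} {x : ℕ → ℝ} (hr : 0 ≤ r)
    (hu : ∀ n, SymbBound p r (u n) (x n)) (hx : Summable x) :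
    ∃ s, ∀ n, SymbBound p r (s - ∑ i ∈ Finset.range n, u i) (∑' i, x (i + n)) := by
  have hs : ∀ k ξ, Summable fun n => symb (u n) k ξ := fun k ξ =>
    hx.of_norm_bounded fun n => (hu n).norm_symb_le hp hr k ξ
  have hsum : ∀ n, ∑' i, symbNorm p r (symb (u (i + n))) ≤ ENNReal.ofReal (∑' i, x (i + n)) := by
    intro n
    rw [ENNReal.ofReal_tsum_of_nonneg (fun i => (hu _).1) ((summable_nat_add_iff n).2 hx)]
    exact ENNReal.tsum_le_tsum fun i => (hu _).2
  have hle := symbNorm_le_tsum hp r (fun n => symb (u n)) (fun k ξ => ∑' n, symb (u n) k ξ)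
    fun k ξ => (hs k ξ).hasSum
  obtain ⟨s, hsymb⟩ := exists_symb_eq_of_norm (b := b) (ħ := ħ) hp
    (fun k ξ => ∑' n, symb (u n) k ξ) hr
    (ne_top_of_le_ne_top ENNReal.ofReal_ne_top (hle.trans (by simpa using hsum 0)))
  refine ⟨s, fun n => ⟨tsum_nonneg fun i => (hu _).1, ?_⟩⟩
  refine (symbNorm_le_tsum hp r (fun i => symb (u (i + n))) _ fun k ξ => ?_).trans (hsum n)
  rw [symb_sub, symb_sum, hsymb]
  exact (hasSum_nat_add_iff' n).2 (hs k ξ).hasSum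

/-- The Leibniz rule holds since ω·k is additive in k and products convolve in k; the derivation
costs radius through |ω·k| ≤ (‖ω‖/r) e^{r|k|}. -/
theorem kamScale_covAlg (ω : Eucl d) :
    KAMScale (A := covAlg b ħ) (SymbBound p) diagPart (IsDerivation ω) where
  nonneg h := h.1
  zero := by
    intro r
    refine ⟨le_rfl, le_of_eq ?_⟩
    have : symb (0 : covAlg b ħ) = fun k ξ => 0 := by ext k ξ; exact symb_zero k ξ
    simp [this, symbNorm, hp.zero]
  mono h hxy := ⟨h.1.trans hxy, h.2.trans (ENNReal.ofReal_le_ofReal hxy)⟩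
  anti h hr := by
    refine ⟨h.1, le_trans (ENNReal.tsum_le_tsum fun k => ?_) h.2⟩
    gcongr
  add h h' := ⟨add_nonneg h.1 h'.1, by
    rw [ENNReal.ofReal_add h.1 h'.1]
    exact (symbNorm_add_le hp _ _ _).trans (add_le_add h.2 h'.2)⟩
  smul c h := ⟨mul_nonneg (norm_nonneg _) h.1, by
    rw [ENNReal.ofReal_mul (norm_nonneg _), ofReal_norm]
    refine (symbNorm_smul_le hp _ _ _).trans ?_
    gcongr
    exact h.2⟩
  mul hr h h' := ⟨mul_nonneg h.1 h'.1, by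
    rw [ENNReal.ofReal_mul h.1]
    exact (symbNorm_mul_le hp hr _ _).trans (mul_le_mul' h.2 h'.2)⟩
  bd_star h := ⟨h.1, (symbNorm_star_le hp _ _).trans h.2⟩
  eq_zero := by
    intro r A _ h
    refine symb_eq_zero_of_norm hp (r := r) (le_antisymm (ENNReal.le_of_forall_pos_le_add ?_) bot_le)
    intro ε hε _
    have := (h ε (by exact_mod_cast hε)).2
    simpa using this
  complete hr hu hx := SymbBound.complete hp hr hu hx
  D_add A B := symb_ext fun k ξ => by
    rw [symb_add, symb_diagPart, symb_diagPart, symb_diagPart, symb_add]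
    split_ifs <;> simp
  D_D A := symb_ext fun k ξ => by
    rw [symb_diagPart, symb_diagPart, symb_diagPart]
    simp
  D_star A := symb_ext fun k ξ => by
    rw [symb_diagPart, symb_star, symb_star, symb_diagPart]
    by_cases hk : k = 0
    · simp [hk]
    · simp [hk]
  D_bd := by
    intro r A x h r'
    refine ⟨h.1, le_trans ?_ h.2⟩
    have : symb (diagPart A) = fun k ξ => (if k = 0 then 1 else 0) * symb A k ξ := by
      ext k ξ
      rw [symb_diagPart]
      split_ifs with hk
      · rw [hk, one_mul]
      · rw [zero_mul]
    rw [this]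
    refine (symbNorm_multiplier_le hp (r := r) zero_le_one (fun k => ?_) _).trans (by simp)
    by_cases hk : k = 0
    · simp [hk, latticePt_zero]
    · simp only [hk, if_false, norm_zero, zero_mul, one_mul]
      positivity
  der_add h h' k ξ := by rw [symb_add, symb_add, h, h']; ring
  der_smul c h k ξ := by rw [symb_smul, symb_smul, h]; ring
  der_mul := by
    intro A B A' B' h h' k ξ
    have h1 := (hasSum_symb_mul B A' k ξ).add (hasSum_symb_mul A B' k ξ)
    rw [← symb_add] at h1
    have h2 := (hasSum_symb_mul A A' k ξ).mul_left ((inner ℝ ω (latticePt k) : ℝ) : ℂ)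
    refine h1.unique (Eq.mp (congrArg₂ HasSum (funext fun l => ?_) rfl) h2)
    rw [h, h', latticePt_sub, inner_sub_right]
    push_cast
    ring
  der_one k ξ := by
    rw [symb_zero, symb_one]
    split_ifs with hk
    · simp [hk, latticePt_zero]
    · simp
  der_unique h h' := symb_ext fun k ξ => by rw [h, h']
  der_bd := by
    intro r hr
    refine ⟨‖ω‖ / r, fun A x h => ?_⟩
    have hm := symbNorm_multiplier_le hp (m := fun k => ((inner ℝ ω (latticePt k) : ℝ) : ℂ))
      (r := r) (r' := 0) (C := ‖ω‖ / r) (by positivity) (fun k => by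
        rw [zero_mul, Real.exp_zero, mul_one, Complex.norm_real, Real.norm_eq_abs, div_mul_eq_mul_div,
          le_div_iff₀ hr]
        have h1 := abs_real_inner_le_norm ω (latticePt k)
        have h2 := Real.add_one_le_exp (r * ‖latticePt k‖)
        calc |inner ℝ ω (latticePt k)| * r ≤ ‖ω‖ * ‖latticePt k‖ * r := by gcongr
          _ = ‖ω‖ * (r * ‖latticePt k‖) := by ring
          _ ≤ _ := by gcongr; linarith) (symb A)
    have hle : symbNorm p 0 (fun k ξ => ((inner ℝ ω (latticePt k) : ℝ) : ℂ) * symb A k ξ) ≤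
        ENNReal.ofReal (‖ω‖ / r * x) := by
      refine hm.trans ?_
      rw [ENNReal.ofReal_mul (by positivity)]
      gcongr
      exact h.2
    obtain ⟨B, hB⟩ := exists_symb_eq_of_norm (b := b) (ħ := ħ) hp _ le_rfl
      (ne_top_of_le_ne_top ENNReal.ofReal_ne_top hle)
    refine ⟨B, hB, mul_nonneg (by positivity) h.1, ?_⟩
    have : symb B = fun k ξ => ((inner ℝ ω (latticePt k) : ℝ) : ℂ) * symb A k ξ := by
      ext k ξ; exact hB k ξ
    rwa [this]

/-- Divide the k-th coefficient by ω·k; at k = 0 the convention 0⁻¹ = 0 is harmless as B has no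
diagonal. With n = ⌈γ - 1⌉ the small divisors cost |k|ⁿ/ς, and tⁿ ≤ n! eᵗ at t = (r - r')|k| pays
with the loss of radius. -/
theorem exists_homological_solution {ς γ : ℝ} (hς : 0 < ς) {ω : Eucl d}
    (hω : IsDiophantine ς γ ω) {r r' : ℝ} (hr' : 0 < r') (hr : r' < r) {B : covAlg b ħ} {y : ℝ}
    (hD : diagPart B = 0) (hs : star B = B) (hB : SymbBound p r B y) :
    ∃ G : covAlg b ħ, IsDerivation ω G B ∧ star G = -G ∧
      SymbBound p r' G ((Nat.factorial ⌈γ - 1⌉₊ / ς) / (r - r') ^ ⌈γ - 1⌉₊ * y) := by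
  set n := ⌈γ - 1⌉₊
  have hrr : 0 < r - r' := by linarith
  have hne : ∀ k : Fin d → ℤ, k ≠ 0 → (inner ℝ ω (latticePt k) : ℝ) ≠ 0 ∧
      |(inner ℝ ω (latticePt k) : ℝ)|⁻¹ ≤ ‖latticePt k‖ ^ n / ς := by
    intro k hk
    have h1 := hω k hk
    rw [real_inner_comm] at h1
    have h2 := one_le_norm_latticePt hk
    have hpos : 0 < ‖latticePt k‖ := by linarith
    have h3 : ‖latticePt k‖ ^ (γ - 1) ≤ ‖latticePt k‖ ^ n := by
      rw [← Real.rpow_natCast]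
      exact Real.rpow_le_rpow_of_exponent_le h2 (Nat.le_ceil _)
    have h4 : 0 < ς / ‖latticePt k‖ ^ (γ - 1) := by positivity
    have h5 : 0 < |(inner ℝ ω (latticePt k) : ℝ)| := h4.trans_le h1
    refine ⟨abs_pos.1 h5, ?_⟩
    rw [inv_le_comm₀ h5 (by positivity), inv_div]
    exact le_trans (by gcongr) h1
  have hm : ∀ k : Fin d → ℤ, ‖((inner ℝ ω (latticePt k) : ℝ) : ℂ)⁻¹‖ *
      Real.exp (r' * ‖latticePt k‖) ≤
        (Nat.factorial n / ς) / (r - r') ^ n * Real.exp (r * ‖latticePt k‖) := by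
    intro k
    by_cases hk : k = 0
    · simp only [hk, latticePt_zero, inner_zero_right, Complex.ofReal_zero, inv_zero, norm_zero,
        zero_mul]
      positivity
    · obtain ⟨-, h2⟩ := hne k hk
      rw [norm_inv, Complex.norm_real, Real.norm_eq_abs]
      have h3 := Real.pow_div_factorial_le_exp ((r - r') * ‖latticePt k‖) (by positivity) n
      rw [div_le_iff₀ (by positivity), mul_pow] at h3
      have h4 : ‖latticePt k‖ ^ n / ς ≤ (Nat.factorial n / ς) / (r - r') ^ n *
          Real.exp ((r - r') * ‖latticePt k‖) := by
        rw [div_div, div_mul_eq_mul_div, div_le_div_iff₀ hς (by positivity)]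
        calc ‖latticePt k‖ ^ n * (ς * (r - r') ^ n)
            = ς * ((r - r') ^ n * ‖latticePt k‖ ^ n) := by ring
          _ ≤ ς * (Real.exp ((r - r') * ‖latticePt k‖) * Nat.factorial n) := by gcongr
          _ = _ := by ring
      calc |(inner ℝ ω (latticePt k) : ℝ)|⁻¹ * Real.exp (r' * ‖latticePt k‖)
          ≤ (Nat.factorial n / ς) / (r - r') ^ n * Real.exp ((r - r') * ‖latticePt k‖) *
              Real.exp (r' * ‖latticePt k‖) := by gcongr; exact h2.trans h4
        _ = _ := by rw [mul_assoc, ← Real.exp_add]; ring_nf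
  have hle := symbNorm_multiplier_le hp (by positivity) hm (symb B)
  have hle' : symbNorm p r' (fun k ξ => ((inner ℝ ω (latticePt k) : ℝ) : ℂ)⁻¹ * symb B k ξ) ≤
      ENNReal.ofReal ((Nat.factorial n / ς) / (r - r') ^ n * y) := by
    refine hle.trans ?_
    rw [ENNReal.ofReal_mul (by positivity)]
    gcongr
    exact hB.2
  obtain ⟨G, hG⟩ := exists_symb_eq_of_norm (b := b) (ħ := ħ) hp _ hr'.le
    (ne_top_of_le_ne_top ENNReal.ofReal_ne_top hle')
  refine ⟨G, fun k ξ => ?_, symb_ext fun k ξ => ?_, mul_nonneg (by positivity) hB.1, ?_⟩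
  · rw [hG]
    by_cases hk : k = 0
    · have := symb_diagPart B 0 ξ
      rw [hD, symb_zero, if_pos rfl] at this
      rw [hk, ← this]
      simp
    · have h1 : ((inner ℝ ω (latticePt k) : ℝ) : ℂ) ≠ 0 := by exact_mod_cast (hne k hk).1
      rw [← mul_assoc, mul_inv_cancel₀ h1, one_mul]
  · have h1 := symb_star B k ξ
    rw [hs] at h1
    rw [symb_star, symb_neg, hG, hG, map_mul, ← h1, latticePt_neg, inner_neg_right]
    push_cast
    rw [inv_neg, map_neg, map_inv₀, Complex.conj_ofReal, neg_mul]
  · have : symb G = fun k ξ => ((inner ℝ ω (latticePt k) : ℝ) : ℂ)⁻¹ * symb B k ξ := by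
      ext k ξ; exact hG k ξ
    rwa [this]

end CovAlg

/-! ### Conjugation of unbounded diagonal operators -/

section UnboundedConjugation

variable {ι H : Type*} [NormedAddCommGroup H] [InnerProductSpace ℂ H]
  (b : HilbertBasis ι ℂ H)

theorem repr_matrixOp (M : ι → ι → ℂ) (ψ : (matrixOp b M).domain) (j : ι) :
    b.repr (matrixOp b M ψ) j = rowSum b M (ψ : H) j := by
  change b.repr (b.repr.symm _) j = _
  rw [LinearIsometryEquiv.apply_symm_apply]

section Bounded

variable [CompleteSpace H]

theorem rowSum_entry (T : H →L[ℂ] H) (ψ : H) : rowSum b (entry b T) ψ = b.repr (T ψ) :=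
  funext fun j => (hasSum_entry_apply b T ψ j).tsum_eq

theorem mem_matrixOp_entry (T : H →L[ℂ] H) (ψ : H) : ψ ∈ (matrixOp b (entry b T)).domain := by
  refine ⟨fun j => (hasSum_entry_apply b T ψ j).summable, ?_⟩
  rw [rowSum_entry]
  exact lp.memℓp _

theorem matrixOp_entry_apply (T : H →L[ℂ] H) (ψ : (matrixOp b (entry b T)).domain) :
    matrixOp b (entry b T) ψ = T ψ := by
  refine b.repr.injective (lp.ext (funext fun j => ?_))
  rw [repr_matrixOp, rowSum_entry]

end Bounded

section Diagonal

variable [DecidableEq ι] (μ : ι → ℂ)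

theorem hasSum_diagonal (ψ : H) (j : ι) :
    HasSum (fun k => (if j = k then μ k else 0) * b.repr ψ k) (μ j * b.repr ψ j) := by
  have h := hasSum_single (f := fun k => (if j = k then μ k else 0) * b.repr ψ k) j
    fun k hk => by rw [if_neg (Ne.symm hk), zero_mul]
  simpa using h

theorem rowSum_diagonal (ψ : H) :
    rowSum b (fun j k => if j = k then μ k else 0) ψ = fun j => μ j * b.repr ψ j :=
  funext fun j => (hasSum_diagonal b μ ψ j).tsum_eq

theorem mem_matrixOp_diagonal {ψ χ : H} (h : ∀ k, b.repr χ k = μ k * b.repr ψ k) :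
    ψ ∈ (matrixOp b fun j k => if j = k then μ k else 0).domain := by
  refine ⟨fun j => (hasSum_diagonal b μ ψ j).summable, ?_⟩
  rw [rowSum_diagonal, ← funext h]
  exact lp.memℓp _

theorem repr_matrixOp_diagonal (ψ : (matrixOp b fun j k => if j = k then μ k else 0).domain)
    (j : ι) : b.repr (matrixOp b (fun j k => if j = k then μ k else 0) ψ) j =
      μ j * b.repr (ψ : H) j := by
  rw [repr_matrixOp, rowSum_diagonal]

theorem matrixOp_diagonal_eq {ψ χ : H} (h : ∀ k, b.repr χ k = μ k * b.repr ψ k)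
    (hψ : ψ ∈ (matrixOp b fun j k => if j = k then μ k else 0).domain) :
    matrixOp b (fun j k => if j = k then μ k else 0) ⟨ψ, hψ⟩ = χ := by
  refine b.repr.injective (lp.ext (funext fun j => ?_))
  rw [repr_matrixOp_diagonal, h]

end Diagonal

variable [CompleteSpace H]

/-- If the commutator of the diagonal operator with A is the bounded operator B on entries, then A
preserves the diagonal operator's domain: for φ in it, with image χ, the image of Aφ must be Aχ +
Bφ. -/
theorem repr_intertwine {μ : ι → ℂ} {A B : H →L[ℂ] H}
    (hAB : ∀ j k, (μ j - μ k) * entry b A j k = entry b B j k) {φ χ : H}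
    (h : ∀ k, b.repr χ k = μ k * b.repr φ k) (j : ι) :
    b.repr (A χ + B φ) j = μ j * b.repr (A φ) j := by
  have h1 := (hasSum_entry_apply b A χ j).add (hasSum_entry_apply b B φ j)
  have h2 := (hasSum_entry_apply b A φ j).mul_left (μ j)
  rw [map_add, lp.coeFn_add, Pi.add_apply]
  refine h1.unique (Eq.mp (congrArg₂ HasSum (funext fun k => ?_) rfl) h2)
  rw [h, ← hAB]
  ring

/-- A unitary operator `U` with `[D, U] = c U W`, for a diagonal operator `D` with real entries and
a bounded operator `W`, conjugates `D + c W` to `D`. -/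
theorem unitaryConj_diagonal [DecidableEq ι] {μ : ι → ℝ} {c : ℂ} {W : H →L[ℂ] H}
    (u : unitary (H →L[ℂ] H))
    (hu : ∀ j k, ((μ j : ℂ) - μ k) * entry b u j k = c * entry b (u * W) j k) :
    unitaryConj (Unitary.linearIsometryEquiv u)
        ((matrixOp b fun j k => if j = k then (μ k : ℂ) else 0) + c • matrixOp b (entry b W)) =
      matrixOp b fun j k => if j = k then (μ k : ℂ) else 0 := by
  set U := Unitary.linearIsometryEquiv u
  have hU : ∀ ψ, U ψ = (u : H →L[ℂ] H) ψ := fun ψ => rfl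
  have h1 : ∀ j k, ((μ j : ℂ) - μ k) * entry b u j k = entry b (c • (u * W : H →L[ℂ] H)) j k := by
    intro j k
    rw [hu, entry_smul]
  -- Adjoint of the commutation relation, using that μ is real. It shows that U* also preserves the
  -- domain, whence equality of domains and not just an inclusion.
  have h2 : ∀ j k, ((μ j : ℂ) - μ k) * entry b (star u) j k =
      entry b (-star (c • (u * W : H →L[ℂ] H))) j k := by
    intro j k
    rw [← neg_one_smul ℂ, entry_smul, entry_star, entry_star, ← h1, map_mul, map_sub,
      Complex.conj_ofReal, Complex.conj_ofReal]
    ring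
  have hdom : ∀ ψ : H, ψ ∈ (matrixOp b fun j k => if j = k then (μ k : ℂ) else 0).domain →
      U.symm ψ ∈ (matrixOp b fun j k => if j = k then (μ k : ℂ) else 0).domain := by
    intro ψ hψ
    exact mem_matrixOp_diagonal b _ fun k => repr_intertwine b h2
      (repr_matrixOp_diagonal b _ ⟨ψ, hψ⟩) k
  have himg : ∀ (φ : H) (hφ : φ ∈ (matrixOp b fun j k => if j = k then (μ k : ℂ) else 0).domain)
      (k : ι), b.repr (U (matrixOp b (fun j k => if j = k then (μ k : ℂ) else 0) ⟨φ, hφ⟩ + c • W φ)) k =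
        μ k * b.repr (U φ) k := by
    intro φ hφ k
    have := repr_intertwine b h1 (repr_matrixOp_diagonal b _ ⟨φ, hφ⟩) k
    rw [hU, hU, ← this, map_add, map_smul]
    rfl
  refine LinearPMap.ext ?_ ?_
  · ext ψ
    constructor
    · rintro ⟨hψ, -⟩
      have := mem_matrixOp_diagonal b _ (himg _ hψ)
      rwa [← LinearIsometryEquiv.apply_symm_apply U ψ]
    · intro hψ
      exact ⟨hdom ψ hψ, mem_matrixOp_entry b W _⟩
  · intro ψ hψ hψ'
    have hφ : U.symm ψ ∈ (matrixOp b fun j k => if j = k then (μ k : ℂ) else 0).domain := hψ.1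
    have h3 : ∀ k, b.repr (U (matrixOp b (fun j k => if j = k then (μ k : ℂ) else 0)
        ⟨U.symm ψ, hφ⟩ + c • W (U.symm ψ))) k = μ k * b.repr ψ k := by
      intro k
      rw [himg _ hφ, LinearIsometryEquiv.apply_symm_apply]
    rw [matrixOp_diagonal_eq b _ h3]
    change U _ = U _
    congr 1
    rw [LinearPMap.add_apply, LinearPMap.smul_apply, matrixOp_entry_apply]

end UnboundedConjugation

/-! ### Estimates in the original norms and Fourier coefficients of symbols -/

theorem BddCont.add {E : Type*} [TopologicalSpace E] {f g : E → ℂ} (hf : BddCont f)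
    (hg : BddCont g) : BddCont fun ξ => f ξ + g ξ := by
  obtain ⟨cf, B, hB⟩ := hf
  obtain ⟨cg, C, hC⟩ := hg
  exact ⟨cf.add cg, B + C, fun ξ => (norm_add_le _ _).trans (add_le_add (hB ξ) (hC ξ))⟩

theorem BddCont.const_mul {E : Type*} [TopologicalSpace E] {f : E → ℂ} (c : ℂ) (hf : BddCont f) :
    BddCont fun ξ => c * f ξ :=
  BddCont.mul (f := fun _ => c) ⟨continuous_const, ‖c‖, fun _ => le_rfl⟩ hf

section Norms

variable {d : ℕ} (N : WienerData d)

theorem normSW_add_le {f g : Eucl d → ℂ} (hf : BddCont f) (hg : BddCont g) :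
    normSW N (fun ξ => f ξ + g ξ) ≤ normSW N f + normSW N g := by
  obtain ⟨c, -, -, h⟩ := exists_normSW_eq N
  rw [h, h, h, ← mul_add, ← lintegral_add_left (measurable_windowSup _ _ hf)]
  gcongr with η
  obtain ⟨B, hB⟩ := hf.2
  obtain ⟨C, hC⟩ := hg.2
  have := windowSup_le_tsum N.cutoff
    (fun j : Submodule.span ℤ (range N.latticeBasis) => (j : Eucl d))
    (f := fun i : Bool => if i then g else f) (g := fun ξ => f ξ + g ξ)
    (B := fun i : Bool => if i then C else B)
    (by rintro (_ | _) <;> simpa) (by rintro (_ | _) <;> simpa)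
    (hasSum_fintype _).summable (fun ξ => by
      have := hasSum_fintype fun i : Bool => (if i then g else f) ξ
      simpa [add_comm] using this) η
  simpa [add_comm] using this

theorem normSW_const_mul_le (c : ℂ) (f : Eucl d → ℂ) :
    normSW N (fun ξ => c * f ξ) ≤ ‖c‖ₑ * normSW N f := by
  obtain ⟨C, -, -, h⟩ := exists_normSW_eq N
  rw [h, h]
  simp only [windowSup_const_mul]
  rw [lintegral_const_mul' _ _ enorm_ne_top, mul_left_comm]

theorem memSW_zero : MemSW N (fun _ => 0) ∧ normSW N (fun _ => 0) = 0 := by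
  have h : normSW N (fun _ => 0) = 0 := by simpa using normSW_const_mul_le N 0 fun _ => 0
  exact ⟨⟨continuous_const, ⟨0, by simp⟩, by simp [h]⟩, h⟩

theorem MemSW.bddCont {N : WienerData d} {f : Eucl d → ℂ} (h : MemSW N f) : BddCont f := ⟨h.1, h.2.1⟩

theorem normConst_mul_normSW_le_normAW (ρ : ℝ) (g : Torus d → Eucl d → ℂ) :
    ENNReal.ofReal (normConst d) * normSW N (symbolCoeff g 0) ≤ normAW N ρ g := by
  rw [normAW]
  gcongr
  refine le_trans (le_of_eq ?_) (ENNReal.le_tsum 0)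
  simp [latticePt_zero]

end Norms

section Coefficients

variable {d : ℕ}

/-- Smoothness of V is assumed for its periodic lift; the quotient map transfers continuity in x to
the torus. -/
theorem isOpenQuotientMap_toTorus : IsOpenQuotientMap (toTorus (d := d)) := by
  have h : IsOpenQuotientMap (Pi.map fun (_ : Fin d) (x : ℝ) => (x : AddCircle (2 * Real.pi))) :=
    IsOpenQuotientMap.piMap fun _ => QuotientAddGroup.isOpenQuotientMap_mk
  exact h.comp (PiLp.homeomorph 2 fun _ : Fin d => ℝ).isOpenQuotientMap

theorem continuous_of_continuous_toTorus {V : Torus d → Eucl d → ℝ}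
    (hV : Continuous fun p : Eucl d × Eucl d => V (toTorus p.1) p.2) (ξ : Eucl d) :
    Continuous fun x => V x ξ := by
  rw [isOpenQuotientMap_toTorus.isQuotientMap.continuous_iff]
  exact hV.comp (continuous_id.prodMk continuous_const)

theorem integrable_of_continuous_torus {f : Torus d → ℂ} (hf : Continuous f) : Integrable f :=
  hf.integrable_of_hasCompactSupport (HasCompactSupport.of_compactSpace _)

theorem conj_symbolCoeff (V : Torus d → Eucl d → ℝ) (k : Fin d → ℤ) (ξ : Eucl d) :
    conj (symbolCoeff (fun x ξ => (V x ξ : ℂ)) (-k) ξ) = symbolCoeff (fun x ξ => (V x ξ : ℂ)) k ξ := by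
  rw [symbolCoeff, symbolCoeff, ← integral_conj]
  congr 1
  ext x
  simp only [eFun, ContinuousMap.smul_apply, smul_eq_mul, map_mul, Complex.conj_ofReal,
    Complex.conj_conj, character_neg]

theorem normConst_mul_integral_conj_eFun (k : Fin d → ℤ) :
    (normConst d : ℂ) * ∫ x : Torus d, conj (eFun k x) = if k = 0 then 1 else 0 := by
  have h : ∀ x : Torus d, conj (eFun k x) = (normConst d : ℂ) * character (-k) x := by
    intro x
    simp only [eFun, ContinuousMap.smul_apply, smul_eq_mul, map_mul, Complex.conj_ofReal,
      character_neg]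
  simp only [h]
  rw [integral_const_mul, integral_character]
  simp only [neg_eq_zero]
  split_ifs
  · rw [← mul_assoc]
    exact_mod_cast normConst_sq d
  · simp

/-- A function of ξ alone has only the zero Fourier mode in x, and on the diagonal the Weyl midpoint
ħ(j + j)/2 is ħj. Continuity of V lets the integral be split. -/
theorem weylMatrix_sub {V : Torus d → Eucl d → ℝ} (hV : ∀ ξ, Continuous fun x => V x ξ)
    (ħ : ℝ) (R : Eucl d → ℝ) (j k : Fin d → ℤ) :
    weylMatrix ħ (fun x ξ => ((V x ξ - R ξ : ℝ) : ℂ)) j k =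
      weylMatrix ħ (fun x ξ => (V x ξ : ℂ)) j k - if j = k then (R (ħ • latticePt k) : ℂ) else 0 := by
  have h1 : ∀ ξ, symbolCoeff (fun x ξ => ((V x ξ - R ξ : ℝ) : ℂ)) (j - k) ξ =
      symbolCoeff (fun x ξ => (V x ξ : ℂ)) (j - k) ξ -
        R ξ * ∫ x : Torus d, conj (eFun (j - k) x) := by
    intro ξ
    have hc := hV ξ
    rw [symbolCoeff, symbolCoeff, ← integral_const_mul, ← integral_sub]
    · congr 1
      ext x
      push_cast
      ring
    · exact integrable_of_continuous_torus
        ((Complex.continuous_ofReal.comp hc).mul (Complex.continuous_conj.comp (eFun _).continuous))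
    · exact integrable_of_continuous_torus
        (continuous_const.mul (Complex.continuous_conj.comp (eFun _).continuous))
  rw [weylMatrix, weylMatrix, h1, mul_sub, mul_left_comm, normConst_mul_integral_conj_eFun]
  by_cases hjk : j = k
  · subst hjk
    have : (ħ / 2) • latticePt (j + j) = ħ • latticePt j := by
      rw [latticePt_add]; module
    simp [this]
  · simp [hjk, sub_eq_zero]

end Coefficients

/-! ### The counterterm and the renormalized operator -/

section Renormalization

variable {d : ℕ} {H : Type*} [NormedAddCommGroup H] [InnerProductSpace ℂ H] [CompleteSpace H]

/-- The symbol, for the left quantization, of the Weyl quantization of `g`. -/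
def leftSymbol (ħ : ℝ) (g : Torus d → Eucl d → ℂ) (k : Fin d → ℤ) (ξ : Eucl d) : ℂ :=
  (normConst d : ℂ) * symbolCoeff g k (ξ + (ħ / 2) • latticePt k)

theorem weylMatrix_eq_leftSymbol (ħ : ℝ) (g : Torus d → Eucl d → ℂ) (j k : Fin d → ℤ) :
    weylMatrix ħ g j k = leftSymbol ħ g (j - k) (0 + ħ • latticePt k) := by
  rw [weylMatrix, leftSymbol]
  congr 2
  rw [latticePt_add, latticePt_sub]
  module

/-- Weyl and left symbols differ by the translation ħk/2, which p ignores; the bound is thus uniform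
in ħ. -/
theorem symbNorm_leftSymbol_le {p : (Eucl d → ℂ) → ℝ≥0∞} (hp : IsWienerNorm p) {N : WienerData d}
    {K : ℝ≥0∞} (hK : ∀ f, BddCont f → p f ≤ K * normSW N f) {ρ : ℝ} (ħ : ℝ)
    {V : Torus d → Eucl d → ℝ} (hV : MemAW N ρ V) :
    symbNorm p ρ (leftSymbol ħ fun x ξ => (V x ξ : ℂ)) ≤
      K * normAW N ρ fun x ξ => (V x ξ : ℂ) := by
  rw [symbNorm, normAW, ← ENNReal.tsum_mul_left, ← ENNReal.tsum_mul_left]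
  refine ENNReal.tsum_le_tsum fun k => ?_
  have h1 : p (leftSymbol ħ (fun x ξ => (V x ξ : ℂ)) k) ≤ ENNReal.ofReal (normConst d) *
      (K * normSW N (symbolCoeff (fun x ξ => (V x ξ : ℂ)) k)) := by
    refine (hp.const_mul_le _ _).trans ?_
    rw [← ofReal_norm, Complex.norm_real, Real.norm_of_nonneg (normConst_pos d).le]
    gcongr
    exact (hp.translate_le _ _).trans (hK _ (hV.2.1 k).bddCont)
  rw [mul_comm ρ]
  calc _ ≤ _ := mul_le_mul_left h1 _
    _ = _ := by ring

theorem star_eq_of_symb_eq_leftSymbol {b : HilbertBasis (Fin d → ℤ) ℂ H} {ħ : ℝ} {V : Torus d → Eucl d → ℝ}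
    {A : covAlg b ħ} (hA : ∀ k ξ, symb A k ξ = leftSymbol ħ (fun x ξ => (V x ξ : ℂ)) k ξ) :
    star A = A := symb_ext fun k ξ => by
  rw [symb_star, hA, hA, leftSymbol, leftSymbol, map_mul, Complex.conj_ofReal, conj_symbolCoeff]
  congr 2
  rw [latticePt_neg]
  module

/-- A unitary element of the covariant algebra that commutes up to `U (A - R)` with `ω · k`
conjugates the renormalized operator to the free one. -/
theorem exists_unitaryConj_eq {b : HilbertBasis (Fin d → ℤ) ℂ H} {ω : Eucl d} {ħ ε : ℝ} (hħ : 0 < ħ) (hε : 0 < ε)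
    {V : Torus d → Eucl d → ℝ} (hV : ∀ ξ, Continuous fun x => V x ξ) {R : Eucl d → ℝ}
    {A U S : covAlg b ħ}
    (hA : ∀ k ξ, symb A k ξ = leftSymbol ħ (fun x ξ => (V x ξ : ℂ)) k ξ)
    (hU : star U * U = 1) (hU' : U * star U = 1) (hS : diagPart S = S)
    (hR : ∀ ξ, (R ξ : ℂ) = ((ħ / ε : ℝ) : ℂ) * symb S 0 ξ)
    (hder : IsDerivation ω U (U * (((ε / ħ : ℝ) : ℂ) • A - S))) :
    ∃ u : H ≃ₗᵢ[ℂ] H, unitaryConj u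
      ((matrixOp b fun j k => if j = k then ((ħ * inner ℝ ω (latticePt k) : ℝ) : ℂ) else 0) +
        (ε : ℂ) • matrixOp b (weylMatrix ħ fun x ξ => ((V x ξ - R ξ : ℝ) : ℂ))) =
      matrixOp b fun j k => if j = k then ((ħ * inner ℝ ω (latticePt k) : ℝ) : ℂ) else 0 := by
  have hħε : ((ε / ħ : ℝ) : ℂ) * ((ħ / ε : ℝ) : ℂ) = 1 := by
    rw [← Complex.ofReal_mul, div_mul_div_cancel₀ hħ.ne', div_self hε.ne', Complex.ofReal_one]
  set T : covAlg b ħ := A - ((ħ / ε : ℝ) : ℂ) • S with hT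
  have hTS : U * (((ε / ħ : ℝ) : ℂ) • A - S) = ((ε / ħ : ℝ) : ℂ) • (U * T) := by
    rw [← mul_smul_comm, hT, smul_sub, smul_smul, hħε, one_smul]
  -- The actual operator on the torus is the member of the covariant family at ξ = 0.
  have hW : weylMatrix ħ (fun x ξ => ((V x ξ - R ξ : ℝ) : ℂ)) = entry b (T.1 0) := by
    ext j k
    rw [weylMatrix_sub hV, weylMatrix_eq_leftSymbol, ← hA, entry_eq_symb, hT, symb_sub, symb_smul,
      ← hS, symb_diagPart, hR, zero_add]
    by_cases hjk : j = k
    · simp [hjk]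
    · simp [hjk, sub_eq_zero]
  let u : unitary (H →L[ℂ] H) := ⟨U.1 0,
    congrFun (congrArg Subtype.val hU) 0, congrFun (congrArg Subtype.val hU') 0⟩
  refine ⟨Unitary.linearIsometryEquiv u, ?_⟩
  rw [hW]
  refine unitaryConj_diagonal b u fun j k => ?_
  have h1 : entry b ((u : H →L[ℂ] H) * T.1 0) j k =
      symb (U * T) (j - k) (0 + ħ • latticePt k) := entry_eq_symb (U * T) 0 j k
  have h2 := hder (j - k) (0 + ħ • latticePt k)
  rw [hTS, symb_smul] at h2
  have h3 : entry b (u : H →L[ℂ] H) j k =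
      symb U (j - k) (0 + ħ • latticePt k) := entry_eq_symb U 0 j k
  rw [h1, h3]
  have hħ' : (ħ : ℂ) ≠ 0 := by exact_mod_cast hħ.ne'
  rw [latticePt_sub, inner_sub_right] at h2
  push_cast at h2 ⊢
  rw [div_mul_eq_mul_div, div_eq_iff hħ'] at h2
  rw [h2]
  ring

theorem exists_counterterm (b : HilbertBasis (Fin d → ℤ) ℂ H) (N : WienerData d) {ρ ς : ℝ} (γ : ℝ) (hρ : 0 < ρ) (hς : 0 < ς) :
    ∃ δ : ℝ, 0 < δ ∧ ∀ ω : Eucl d, IsDiophantine ς γ ω →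
      ∀ V : Torus d → Eucl d → ℝ, MemAW N ρ V → ∀ ħ ε : ℝ, 0 < ħ → 0 < ε →
        ε * (normAW N ρ fun x ξ => (V x ξ : ℂ)).toReal ≤ δ * ħ →
        ∃ (u : H ≃ₗᵢ[ℂ] H) (R : Eucl d → ℝ),
          (MemSW N (fun ξ => (R ξ : ℂ)) ∧
            normSW N (fun ξ => (R ξ : ℂ)) ≤ 2 * normAW N ρ fun x ξ => (V x ξ : ℂ)) ∧
          unitaryConj u
      ((matrixOp b fun j k => if j = k then ((ħ * inner ℝ ω (latticePt k) : ℝ) : ℂ) else 0) +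
        (ε : ℂ) • matrixOp b (weylMatrix ħ fun x ξ => ((V x ξ - R ξ : ℝ) : ℂ))) =
      matrixOp b fun j k => if j = k then ((ħ * inner ℝ ω (latticePt k) : ℝ) : ℂ) else 0 := by
  obtain ⟨p, hp, K₀, hK₀, hle, hge⟩ := exists_isWienerNorm_equiv N
  set K : ℝ := K₀.toReal + 1 with hK
  have hK1 : 1 ≤ K := by have := ENNReal.toReal_nonneg (a := K₀); linarith
  have hKle : K₀ ≤ ENNReal.ofReal K := by
    rw [← ENNReal.ofReal_toReal hK₀]
    exact ENNReal.ofReal_le_ofReal (by linarith)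
  set τ := ⌈γ - 1⌉₊
  set c : ℝ := Nat.factorial τ / ς with hc
  have hcpos : 0 < c := by positivity
  set M : ℝ := 320 * (c * (4 / ρ) ^ τ) * 2 ^ τ with hM
  have hMpos : 0 < M := by positivity
  -- Chosen so that the quadratic part of R, of norm at most (ħ/ε) K · 2M ((ε/ħ) K v)² = 2 M K³
  -- (ε/ħ) v · v, is at most v. As K ≥ 1, the smallness condition of the Newton scheme follows as
  -- well.
  refine ⟨(2 * M * K ^ 3)⁻¹, by positivity, fun ω hω V hV ħ ε hħ hε hsmall => ?_⟩
  set v : ℝ := (normAW N ρ fun x ξ => (V x ξ : ℂ)).toReal with hv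
  have hv0 : 0 ≤ v := ENNReal.toReal_nonneg
  have hvV : (normAW N ρ fun x ξ => (V x ξ : ℂ)) = ENNReal.ofReal v :=
    (ENNReal.ofReal_toReal hV.2.2.ne).symm
  have hl : 2 * M * K ^ 3 * (ε / ħ * v) ≤ 1 := by
    have h1 : ε / ħ * v ≤ (2 * M * K ^ 3)⁻¹ := by
      rw [div_mul_eq_mul_div, div_le_iff₀ hħ]; exact hsmall
    calc _ ≤ 2 * M * K ^ 3 * (2 * M * K ^ 3)⁻¹ := by gcongr
      _ = 1 := mul_inv_cancel₀ (by positivity)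
  have hnorm : symbNorm p ρ (leftSymbol ħ fun x ξ => (V x ξ : ℂ)) ≤ ENNReal.ofReal (K * v) := by
    rw [ENNReal.ofReal_mul (by positivity), ← hvV]
    exact (symbNorm_leftSymbol_le hp hge ħ hV).trans (by gcongr)
  obtain ⟨A, hA⟩ := exists_symb_eq_of_norm (b := b) (ħ := ħ) hp _ hρ.le
    (ne_top_of_le_ne_top ENNReal.ofReal_ne_top hnorm)
  have hAb : SymbBound p ρ A (K * v) := by
    refine ⟨by positivity, ?_⟩
    rwa [show symb A = _ from funext fun k => funext (hA k)]
  have hS := kamScale_covAlg (b := b) (ħ := ħ) hp ω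
  have hVb := hS.smul ((ε / ħ : ℝ) : ℂ) hAb
  rw [Complex.norm_real, Real.norm_of_nonneg (by positivity)] at hVb
  have hVs : star (((ε / ħ : ℝ) : ℂ) • A) = ((ε / ħ : ℝ) : ℂ) • A := by
    rw [star_smul, star_eq_of_symb_eq_leftSymbol hA, Complex.star_def, Complex.conj_ofReal]
  obtain ⟨U, S, hU, hU', hSs, hSD, hSb, hder⟩ := hS.exists_conjugation hρ hcpos.le
    (fun r r' B y hr' hr hD hs hB => exists_homological_solution hp hς hω hr' hr hD hs hB)
    hVb hVs hM (by
      have hKK : K ≤ 2 * K ^ 3 := by nlinarith [sq_nonneg K]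
      calc M * (ε / ħ * (K * v)) = M * K * (ε / ħ * v) := by ring
        _ ≤ M * (2 * K ^ 3) * (ε / ħ * v) := by gcongr
        _ = 2 * M * K ^ 3 * (ε / ħ * v) := by ring
        _ ≤ 1 := hl)
  set R : Eucl d → ℝ := fun ξ => ħ / ε * (symb S 0 ξ).re with hRdef
  have hR : ∀ ξ, (R ξ : ℂ) = ((ħ / ε : ℝ) : ℂ) * symb S 0 ξ := by
    intro ξ
    have h := symb_star S 0 ξ
    rw [hSs, neg_zero, latticePt_zero, smul_zero, add_zero] at h
    rw [hRdef, Complex.ofReal_mul, Complex.conj_eq_iff_re.1 h.symm]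
  obtain ⟨u, hu⟩ := exists_unitaryConj_eq hħ hε
    (continuous_of_continuous_toTorus hV.1.continuous) hA hU hU' hSD hR hder
  refine ⟨u, R, ?_, hu⟩
  -- R is the mean of V in x plus (ħ/ε) f with f quadratic in ε/ħ. Only f passes through the
  -- equivalent norm; the mean is bounded in ‖·‖_W with constant 1.
  set f : Eucl d → ℂ := symb (S - diagPart (((ε / ħ : ℝ) : ℂ) • A)) 0 with hf
  set g : Eucl d → ℂ := symbolCoeff (fun x ξ => (V x ξ : ℂ)) 0 with hg
  have hpf : p f ≤ ENNReal.ofReal (2 * (M * (ε / ħ * (K * v)) ^ 2)) := by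
    refine le_trans ?_ hSb.2
    refine le_trans (le_of_eq ?_) (ENNReal.le_tsum 0)
    simp [hf]
  have hfb : BddCont f := hp.bddCont f (ne_top_of_le_ne_top ENNReal.ofReal_ne_top hpf)
  have hgb : BddCont g := (hV.2.1 0).bddCont
  have hRfg : (fun ξ => (R ξ : ℂ)) =
      fun ξ => (normConst d : ℂ) * g ξ + ((ħ / ε : ℝ) : ℂ) * f ξ := by
    ext ξ
    have hħε : ((ħ / ε : ℝ) : ℂ) * ((ε / ħ : ℝ) : ℂ) = 1 := by
      rw [← Complex.ofReal_mul, div_mul_div_cancel₀ hε.ne', div_self hħ.ne', Complex.ofReal_one]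
    rw [hR, hf, symb_sub, symb_diagPart, if_pos rfl, symb_smul, hA, leftSymbol, latticePt_zero,
      smul_zero, add_zero, mul_sub, ← mul_assoc _ (((ε / ħ : ℝ) : ℂ)), hħε, one_mul]
    ring
  have hb1 : normSW N (fun ξ => (normConst d : ℂ) * g ξ) ≤
      normAW N ρ fun x ξ => (V x ξ : ℂ) := by
    refine (normSW_const_mul_le N _ _).trans ?_
    rw [← ofReal_norm, Complex.norm_real, Real.norm_of_nonneg (normConst_pos d).le]
    exact normConst_mul_normSW_le_normAW N ρ _
  have hb2 : normSW N (fun ξ => ((ħ / ε : ℝ) : ℂ) * f ξ) ≤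
      normAW N ρ fun x ξ => (V x ξ : ℂ) := by
    refine (normSW_const_mul_le N _ _).trans ?_
    rw [← ofReal_norm, Complex.norm_real, Real.norm_of_nonneg (by positivity), hvV]
    calc ENNReal.ofReal (ħ / ε) * normSW N f
        ≤ ENNReal.ofReal (ħ / ε) * (ENNReal.ofReal K *
            ENNReal.ofReal (2 * (M * (ε / ħ * (K * v)) ^ 2))) := by
          gcongr
          exact (hle f).trans (by gcongr)
      _ = ENNReal.ofReal (2 * M * K ^ 3 * (ε / ħ * v) * v) := by
          rw [← ENNReal.ofReal_mul (by positivity), ← ENNReal.ofReal_mul (by positivity)]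
          congr 1
          field_simp
      _ ≤ ENNReal.ofReal v := ENNReal.ofReal_le_ofReal (mul_le_of_le_one_left hv0 hl)
  have hb : normSW N (fun ξ => (R ξ : ℂ)) ≤ 2 * normAW N ρ fun x ξ => (V x ξ : ℂ) := by
    rw [hRfg, two_mul]
    exact (normSW_add_le N (hgb.const_mul _) (hfb.const_mul _)).trans (add_le_add hb1 hb2)
  have hRb : BddCont fun ξ => (R ξ : ℂ) := by
    rw [hRfg]
    exact (hgb.const_mul _).add (hfb.const_mul _)
  exact ⟨⟨hRb.1, hRb.2, hb.trans_lt (ENNReal.mul_lt_top (by simp) hV.2.2)⟩, hb⟩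

end Renormalization

end TorusKAM

end

/-! ### The main theorem -/

theorem mainTheorem6 {d : ℕ} (N : TorusKAM.WienerData d) {ρ ς γ : ℝ}
    (hρ : 0 < ρ) (hς : 0 < ς) (hγ : (d : ℝ) < γ) :
    ∃ δ : ℝ, 0 < δ ∧
      ∀ ω : TorusKAM.Eucl d, TorusKAM.IsDiophantine ς γ ω →
      ∀ V : TorusKAM.Torus d → TorusKAM.Eucl d → ℝ, TorusKAM.MemAW N ρ V →
      ∀ ε : ℝ → ℝ, (∀ ħ ∈ Set.Ioc (0 : ℝ) 1, 0 < ε ħ) →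
        Filter.Tendsto (fun ħ => ε ħ / ħ) (nhdsWithin 0 (Set.Ioi 0)) (nhds 0) →
      ∃ (U : ℝ → (TorusKAM.L2 d ≃ₗᵢ[ℂ] TorusKAM.L2 d)) (R : ℝ → TorusKAM.Eucl d → ℝ),
        (∀ ħ ∈ Set.Ioc (0 : ℝ) 1,
          TorusKAM.MemSW N (fun ξ => (R ħ ξ : ℂ)) ∧
          TorusKAM.normSW N (fun ξ => (R ħ ξ : ℂ)) ≤
            2 * TorusKAM.normAW N ρ (fun x ξ => (V x ξ : ℂ))) ∧
        (∃ ħ₀ ∈ Set.Ioc (0 : ℝ) 1, ∀ ħ ∈ Set.Ioc (0 : ℝ) ħ₀,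
          TorusKAM.unitaryConj (U ħ) (TorusKAM.renormalizedOp ω ħ (ε ħ) V (R ħ)) =
            TorusKAM.freeOp ω ħ) ∧
        (∀ ħ ∈ Set.Ioc (0 : ℝ) 1,
          ε ħ * (TorusKAM.normAW N ρ (fun x ξ => (V x ξ : ℂ))).toReal ≤ δ * ħ →
          TorusKAM.unitaryConj (U ħ) (TorusKAM.renormalizedOp ω ħ (ε ħ) V (R ħ)) =
            TorusKAM.freeOp ω ħ) := by
  obtain ⟨δ, hδ, h⟩ := TorusKAM.exists_counterterm (TorusKAM.basis d) N γ hρ hς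
  refine ⟨δ, hδ, fun ω hω V hV ε hε hlim => ?_⟩
  set v := (TorusKAM.normAW N ρ (fun x ξ => (V x ξ : ℂ))).toReal
  have h' : ∀ ħ : ℝ, ∃ (u : TorusKAM.L2 d ≃ₗᵢ[ℂ] TorusKAM.L2 d) (R : TorusKAM.Eucl d → ℝ),
      (TorusKAM.MemSW N (fun ξ => (R ξ : ℂ)) ∧
        TorusKAM.normSW N (fun ξ => (R ξ : ℂ)) ≤
          2 * TorusKAM.normAW N ρ (fun x ξ => (V x ξ : ℂ))) ∧
      (ħ ∈ Set.Ioc (0 : ℝ) 1 → ε ħ * v ≤ δ * ħ →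
        TorusKAM.unitaryConj u (TorusKAM.renormalizedOp ω ħ (ε ħ) V R) =
          TorusKAM.freeOp ω ħ) := by
    intro ħ
    by_cases hħ : ħ ∈ Set.Ioc (0 : ℝ) 1 ∧ ε ħ * v ≤ δ * ħ
    · obtain ⟨u, R, hR, hu⟩ := h ω hω V hV ħ (ε ħ) hħ.1.1 (hε ħ hħ.1) hħ.2
      exact ⟨u, R, hR, fun _ _ => hu⟩
    -- Outside the smallness regime only the bound on R is claimed, and the identity with R = 0
    -- satisfies it.
    · have h0 := TorusKAM.memSW_zero N
      refine ⟨LinearIsometryEquiv.refl ℂ _, fun _ => 0, ?_, fun h1 h2 => absurd ⟨h1, h2⟩ hħ⟩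
      simp only [Complex.ofReal_zero]
      exact ⟨h0.1, by simp [h0.2]⟩
  choose U R hR hU using h'
  refine ⟨U, R, fun ħ _ => hR ħ, ?_, hU⟩
  have hlim' : Filter.Tendsto (fun ħ => ε ħ / ħ * v) (nhdsWithin 0 (Set.Ioi 0)) (nhds 0) := by
    simpa using hlim.mul_const v
  -- ε_ħ/ħ → 0 forces the quantitative smallness condition on some interval (0, a], so the claim for
  -- small ħ reduces to the quantitative one.
  obtain ⟨a, ha, hsub⟩ := mem_nhdsGT_iff_exists_Ioc_subset.1 (hlim'.eventually_le_const hδ)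
  refine ⟨min a 1, ⟨lt_min ha one_pos, min_le_right _ _⟩, fun ħ hħ => ?_⟩
  refine hU ħ ⟨hħ.1, hħ.2.trans (min_le_right _ _)⟩ ?_
  have h1 : ε ħ / ħ * v ≤ δ := hsub ⟨hħ.1, hħ.2.trans (min_le_left _ _)⟩
  rwa [div_mul_eq_mul_div, div_le_iff₀ hħ.1] at h1
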